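/- **Setting.** Let $\mathcal Z$ be a measurable space, $d\ge 0$, $\Theta=\mathbb R^d$, $n,T\ge 1$, and let $\ell:\mathcal Z\times\Theta\to[0,C]$ ($C>0$) be a measurable loss. For a probability distribution $P$ on $\mathcal Z$ put $R_P(\theta)=\mathbb E_{Z\sim P}[\ell(Z,\theta)]$ and $R_P^*=\inf_\theta R_P(\theta)$. Let $\mathcal P$ be a probability distribution on the set of probability distributions on $\mathcal Z$, and let $P\mapsto\mu_P\in\Theta$ be measurable with $R_P(\mu_P)=R_P^*$ for $\mathcal P$-a.e. $P$. Assume that there are constants $c,L>0$ such that for $\mathcal P$-a.e. $P$ and all $\theta\in\Theta$, $$\mathbb E_{Z\sim P}\big[|\ell(Z,\theta)-\ell(Z,\mu_P)|^2\big]\le c\,(R_P(\theta)-R_P^*)\quad\text{(Bernstein's condition)},\qquad R_P(\theta)-R_P^*\le L\|\theta-\mu_P\|^2 .$$ Let $\alpha=\beta=\frac1{C+c}$. **Within-task algorithm.** For a sample $S=(Z_1,\dots,Z_n)$ and a prior $\pi$ on $\Theta$, let $\hat R_S(\theta)=\frac1n\sum_i\ell(Z_i,\theta)$ and $\hat{\mathcal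 R}_S(\rho,\pi)=\mathbb E_{\theta\sim\rho}[\hat R_S(\theta)]+\frac{\mathrm{KL}(\rho\|\pi)}{\alpha n}$, and let the Gibbs posterior $\rho_S(\pi)$ be the minimizer of $\rho\mapsto\hat{\mathcal R}_S(\rho,\pi)$ over all probability distributions on $\Theta$. The meta-risk of $\pi$ is $\mathcal E(\pi)=\mathbb E_{P\sim\mathcal P}\mathbb E_{S\sim P^{\otimes n}}\mathbb E_{\theta\sim\rho_S(\pi)}[R_P(\theta)]$, and $\mathcal E^*=\mathbb E_{P\sim\mathcal P}[R_P^*]$. **Meta algorithm.** The priors are finite Gaussian mixtures $\pi=\sum_{k=1}^K w_k\,\mathcal N(\mu_k,\sigma_k^2I_d)$; distributions on priors are distributions of the parameters $(K,w,\mu,\sigma^2)$. Let $\mathcal G$ be the set of all distributions $q_{x,\delta,\tau,\xi^2,b}$ under which $K\in\{1,\dots,T\}$ is drawn with probabilities $(x_1,\dots,x_T)$ ($x_K\ge0$, $\sum_K x_K=1$) and, given $K$, $$(w,\mu,\sigma^2)\sim \mathrm{Dir}(\delta_1,\dots,\delta_K)\otimes\bigotimes_{k\le K,\,i\le d}\mathcal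 N(\tau_{k,i},\xi_k^2)\otimes\bigotimes_{k\le K}\Gamma(2,b_k)$$ (shape $2$, rate $b_k$), with $\delta_k,\xi_k^2,b_k>0$ and $\tau_{k,i}\in\mathbb R$ all allowed to depend on $K$. Let $\Lambda\in\mathcal G$ be the element with $x_K=1/T$, $\delta_k=1$, $\tau_k=0$, $\xi_k^2=\bar{\bar\xi}_k^2$, $b_k=\bar{\bar b}_k$, where $\bar{\bar\xi}_k^2,\bar{\bar b}_k>0$ are fixed (and may depend on $K$). Draw $P_1,\dots,P_T$ i.i.d. from $\mathcal P$ and, given them, independent samples $S_t\sim P_t^{\otimes n}$, and let $\hat\Pi$, depending measurably on the data, be a minimizer over $\Pi\in\mathcal G$ of $$\frac1T\sum_{t=1}^T\mathbb E_{\pi\sim\Pi}\big[\hat{\mathcal R}_{S_t}(\rho_{S_t}(\pi),\pi)\big]+\frac{\mathrm{KL}(\Pi\|\Lambda)}{\beta T}.$$ **Claim.** For $K\in\{1,\dots,T\}$ let $\Sigma_K(\mathcal P)=\inf_{\tau_1,\dots,\tau_K\in\mathbb R^d}\mathbb E_{P\sim\mathcal P}[\min_{k\le K}\|\mu_P-\tau_k\|^2]\in[0,\infty]$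 and let $\tau_1,\dots,\tau_K$ (depending on $K$) attain this infimum. Then $$\mathbb E_{P_1,\dots,P_T}\mathbb E_{S_1,\dots,S_T}\mathbb E_{\pi\sim\hat\Pi}[\mathcal E(\pi)]-\mathcal E^*\le\min_{1\le K\le T}\Big\{\mathrm{CV}_{\rm finite}(K,n)+K\,\mathrm{CV}_{\rm Gaussian}(d,\Sigma_K(\mathcal P),n,T)+\mathrm{CV}_{\rm meta}(K)+\frac{2\log T}{\beta T}\Big\},$$ where $\mathrm{CV}_{\rm finite}(K,n)=\frac{4\log(2K)}{\alpha n}$, $$\mathrm{CV}_{\rm Gaussian}(d,\Sigma,n,T)=\begin{cases}\frac{8Ld}{T}+\frac{4}{\alpha T}&\text{if }\Sigma\le\frac n{T^2},\\[2pt] \frac{2d}{\alpha n}\log(1+4\alpha Ln)+\frac{4\Sigma}{\alpha n}&\text{otherwise},\end{cases}$$ $$\mathrm{CV}_{\rm meta}(K)=\frac{2K\log(2K)}{\beta T}+\frac1{\beta T}\sum_{k=1}^K\frac{\|\tau_k\|^2}{\bar{\bar\xi}_k^2}+\frac d{\beta T}\sum_{k=1}^K\log\Big(1+\frac{4\bar{\bar\xi}_k^2\beta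 T^2}{\alpha n}\Big)+\frac4{\beta T}\sum_{k=1}^K\Big(\log\frac T{\bar{\bar b}_k}+\bar{\bar b}_k-1\Big).$$ Moreover $\mathrm{CV}_{\rm meta}(K)=O\big(\frac{dK\log T}T\big)$: for all $0<m\le M$ there is a constant $A$ (depending only on $\alpha,\beta,m,M$) such that $\mathrm{CV}_{\rm meta}(K)\le A\frac{dK\log T}T$ for all $T\ge2$, $n,d\ge1$, $1\le K\le T$, whenever $\bar{\bar b}_k,\bar{\bar\xi}_k^2\in[m,M]$ and $\|\tau_k\|^2\le M$ for all $k\le K$. -/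

import Mathlib

open MeasureTheory ProbabilityTheory InformationTheory
open scoped ENNReal NNReal

noncomputable section

namespace MetaPAC

/-! The parameter space is `Θ = ℝ^d`, written `Fin d → ℝ`; Euclidean distances are written out
through `sqDist`.  Expectations of nonnegative quantities are `ℝ≥0∞`-valued integrals. -/

/-- Squared Euclidean distance on `ℝ^d`. -/
def sqDist {d : ℕ} (x y : Fin d → ℝ) : ℝ := ∑ i, (x i - y i) ^ 2

/-! ### Tasks, risks and Gibbs posteriors -/

section Tasks

variable {Z : Type*} [MeasurableSpace Z] {d : ℕ}

/-- Prediction risk `R_P(θ) = E_{Z ∼ P}[ℓ(Z, θ)]`. -/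
def risk (ℓ : Z → (Fin d → ℝ) → ℝ) (P : ProbabilityMeasure Z) (θ : Fin d → ℝ) : ℝ :=
  ∫ z, ℓ z θ ∂(P : Measure Z)

/-- `R_P^* = inf_θ R_P(θ)`. -/
def bestRisk (ℓ : Z → (Fin d → ℝ) → ℝ) (P : ProbabilityMeasure Z) : ℝ := ⨅ θ, risk ℓ P θ

/-- Empirical risk of `θ` on the sample `S`. -/
def empRisk {n : ℕ} (ℓ : Z → (Fin d → ℝ) → ℝ) (S : Fin n → Z) (θ : Fin d → ℝ) : ℝ :=
  (1 / (n : ℝ)) * ∑ i, ℓ (S i) θ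

/-- Penalized empirical risk `E_{θ ∼ ρ}[R̂(θ)] + KL(ρ ‖ π) / (α n)`. -/
def penEmpRisk {n : ℕ} (ℓ : Z → (Fin d → ℝ) → ℝ) (α : ℝ) (S : Fin n → Z)
    (ρ π : Measure (Fin d → ℝ)) : ℝ≥0∞ :=
  ∫⁻ θ, ENNReal.ofReal (empRisk ℓ S θ) ∂ρ + klDiv ρ π / ENNReal.ofReal (α * n)

/-- `ρ` is the Gibbs posterior `ρ(π, α)` computed from the sample `S`: it minimizes the penalized
empirical risk over all probability distributions on `ℝ^d`. -/
def IsGibbsPosterior {n : ℕ} (ℓ : Z → (Fin d → ℝ) → ℝ) (α : ℝ) (S : Fin n → Z)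
    (π ρ : Measure (Fin d → ℝ)) : Prop :=
  IsProbabilityMeasure ρ ∧
    ∀ ρ' : Measure (Fin d → ℝ), IsProbabilityMeasure ρ' →
      penEmpRisk ℓ α S ρ π ≤ penEmpRisk ℓ α S ρ' π

/-- Law of a sample of `n` independent observations from `P`. -/
def sampleLaw (n : ℕ) (P : ProbabilityMeasure Z) : Measure (Fin n → Z) :=
  Measure.pi fun _ => (P : Measure Z)

/-- Meta-risk `ℰ(π) = E_{P ∼ 𝓓} E_{S ∼ P^n} E_{θ ∼ ρ(π, α)}[R_P(θ)]` of the prior `π` on a new task,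
when `ρ S π` is the posterior computed from the sample `S` and the prior `π`. -/
def metaRisk {n : ℕ} (ℓ : Z → (Fin d → ℝ) → ℝ) (𝓓 : Measure (ProbabilityMeasure Z))
    (ρ : (Fin n → Z) → Measure (Fin d → ℝ) → Measure (Fin d → ℝ))
    (π : Measure (Fin d → ℝ)) : ℝ≥0∞ :=
  ∫⁻ P, ∫⁻ S, ∫⁻ θ, ENNReal.ofReal (risk ℓ P θ) ∂(ρ S π) ∂(sampleLaw n P) ∂𝓓

/-- Oracle meta-risk `ℰ^* = E_{P ∼ 𝓓}[R_P^*]`. -/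
def oracleRisk (ℓ : Z → (Fin d → ℝ) → ℝ) (𝓓 : Measure (ProbabilityMeasure Z)) : ℝ≥0∞ :=
  ∫⁻ P, ENNReal.ofReal (bestRisk ℓ P) ∂𝓓

/-- `E_{P ∼ 𝓓}[min_{k} ‖μ_P - τ_k‖²]`, where `μ_P = θstar P`. -/
def quantError (𝓓 : Measure (ProbabilityMeasure Z)) (θstar : ProbabilityMeasure Z → Fin d → ℝ)
    {K : ℕ} (τ : Fin K → Fin d → ℝ) : ℝ≥0∞ :=
  ∫⁻ P, ⨅ k, ENNReal.ofReal (sqDist (θstar P) (τ k)) ∂𝓓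

/-- `Σ_K(𝓓) = inf_{τ_1, …, τ_K} E_{P ∼ 𝓓}[min_{k} ‖μ_P - τ_k‖²]` (possibly infinite). -/
def sigmaK (𝓓 : Measure (ProbabilityMeasure Z)) (θstar : ProbabilityMeasure Z → Fin d → ℝ)
    (K : ℕ) : ℝ≥0∞ :=
  ⨅ τ : Fin K → Fin d → ℝ, quantError 𝓓 θstar τ

end Tasks

/-! ### Mixtures of Gaussians as priors, and distributions on them -/

/-- Parameters of a mixture of `K` isotropic Gaussians: weights `w`, means `μ`, variances `v`. -/
abbrev CompParam (d K : ℕ) : Type := (Fin K → ℝ) × (Fin K → Fin d → ℝ) × (Fin K → ℝ)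

/-- Parameters of a finite mixture with an arbitrary number `K` of components. -/
abbrev MixParam (d : ℕ) : Type := Σ K : ℕ, CompParam d K

/-- The prior `p_{w, μ, v} = ∑_k w_k N(μ_k, v_k I_d)` on `ℝ^d`. -/
def mixture {d : ℕ} (m : MixParam d) : Measure (Fin d → ℝ) :=
  ∑ k : Fin m.1, ENNReal.ofReal (m.2.1 k) •
    Measure.pi fun i => gaussianReal (m.2.2.1 k i) (m.2.2.2 k).toNNReal

/-- Dirichlet distribution `Dir(δ)`: the law of `(g_1, …, g_K) / (g_1 + … + g_K)` for independent
`g_k ∼ Γ(δ_k, 1)`. -/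
def dirichlet {K : ℕ} (δ : Fin K → ℝ) : Measure (Fin K → ℝ) :=
  (Measure.pi fun k => gammaMeasure (δ k) 1).map fun g k => g k / ∑ j, g j

/-- `q_{δ, τ, ξ², b | K}`: weights `Dir(δ)`, coordinates of the means `N(τ_{k,i}, ξ_k²)`, variances
`Γ(2, b_k)` (shape `2`, rate `b_k`), all independent. -/
def compHyper {d K : ℕ} (δ : Fin K → ℝ) (τ : Fin K → Fin d → ℝ) (ξ2 b : Fin K → ℝ) :
    Measure (CompParam d K) :=
  (dirichlet δ).prod
    ((Measure.pi fun k => Measure.pi fun i => gaussianReal (τ k i) (ξ2 k).toNNReal).prod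
      (Measure.pi fun k => gammaMeasure 2 (b k)))

/-- `q_{x, δ, τ, ξ², b}`: draw `K ∈ {1, …, T}` with probabilities `x_1, …, x_T`, then draw the
parameters of a mixture of `K` components from `q_{δ, τ, ξ², b | K}`; the parameters of the latter
may depend on `K`. -/
def hyper {d : ℕ} (T : ℕ) (x : ℕ → ℝ) (δ : ∀ K : ℕ, Fin K → ℝ) (τ : ∀ K : ℕ, Fin K → Fin d → ℝ)
    (ξ2 b : ∀ K : ℕ, Fin K → ℝ) : Measure (MixParam d) :=
  ∑ K ∈ Finset.Icc 1 T,
    ENNReal.ofReal (x K) • (compHyper (δ K) (τ K) (ξ2 K) (b K)).map (Sigma.mk K)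

/-- The set `𝒢` of distributions on priors. -/
def hyperSet (d T : ℕ) : Set (Measure (MixParam d)) :=
  {Q | ∃ (x : ℕ → ℝ) (δ : ∀ K : ℕ, Fin K → ℝ) (τ : ∀ K : ℕ, Fin K → Fin d → ℝ)
      (ξ2 b : ∀ K : ℕ, Fin K → ℝ),
      (∀ K ∈ Finset.Icc 1 T, 0 ≤ x K) ∧ ∑ K ∈ Finset.Icc 1 T, x K = 1 ∧
      (∀ K ∈ Finset.Icc 1 T, ∀ k, 0 < δ K k ∧ 0 < ξ2 K k ∧ 0 < b K k) ∧
      Q = hyper T x δ τ ξ2 b}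

/-- The prior on priors `Λ`: uniform `K ∈ {1, …, T}`, `Dir(1, …, 1)` weights, centred means with
variances `ξ0 K k`, and component variances `Γ(2, b0 K k)`. -/
def hyperPrior (d T : ℕ) (ξ0 b0 : ∀ K : ℕ, Fin K → ℝ) : Measure (MixParam d) :=
  hyper T (fun _ => 1 / (T : ℝ)) (fun _ _ => 1) (fun _ _ _ => 0) ξ0 b0

section MetaLearner

variable {Z : Type*} [MeasurableSpace Z] {d n T : ℕ}

/-- Criterion at the meta level,
`(1/T) ∑_t E_{π ∼ Q}[R̂_t(ρ_t(π, α), π, α)] + KL(Q ‖ Λ) / (β T)`. -/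
def metaCriterion (ℓ : Z → (Fin d → ℝ) → ℝ) (α β : ℝ)
    (ρ : (Fin n → Z) → Measure (Fin d → ℝ) → Measure (Fin d → ℝ))
    (Λ : Measure (MixParam d)) (S : Fin T → Fin n → Z) (Q : Measure (MixParam d)) : ℝ≥0∞ :=
  (∑ t, ∫⁻ m, penEmpRisk ℓ α (S t) (ρ (S t) (mixture m)) (mixture m) ∂Q) / (T : ℝ≥0∞)
    + klDiv Q Λ / ENNReal.ofReal (β * T)

/-- `Q̂` is the Gibbs distribution on priors: for all data it minimizes the meta criterion
over `𝒢`. -/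
def IsMetaGibbs (ℓ : Z → (Fin d → ℝ) → ℝ) (α β : ℝ)
    (ρ : (Fin n → Z) → Measure (Fin d → ℝ) → Measure (Fin d → ℝ))
    (Λ : Measure (MixParam d)) (Qhat : (Fin T → Fin n → Z) → Measure (MixParam d)) : Prop :=
  ∀ S, Qhat S ∈ hyperSet d T ∧
    ∀ Q ∈ hyperSet d T, metaCriterion ℓ α β ρ Λ S (Qhat S) ≤ metaCriterion ℓ α β ρ Λ S Q

/-- `E_{P_1, …, P_T} E_{S_1, …, S_T} E_{π ∼ Q̂}[ℰ(π)]`. -/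
def expectedMetaRisk (ℓ : Z → (Fin d → ℝ) → ℝ) (𝓓 : Measure (ProbabilityMeasure Z))
    (ρ : (Fin n → Z) → Measure (Fin d → ℝ) → Measure (Fin d → ℝ))
    (Qhat : (Fin T → Fin n → Z) → Measure (MixParam d)) : ℝ≥0∞ :=
  ∫⁻ P : Fin T → ProbabilityMeasure Z,
    ∫⁻ S : Fin T → Fin n → Z, ∫⁻ m, metaRisk ℓ 𝓓 ρ (mixture m) ∂(Qhat S)
      ∂(Measure.pi fun t => sampleLaw n (P t))
    ∂(Measure.pi fun _ => 𝓓)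

end MetaLearner

/-! ### The terms of the bound -/

/-- `CV_finite(K, n) = 4 log(2K) / (α n)`. -/
def cvFinite (α : ℝ) (K n : ℕ) : ℝ := 4 * Real.log (2 * K) / (α * n)

open scoped Classical in
/-- `CV_Gaussian(d, Σ, n, T)`. -/
def cvGaussian (α L : ℝ) (d : ℕ) (Sig : ℝ≥0∞) (n T : ℕ) : ℝ≥0∞ :=
  if Sig ≤ ENNReal.ofReal ((n : ℝ) / (T : ℝ) ^ 2) then
    ENNReal.ofReal (8 * L * d / T + 4 / (α * T))
  else
    ENNReal.ofReal (2 * d / (α * n) * Real.log (1 + 4 * α * L * n))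
      + ENNReal.ofReal (4 / (α * n)) * Sig

/-- `CV_meta(T, n, d, K, b0, ξ0, τ)`. -/
def cvMeta (α β : ℝ) (T n d K : ℕ) (b0 ξ0 : Fin K → ℝ) (τ : Fin K → Fin d → ℝ) : ℝ :=
  2 * K * Real.log (2 * K) / (β * T)
    + 1 / (β * T) * ∑ k, sqDist (τ k) 0 / ξ0 k
    + d / (β * T) * ∑ k, Real.log (1 + 4 * ξ0 k * β * (T : ℝ) ^ 2 / (α * n))
    + 4 / (β * T) * ∑ k, (Real.log (T / b0 k) + b0 k - 1)

/-- `CV_meta^unknown = CV_meta + 2 log T / (β T)`. -/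
def cvMetaUnknown (α β : ℝ) (T n d K : ℕ) (b0 ξ0 : Fin K → ℝ) (τ : Fin K → Fin d → ℝ) : ℝ :=
  cvMeta α β T n d K b0 ξ0 τ + 2 * Real.log T / (β * T)

end MetaPAC

end

noncomputable section
namespace MetaPAC
section

/-! ### Elementary inequalities -/

/-! Notation: R̂_S is the empirical risk, N_S(π) = -log(∫ exp(-αn R̂_S) dπ)/(αn) the minimum of the
penalized empirical risk (`freeEnergy`), F(π) the meta-risk, O the oracle risk. By the Gibbs
variational formula the posterior is the exponential tilting of π, so the criterion of the
meta-learner is an average of the N_{S_t}(π) plus a divergence. Here β = α.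

The core is an exponential moment with one factor α per task, instead of αn: for every fixed prior
π, E_P E_S exp(α((F(π) - O)/2 + R̂_S(μ_P) - N_S(π))) ≤ 1 (`integral_integral_exp_le_one`). Within a
task, Bernstein's condition and αc = 1 - αC give E_S exp(αn(γ r(θ) - R̂_S(θ) + R̂_S(μ_P))) ≤ 1,
where r is the excess risk and γ = 1/2 + x/4 + x²/4 with x = αC. Average this over θ ∼ π and call
the random variable Y, so E_S Y ≤ 1. Rewriting Y under the Gibbs posterior and applying Jensen's
inequality gives exp(α(R̂_S(μ_P) - N_S)) ≤ Y^{1/n} exp(-γαm), with m the excess risk of the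
posterior. For n ≥ 3 the right side is at most 1 + (Y - 1)/n - αm/2 (`exp_sub_le`). Its mean is
linear in m, so the average over tasks turns m into F(π) - O, and 1 - u ≤ e^{-u} concludes. For n ≤
2 the theorem is trivial, because CV_finite is already at least C.

Across tasks, these moments multiply by independence and are averaged over π ∼ Λ. The
Donsker-Varadhan inequality at the data-dependent Q̂, followed by the minimality of Q̂ against a
fixed Q in 𝒢, gives E[∫ F dQ̂] - O ≤ 2(∫ E[N] dQ - O) + 2 KL(Q ‖ Λ)/(αT)
(`lintegral_gibbsMetaRisk_le`).

It remains to choose Q for each K: a point mass at K, Dir(1,…,1) weights, means around the centres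
τ_k with variances ξ_k, and component variances Γ(2, b) with the same b for all k. The free energy
is bounded with a Gaussian centred at μ_P as posterior, compared only with the mixture component
nearest to μ_P (`integral_freeEnergy_mixture_le`). Averaging over Q leaves log(2K)/n, a term in d
log(1 + 4αnL/b)/n, and b Σ_K/n. Taking b = T or b = 1 produces the two cases of CV_Gaussian, and ξ_k
is chosen so that its own cost is absorbed by KL(Q ‖ Λ), which becomes CV_meta plus 2 log T/(βT). -/

theorem exp_le_one_add_add_mul_sq {x u : ℝ} (hu : |u| ≤ x) (hx : x ≤ 1) :
    Real.exp u ≤ 1 + u + (1 / 2 + x / 4) * u ^ 2 := by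
  -- The cubic Taylor remainder is at most (2/9)|u|³ on [-1, 1]; the constant is rounded up to 1/4
  -- below.
  have h := Real.exp_bound (hu.trans hx) (n := 3) (by norm_num)
  norm_num [Finset.sum_range_succ, Nat.factorial] at h
  have h1 := (abs_le.mp h).2
  have h2 : |u| ^ 3 ≤ x * u ^ 2 := by
    rw [pow_succ, sq_abs, mul_comm]
    exact mul_le_mul_of_nonneg_right hu (sq_nonneg u)
  nlinarith [sq_nonneg u, mul_nonneg ((abs_nonneg u).trans hu) (sq_nonneg u)]

/-- Equivalent to -log(1 - 3b/4) ≤ 3b/4 + 3b²/8 + 3b³/8 on [0, 1]. Replacing the exponential by its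
cubic Taylor polynomial leaves a polynomial inequality, settled by comparing all powers from the
third on with b³. -/
theorem exp_neg_le_one_sub {b : ℝ} (hb : 0 ≤ b) (hb1 : b ≤ 1) :
    Real.exp (-(3 / 2 * (1 / 2 + b / 4 + b ^ 2 / 4) * b)) ≤ 1 - 3 / 4 * b := by
  set u : ℝ := 3 / 2 * (1 / 2 + b / 4 + b ^ 2 / 4) * b with hu
  have hu0 : 0 ≤ u := by positivity
  have h1 : 1 + u + u ^ 2 / 2 + u ^ 3 / 6 ≤ Real.exp u := by
    have := Real.sum_le_exp_of_nonneg hu0 4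
    norm_num [Finset.sum_range_succ, Nat.factorial] at this
    linarith
  have h2 : 1 ≤ (1 - 3 / 4 * b) * (1 + u + u ^ 2 / 2 + u ^ 3 / 6) := by
    have hp : ∀ k, 3 ≤ k → b ^ k ≤ b ^ 3 := fun k hk => pow_le_pow_of_le_one hb hb1 hk
    have h3 : b ^ 3 ≤ b ^ 2 := pow_le_pow_of_le_one hb hb1 (by norm_num)
    have h0 : 0 ≤ b ^ 3 := by positivity
    have h4 := hp 4 (by norm_num)
    have h5 := hp 5 (by norm_num)
    have h6 := hp 6 (by norm_num)
    have h7 := hp 7 (by norm_num)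
    have h8 := hp 8 (by norm_num)
    have h9 := hp 9 (by norm_num)
    have h10 := hp 10 (by norm_num)
    rw [hu]
    ring_nf
    linarith
  rw [Real.exp_neg, inv_le_iff_one_le_mul₀ (Real.exp_pos u)]
  exact h2.trans (mul_le_mul_of_nonneg_left h1 (by linarith))

/-- Linearizes an n-th root: with e^{nv} = Y the right side is affine in both Y and b, so its
expectation needs only the means of Y and b. The loss e^{-γb} is split as h² and separated from e^v
by Young's inequality with exponents 3 and 3/2; this is why three observations are required. -/
theorem exp_sub_le {n : ℕ} (hn : 3 ≤ n) {x b : ℝ} (hx : x ≤ 1) (hb : 0 ≤ b) (hbx : b ≤ x) (v : ℝ) :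
    Real.exp (v - (1 / 2 + x / 4 + x ^ 2 / 4) * b)
      ≤ 1 + (Real.exp (n * v) - 1) / n - b / 2 := by
  have hn' : (3 : ℝ) ≤ n := by exact_mod_cast hn
  have h1 : (Real.exp v ^ 3 - 1) / 3 ≤ (Real.exp (n * v) - 1) / n := by
    -- Bernoulli's inequality for the base e^{3v} and the exponent n/3 ≥ 1.
    have := one_add_mul_self_le_rpow_one_add (s := Real.exp v ^ 3 - 1) (p := (n : ℝ) / 3)
      (by have := Real.exp_pos v; have : 0 < Real.exp v ^ 3 := by positivity
          linarith) (by linarith)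
    rw [add_sub_cancel, ← Real.exp_nat_mul, ← Real.exp_mul] at this
    rw [← Real.exp_nat_mul, div_le_div_iff₀ (by norm_num) (by linarith)]
    have e : (3 : ℕ) * v * (n / 3) = n * v := by push_cast; ring
    rw [e] at this
    push_cast at this ⊢
    linarith
  set h := Real.exp (-((1 / 2 + x / 4 + x ^ 2 / 4) * b / 2)) with hh
  have h2 : h ^ 3 ≤ 1 - 3 / 4 * b := by
    refine le_trans ?_ (exp_neg_le_one_sub hb (hbx.trans hx))
    rw [hh, ← Real.exp_nat_mul, Real.exp_le_exp]
    push_cast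
    have : (1 / 2 + b / 4 + b ^ 2 / 4) * b ≤ (1 / 2 + x / 4 + x ^ 2 / 4) * b := by gcongr
    linarith
  have h3 : Real.exp (v - (1 / 2 + x / 4 + x ^ 2 / 4) * b) = Real.exp v * h ^ 2 := by
    rw [hh, ← Real.exp_nat_mul, ← Real.exp_add]
    congr 1
    push_cast
    ring
  have h4 : Real.exp v * h ^ 2 ≤ Real.exp v ^ 3 / 3 + 2 / 3 * h ^ 3 := by
    -- Expands to e^{3v} - 3 e^v h² + 2h³, which is the required case of Young's inequality.
    have : 0 ≤ (Real.exp v - h) ^ 2 * (Real.exp v + 2 * h) := by positivity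
    nlinarith
  rw [h3]
  linarith

end

section

/-! ### Kullback-Leibler divergence -/

section KL

variable {Ω : Type*} [MeasurableSpace Ω] {μ ν : Measure Ω}

/-- Tilting the reference measure subtracts f from the log-likelihood ratio and adds the
log-normalizer. Nonnegativity of the resulting divergence is Donsker-Varadhan; its vanishing
identifies the Gibbs minimizer. -/
theorem klDiv_tilted_right [IsProbabilityMeasure μ] [IsProbabilityMeasure ν] {f : Ω → ℝ}
    (h : klDiv μ ν ≠ ∞) (hfμ : Integrable f μ) (hfν : Integrable (fun x => Real.exp (f x)) ν) :
    klDiv μ (ν.tilted f) ≠ ∞ ∧ (klDiv μ (ν.tilted f)).toReal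
      = (klDiv μ ν).toReal - ∫ x, f x ∂μ + Real.log (∫ x, Real.exp (f x) ∂ν) := by
  obtain ⟨hac, hint⟩ := klDiv_ne_top_iff.mp h
  have hac' : μ ≪ ν.tilted f := hac.trans (absolutelyContinuous_tilted hfν)
  have := isProbabilityMeasure_tilted hfν
  refine ⟨klDiv_ne_top hac' (integrable_llr_tilted_right hac hfμ hint hfν), ?_⟩
  rw [toReal_klDiv_of_measure_eq hac' (by simp), toReal_klDiv_of_measure_eq hac (by simp),
    integral_llr_tilted_right hac hfμ hfν hint]

/-- Donsker-Varadhan inequality. -/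
theorem integral_le_klDiv_add_log [IsProbabilityMeasure μ] [IsProbabilityMeasure ν] {f : Ω → ℝ}
    (h : klDiv μ ν ≠ ∞) (hfμ : Integrable f μ) (hfν : Integrable (fun x => Real.exp (f x)) ν) :
    ∫ x, f x ∂μ ≤ (klDiv μ ν).toReal + Real.log (∫ x, Real.exp (f x) ∂ν) := by
  have := (klDiv_tilted_right h hfμ hfν).2
  have h0 : 0 ≤ (klDiv μ (ν.tilted f)).toReal := ENNReal.toReal_nonneg
  linarith

theorem klDiv_tilted_left_ne_top [IsProbabilityMeasure μ] {f : Ω → ℝ}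
    (hf : Integrable f (μ.tilted f)) (hexp : Integrable (fun x => Real.exp (f x)) μ) :
    klDiv (μ.tilted f) μ ≠ ∞ := by
  have hac := tilted_absolutelyContinuous μ f
  have := isProbabilityMeasure_tilted hexp
  refine klDiv_ne_top hac ?_
  rw [llr_def, integrable_congr (hac.ae_le (log_rnDeriv_tilted_left_self hexp))]
  exact hf.sub (integrable_const _)

/-- The Gibbs variational formula: the minimizer of `E_ρ[R] + KL(ρ ‖ π) / a` is the measure with
density proportional to `exp (- a R)` with respect to `π`. -/
theorem eq_tilted_of_isMin [IsProbabilityMeasure μ] [IsProbabilityMeasure ν] {R : Ω → ℝ} {C a : ℝ}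
    (ha : 0 < a) (hR : Measurable R) (hR0 : ∀ x, 0 ≤ R x) (hRC : ∀ x, R x ≤ C)
    (hmin : ∀ μ' : Measure Ω, IsProbabilityMeasure μ' →
      ∫⁻ x, ENNReal.ofReal (R x) ∂μ + klDiv μ ν / ENNReal.ofReal a
        ≤ ∫⁻ x, ENNReal.ofReal (R x) ∂μ' + klDiv μ' ν / ENNReal.ofReal a) :
    μ = ν.tilted (fun x => -(a * R x)) ∧
      ∫⁻ x, ENNReal.ofReal (R x) ∂μ + klDiv μ ν / ENNReal.ofReal a
        = ENNReal.ofReal (-(Real.log (∫ x, Real.exp (-(a * R x)) ∂ν) / a)) := by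
  set f : Ω → ℝ := fun x => -(a * R x) with hf
  have hfm : Measurable f := (hR.const_mul a).neg
  have hbd : ∀ x, ‖f x‖ ≤ a * C := fun x => by
    rw [hf, norm_neg, Real.norm_of_nonneg (mul_nonneg ha.le (hR0 x))]
    exact mul_le_mul_of_nonneg_left (hRC x) ha.le
  have hint : ∀ (m : Measure Ω) [IsFiniteMeasure m], Integrable f m := fun m _ =>
    Integrable.of_bound hfm.aestronglyMeasurable _ (Filter.Eventually.of_forall hbd)
  have hintR : ∀ (m : Measure Ω) [IsFiniteMeasure m], Integrable R m := fun m _ =>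
    Integrable.of_bound hR.aestronglyMeasurable C (Filter.Eventually.of_forall fun x => by
      rw [Real.norm_of_nonneg (hR0 x)]; exact hRC x)
  have hexp : Integrable (fun x => Real.exp (f x)) ν :=
    Integrable.of_bound hfm.exp.aestronglyMeasurable 1 (Filter.Eventually.of_forall fun x => by
      rw [Real.norm_of_nonneg (Real.exp_pos _).le, Real.exp_le_one_iff]
      exact neg_nonpos.mpr (mul_nonneg ha.le (hR0 x)))
  have hG := isProbabilityMeasure_tilted hexp
  -- On measures of finite divergence the objective equals (KL(m ‖ tilted) - log Z)/a, so minimizing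
  -- it means minimizing the divergence to the tilted measure.
  have key : ∀ m : Measure Ω, IsProbabilityMeasure m → klDiv m ν ≠ ∞ →
      ∫⁻ x, ENNReal.ofReal (R x) ∂m + klDiv m ν / ENNReal.ofReal a
        = ENNReal.ofReal (((klDiv m (ν.tilted f)).toReal
            - Real.log (∫ x, Real.exp (f x) ∂ν)) / a) ∧
      0 ≤ ((klDiv m (ν.tilted f)).toReal - Real.log (∫ x, Real.exp (f x) ∂ν)) / a := by
    intro m _ hm
    have h1 := (klDiv_tilted_right hm (hint m) hexp).2
    have h2 : ∫ x, f x ∂m = -(a * ∫ x, R x ∂m) := by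
      rw [hf, integral_neg, integral_const_mul]
    have h3 : ((klDiv m (ν.tilted f)).toReal - Real.log (∫ x, Real.exp (f x) ∂ν)) / a
        = ∫ x, R x ∂m + (klDiv m ν).toReal / a := by
      rw [h1, h2]; field_simp; ring
    have h4 : 0 ≤ ∫ x, R x ∂m := integral_nonneg hR0
    have h5 : 0 ≤ (klDiv m ν).toReal / a := by positivity
    refine ⟨?_, by rw [h3]; positivity⟩
    rw [h3, ENNReal.ofReal_add h4 h5, ofReal_integral_eq_lintegral_ofReal (hintR m)
      (Filter.Eventually.of_forall hR0), ENNReal.ofReal_div_of_pos ha, ENNReal.ofReal_toReal hm]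
  have hGtop := klDiv_tilted_left_ne_top (hint (ν.tilted f)) hexp
  obtain ⟨hG1, hG2⟩ := key _ hG hGtop
  rw [klDiv_self, ENNReal.toReal_zero, zero_sub, neg_div] at hG1 hG2
  have hle := hmin _ hG
  rw [hG1] at hle
  -- The tilted measure has a finite objective, so the minimizer has one too, which makes `key`
  -- applicable to it.
  have hμtop : klDiv μ ν ≠ ∞ := by
    intro h
    rw [h, ENNReal.top_div_of_ne_top ENNReal.ofReal_ne_top, add_top, top_le_iff] at hle
    exact ENNReal.ofReal_ne_top hle
  obtain ⟨h1, h2⟩ := key μ inferInstance hμtop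
  have h3 : (klDiv μ (ν.tilted f)).toReal ≤ 0 := by
    rw [h1, ENNReal.ofReal_le_ofReal_iff hG2, sub_div] at hle
    have := (div_le_iff₀ ha).mp (show (klDiv μ (ν.tilted f)).toReal / a ≤ 0 by linarith)
    linarith
  have h4 : klDiv μ (ν.tilted f) = 0 := by
    have := le_antisymm h3 ENNReal.toReal_nonneg
    exact ((ENNReal.toReal_eq_zero_iff _).mp this).resolve_right
      (klDiv_tilted_right hμtop (hint μ) hexp).1
  have h5 : μ = ν.tilted f := klDiv_eq_zero_iff.mp h4
  refine ⟨h5, ?_⟩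
  rw [h1, h4, ENNReal.toReal_zero, zero_sub, neg_div]

/-- A bound e^f on the density bounds the log-likelihood ratio by f almost everywhere. The work lies
in integrability: log r lies between 1 - 1/r and f, and 1/r is integrable under μ. All explicit
divergence bounds below pass through this lemma. -/
theorem klDiv_le_of_le_withDensity [IsProbabilityMeasure μ] [IsProbabilityMeasure ν] {f : Ω → ℝ}
    (hf : Measurable f) (hint : Integrable f μ)
    (hle : μ ≤ ν.withDensity fun x => ENNReal.ofReal (Real.exp (f x))) :
    klDiv μ ν ≤ ENNReal.ofReal (∫ x, f x ∂μ) := by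
  have hg : Measurable fun x => ENNReal.ofReal (Real.exp (f x)) := hf.exp.ennreal_ofReal
  have hac : μ ≪ ν := (Measure.absolutelyContinuous_of_le hle).trans
    (withDensity_absolutelyContinuous _ _)
  have h1 : μ.rnDeriv ν ≤ᵐ[ν] fun x => ENNReal.ofReal (Real.exp (f x)) := by
    refine ae_le_of_forall_setLIntegral_le_of_sigmaFinite (Measure.measurable_rnDeriv _ _) ?_
    intro s hs _
    rw [← withDensity_apply _ hs, ← withDensity_apply _ hs, Measure.withDensity_rnDeriv_eq _ _ hac]
    exact hle s
  have hpos := Measure.rnDeriv_pos hac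
  have hlt := hac.ae_le (Measure.rnDeriv_lt_top μ ν)
  have h2 : llr μ ν ≤ᵐ[μ] f := by
    filter_upwards [hac.ae_le h1, hpos, hlt] with x hx hp hl
    rw [llr, ← Real.log_exp (f x)]
    refine Real.log_le_log (ENNReal.toReal_pos hp.ne' hl.ne) ?_
    exact ENNReal.toReal_le_of_le_ofReal (Real.exp_pos _).le hx
  -- With r = dμ/dν, the integral of 1/r under μ equals that of r · r⁻¹ under ν, hence is at most 1.
  have h3 : Integrable (fun x => (μ.rnDeriv ν x).toReal⁻¹) μ := by
    refine ⟨(Measure.measurable_rnDeriv μ ν).ennreal_toReal.inv.aestronglyMeasurable, ?_⟩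
    rw [hasFiniteIntegral_iff_enorm]
    calc ∫⁻ x, ‖(μ.rnDeriv ν x).toReal⁻¹‖ₑ ∂μ
        = ∫⁻ x, (μ.rnDeriv ν x)⁻¹ ∂μ := by
          refine lintegral_congr_ae ?_
          filter_upwards [hpos, hlt] with x hp hl
          rw [← ENNReal.toReal_inv, Real.enorm_of_nonneg ENNReal.toReal_nonneg,
            ENNReal.ofReal_toReal (ENNReal.inv_ne_top.mpr hp.ne')]
      _ = ∫⁻ x, μ.rnDeriv ν x * (μ.rnDeriv ν x)⁻¹ ∂ν :=
          (lintegral_rnDeriv_mul hac (Measure.measurable_rnDeriv μ ν).inv.aemeasurable).symm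
      _ ≤ ∫⁻ _, 1 ∂ν := lintegral_mono fun x => ENNReal.mul_inv_le_one _
      _ < ∞ := by simp
  have h4 : Integrable (llr μ ν) μ := by
    refine Integrable.mono' (hint.norm.add ((integrable_const (1 : ℝ)).add h3))
      (measurable_llr μ ν).aestronglyMeasurable ?_
    filter_upwards [h2, hpos, hlt] with x hx hp hl
    have hr := ENNReal.toReal_pos hp.ne' hl.ne
    have := Real.one_sub_inv_le_log_of_pos hr
    have h0 := inv_pos.mpr hr
    simp only [Pi.add_apply, Real.norm_eq_abs]
    rw [abs_le]
    have := neg_abs_le (f x)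
    have := le_abs_self (f x)
    rw [llr] at hx ⊢
    constructor <;> linarith
  rw [klDiv_of_ac_of_integrable hac h4]
  simpa using ENNReal.ofReal_le_ofReal (integral_mono_ae h4 hint h2)

end KL

end

section

/-! ### Bounded losses, samples and Gibbs posteriors -/

/-- A measurable loss with values in `[0, C]`. -/
structure IsBoundedLoss {Z : Type*} [MeasurableSpace Z] {d : ℕ} (ℓ : Z → (Fin d → ℝ) → ℝ)
    (C : ℝ) : Prop where
  meas : Measurable (Function.uncurry ℓ)
  nonneg : ∀ z θ, 0 ≤ ℓ z θ
  le : ∀ z θ, ℓ z θ ≤ C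

theorem integrable_of_mem_Icc {Ω : Type*} [MeasurableSpace Ω] {μ : Measure Ω} [IsFiniteMeasure μ]
    {f : Ω → ℝ} (hf : Measurable f) {A B : ℝ} (hA : ∀ x, A ≤ f x) (hB : ∀ x, f x ≤ B) :
    Integrable f μ :=
  Integrable.of_bound hf.aestronglyMeasurable (max (-A) B) (Filter.Eventually.of_forall fun x => by
    rw [Real.norm_eq_abs, abs_le]
    exact ⟨by linarith [hA x, le_max_left (-A) B], (hB x).trans (le_max_right _ _)⟩)

theorem integral_mem_Icc {Ω : Type*} [MeasurableSpace Ω] {μ : Measure Ω} [IsProbabilityMeasure μ]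
    {f : Ω → ℝ} (hf : Measurable f) {A B : ℝ} (hA : ∀ x, A ≤ f x) (hB : ∀ x, f x ≤ B) :
    A ≤ ∫ x, f x ∂μ ∧ ∫ x, f x ∂μ ≤ B := by
  have hi := integrable_of_mem_Icc (μ := μ) hf hA hB
  constructor
  · simpa using integral_mono (integrable_const A) hi hA
  · simpa using integral_mono hi (integrable_const B) hB

theorem measurable_integral_kernel {X Y : Type*} [MeasurableSpace X] [MeasurableSpace Y]
    (κ : Kernel X Y) [IsSFiniteKernel κ] {f : X → Y → ℝ} (hf : Measurable (Function.uncurry f)) :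
    Measurable fun x => ∫ y, f x y ∂(κ x) :=
  (StronglyMeasurable.integral_kernel_prod_right' (κ := κ) hf.stronglyMeasurable).measurable

variable {Z : Type*} [MeasurableSpace Z] {d n : ℕ}

theorem measurable_sampleLaw (n : ℕ) :
    Measurable fun P : ProbabilityMeasure Z => sampleLaw n P := by
  have : ∀ P : ProbabilityMeasure Z, IsProbabilityMeasure (sampleLaw n P) := fun P => by
    unfold sampleLaw; infer_instance
  refine Measurable.measure_of_isPiSystem_of_isProbabilityMeasure generateFrom_pi.symm
    isPiSystem_pi ?_
  rintro _ ⟨s, hs, rfl⟩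
  simp only [sampleLaw, Measure.pi_pi]
  refine Finset.measurable_prod _ fun i _ => ?_
  exact (Measure.measurable_coe (hs i (Set.mem_univ i))).comp measurable_subtype_coe

/-- The observation kernel `P ↦ P`. -/
def taskKernel (Z : Type*) [MeasurableSpace Z] : Kernel (ProbabilityMeasure Z) Z :=
  ⟨fun P => (P : Measure Z), measurable_subtype_coe⟩

instance : IsMarkovKernel (taskKernel Z) := ⟨fun P => P.2⟩

/-- The kernel `P ↦ P^n`. -/
def sampleKernel (Z : Type*) [MeasurableSpace Z] (n : ℕ) :
    Kernel (ProbabilityMeasure Z) (Fin n → Z) :=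
  ⟨sampleLaw n, measurable_sampleLaw n⟩

instance (P : ProbabilityMeasure Z) : IsProbabilityMeasure (sampleLaw n P) := by
  unfold sampleLaw; infer_instance

instance : IsMarkovKernel (sampleKernel Z n) :=
  ⟨fun P => inferInstanceAs (IsProbabilityMeasure (sampleLaw n P))⟩

/-- Normalizing constant of the Gibbs posterior with inverse temperature `a`. -/
def gibbsPartition (ℓ : Z → (Fin d → ℝ) → ℝ) (a : ℝ) (S : Fin n → Z)
    (π : Measure (Fin d → ℝ)) : ℝ :=
  ∫ θ, Real.exp (-(a * empRisk ℓ S θ)) ∂π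

/-- Minimum of the penalized empirical risk. -/
def freeEnergy (ℓ : Z → (Fin d → ℝ) → ℝ) (a : ℝ) (S : Fin n → Z)
    (π : Measure (Fin d → ℝ)) : ℝ :=
  -(Real.log (gibbsPartition ℓ a S π) / a)

/-- Explicit form of the Gibbs posterior. -/
def gibbs (ℓ : Z → (Fin d → ℝ) → ℝ) (a : ℝ) (S : Fin n → Z)
    (π : Measure (Fin d → ℝ)) : Measure (Fin d → ℝ) :=
  π.tilted fun θ => -(a * empRisk ℓ S θ)

namespace IsBoundedLoss

variable {ℓ : Z → (Fin d → ℝ) → ℝ} {C : ℝ} (hℓ : IsBoundedLoss ℓ C)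
include hℓ

theorem measurable_left (θ : Fin d → ℝ) : Measurable fun z => ℓ z θ :=
  hℓ.meas.comp measurable_prodMk_right

theorem integrable (P : ProbabilityMeasure Z) (θ : Fin d → ℝ) :
    Integrable (fun z => ℓ z θ) (P : Measure Z) :=
  integrable_of_mem_Icc (hℓ.measurable_left θ) (hℓ.nonneg · θ) (hℓ.le · θ)

theorem risk_nonneg (P : ProbabilityMeasure Z) (θ : Fin d → ℝ) : 0 ≤ risk ℓ P θ :=
  (integral_mem_Icc (hℓ.measurable_left θ) (hℓ.nonneg · θ) (hℓ.le · θ)).1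

theorem risk_le (P : ProbabilityMeasure Z) (θ : Fin d → ℝ) : risk ℓ P θ ≤ C :=
  (integral_mem_Icc (hℓ.measurable_left θ) (hℓ.nonneg · θ) (hℓ.le · θ)).2

theorem bestRisk_le (P : ProbabilityMeasure Z) (θ : Fin d → ℝ) : bestRisk ℓ P ≤ risk ℓ P θ :=
  ciInf_le ⟨0, by rintro _ ⟨θ, rfl⟩; exact hℓ.risk_nonneg P θ⟩ θ

theorem measurable_risk :
    Measurable fun p : ProbabilityMeasure Z × (Fin d → ℝ) => risk ℓ p.1 p.2 := by
  refine measurable_integral_kernel ((taskKernel Z).comap Prod.fst measurable_fst)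
    (f := fun p z => ℓ z p.2) ?_
  exact hℓ.meas.comp (measurable_snd.prodMk measurable_fst.snd)

theorem measurable_risk_right (P : ProbabilityMeasure Z) : Measurable (risk ℓ P) :=
  hℓ.measurable_risk.comp measurable_prodMk_left

theorem measurable_empRisk :
    Measurable fun p : (Fin n → Z) × (Fin d → ℝ) => empRisk ℓ p.1 p.2 := by
  refine measurable_const.mul (Finset.measurable_sum _ fun i _ => ?_)
  have h : Measurable fun p : (Fin n → Z) × (Fin d → ℝ) => (p.1 i, p.2) := by fun_prop
  exact hℓ.meas.comp h

theorem measurable_empRisk_right (S : Fin n → Z) : Measurable (empRisk ℓ S) :=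
  hℓ.measurable_empRisk.comp measurable_prodMk_left

theorem measurable_empRisk_left (θ : Fin d → ℝ) : Measurable fun S : Fin n → Z => empRisk ℓ S θ :=
  hℓ.measurable_empRisk.comp measurable_prodMk_right

theorem empRisk_nonneg (S : Fin n → Z) (θ : Fin d → ℝ) : 0 ≤ empRisk ℓ S θ :=
  mul_nonneg (by positivity) (Finset.sum_nonneg fun i _ => hℓ.nonneg _ _)

theorem empRisk_le (hn : 0 < n) (S : Fin n → Z) (θ : Fin d → ℝ) : empRisk ℓ S θ ≤ C := by
  have hn' : (0 : ℝ) < n := by exact_mod_cast hn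
  have : ∑ i, ℓ (S i) θ ≤ n * C := by
    simpa using Finset.sum_le_sum fun i (_ : i ∈ Finset.univ) => hℓ.le (S i) θ
  rw [empRisk, one_div, inv_mul_le_iff₀ hn']
  exact this

theorem integral_empRisk (hn : 0 < n) (P : ProbabilityMeasure Z) (θ : Fin d → ℝ) :
    ∫ S : Fin n → Z, empRisk ℓ S θ ∂(sampleLaw n P) = risk ℓ P θ := by
  have hn' : (n : ℝ) ≠ 0 := by exact_mod_cast hn.ne'
  simp only [empRisk, sampleLaw]
  rw [integral_const_mul, integral_finsetSum]
  · have : ∀ i : Fin n, ∫ S : Fin n → Z, ℓ (S i) θ ∂(Measure.pi fun _ => (P : Measure Z))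
        = risk ℓ P θ := fun i =>
      integral_comp_eval (μ := fun _ : Fin n => (P : Measure Z)) (i := i) (f := fun z => ℓ z θ)
        (hℓ.measurable_left θ).aestronglyMeasurable
    simp only [this, Finset.sum_const, Finset.card_univ, Fintype.card_fin, nsmul_eq_mul]
    field_simp
  · intro i _
    exact integrable_of_mem_Icc ((hℓ.measurable_left θ).comp (measurable_pi_apply i))
      (fun S => hℓ.nonneg _ _) (fun S => hℓ.le _ _)

section Gibbs

variable {a : ℝ} (ha : 0 < a) (hn : 0 < n)
include ha hn

theorem exp_mem_Icc (S : Fin n → Z) (θ : Fin d → ℝ) :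
    Real.exp (-(a * C)) ≤ Real.exp (-(a * empRisk ℓ S θ)) ∧
      Real.exp (-(a * empRisk ℓ S θ)) ≤ 1 := by
  constructor
  · rw [Real.exp_le_exp, neg_le_neg_iff]
    exact mul_le_mul_of_nonneg_left (hℓ.empRisk_le hn S θ) ha.le
  · rw [Real.exp_le_one_iff, neg_nonpos]
    exact mul_nonneg ha.le (hℓ.empRisk_nonneg S θ)

theorem integrable_exp (S : Fin n → Z) (π : Measure (Fin d → ℝ)) [IsProbabilityMeasure π] :
    Integrable (fun θ => Real.exp (-(a * empRisk ℓ S θ))) π :=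
  integrable_of_mem_Icc ((hℓ.measurable_empRisk_right S).const_mul a).neg.exp
    (fun θ => (hℓ.exp_mem_Icc ha hn S θ).1) (fun θ => (hℓ.exp_mem_Icc ha hn S θ).2)

theorem gibbsPartition_mem_Icc (S : Fin n → Z) (π : Measure (Fin d → ℝ))
    [IsProbabilityMeasure π] :
    Real.exp (-(a * C)) ≤ gibbsPartition ℓ a S π ∧ gibbsPartition ℓ a S π ≤ 1 :=
  integral_mem_Icc ((hℓ.measurable_empRisk_right S).const_mul a).neg.exp
    (fun θ => (hℓ.exp_mem_Icc ha hn S θ).1) (fun θ => (hℓ.exp_mem_Icc ha hn S θ).2)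

theorem gibbsPartition_pos (S : Fin n → Z) (π : Measure (Fin d → ℝ)) [IsProbabilityMeasure π] :
    0 < gibbsPartition ℓ a S π :=
  (Real.exp_pos _).trans_le (hℓ.gibbsPartition_mem_Icc ha hn S π).1

theorem freeEnergy_mem_Icc (S : Fin n → Z) (π : Measure (Fin d → ℝ)) [IsProbabilityMeasure π] :
    0 ≤ freeEnergy ℓ a S π ∧ freeEnergy ℓ a S π ≤ C := by
  obtain ⟨h1, h2⟩ := hℓ.gibbsPartition_mem_Icc ha hn S π
  have h0 := hℓ.gibbsPartition_pos ha hn S π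
  have h3 := Real.log_nonpos h0.le h2
  have h4 := Real.log_le_log (Real.exp_pos _) h1
  rw [Real.log_exp] at h4
  rw [freeEnergy, ← neg_div]
  refine ⟨div_nonneg (by linarith) ha.le, ?_⟩
  rw [div_le_iff₀ ha]
  linarith

theorem isProbabilityMeasure_gibbs (S : Fin n → Z) (π : Measure (Fin d → ℝ))
    [IsProbabilityMeasure π] : IsProbabilityMeasure (gibbs ℓ a S π) :=
  isProbabilityMeasure_tilted (hℓ.integrable_exp ha hn S π)

theorem integral_risk_gibbs_mem_Icc (P : ProbabilityMeasure Z) (S : Fin n → Z)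
    (π : Measure (Fin d → ℝ)) [IsProbabilityMeasure π] :
    0 ≤ ∫ θ, risk ℓ P θ ∂(gibbs ℓ a S π) ∧ ∫ θ, risk ℓ P θ ∂(gibbs ℓ a S π) ≤ C := by
  have := hℓ.isProbabilityMeasure_gibbs ha hn S π
  exact integral_mem_Icc (hℓ.measurable_risk_right P) (hℓ.risk_nonneg P) (hℓ.risk_le P)

end Gibbs

theorem eq_gibbs {α : ℝ} (hα : 0 < α) (hn : 0 < n) {S : Fin n → Z} {π ρ : Measure (Fin d → ℝ)}
    [IsProbabilityMeasure π] (h : IsGibbsPosterior ℓ α S π ρ) :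
    ρ = gibbs ℓ (α * n) S π ∧
      penEmpRisk ℓ α S ρ π = ENNReal.ofReal (freeEnergy ℓ (α * n) S π) := by
  have hn' : (0 : ℝ) < n := by exact_mod_cast hn
  obtain ⟨hp, hmin⟩ := h
  exact eq_tilted_of_isMin (mul_pos hα hn') (hℓ.measurable_empRisk_right S) (hℓ.empRisk_nonneg S)
    (hℓ.empRisk_le hn S) hmin

/-- The free energy is a minimum over posteriors, so a trial ρ yields an upper bound. It is used
with a Gaussian concentrated near the best parameter of the task. -/
theorem freeEnergy_le {a : ℝ} (ha : 0 < a) (hn : 0 < n) (S : Fin n → Z)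
    (π ρ : Measure (Fin d → ℝ)) [IsProbabilityMeasure π] [IsProbabilityMeasure ρ]
    (hk : klDiv ρ π ≠ ∞) :
    freeEnergy ℓ a S π ≤ ∫ θ, empRisk ℓ S θ ∂ρ + (klDiv ρ π).toReal / a := by
  have hi : Integrable (empRisk ℓ S) ρ := integrable_of_mem_Icc (hℓ.measurable_empRisk_right S)
    (hℓ.empRisk_nonneg S) (hℓ.empRisk_le hn S)
  have h := integral_le_klDiv_add_log hk (f := fun θ => -(a * empRisk ℓ S θ))
    (hi.const_mul _).neg (hℓ.integrable_exp ha hn S π)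
  rw [integral_neg, integral_const_mul] at h
  rw [freeEnergy, ← neg_div, div_le_iff₀ ha, add_mul, div_mul_cancel₀ _ ha.ne', gibbsPartition]
  linarith

end IsBoundedLoss

end

section

/-! ### Exponential inequality within a task -/

/-- The exponential of n times an empirical mean factorizes over independent observations, and each
of the n factors contributes at most exp(-αg), cancelling exp(αng). -/
theorem integral_sample_exp_le_one {Z : Type*} [MeasurableSpace Z] {d n : ℕ}
    {ℓ : Z → (Fin d → ℝ) → ℝ} {α g : ℝ} (hn : 0 < n) (P : ProbabilityMeasure Z)
    (θ θ₀ : Fin d → ℝ)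
    (h : ∫ z, Real.exp (-(α * (ℓ z θ - ℓ z θ₀))) ∂(P : Measure Z) ≤ Real.exp (-(α * g))) :
    ∫ S : Fin n → Z, Real.exp (α * n * (g - empRisk ℓ S θ + empRisk ℓ S θ₀)) ∂(sampleLaw n P)
      ≤ 1 := by
  have hn' : (n : ℝ) ≠ 0 := by exact_mod_cast hn.ne'
  have h1 : ∀ S : Fin n → Z, Real.exp (α * n * (g - empRisk ℓ S θ + empRisk ℓ S θ₀))
      = Real.exp (α * n * g) * ∏ i, Real.exp (-(α * (ℓ (S i) θ - ℓ (S i) θ₀))) := by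
    intro S
    rw [← Real.exp_sum, ← Real.exp_add]
    congr 1
    simp only [empRisk, Finset.sum_neg_distrib, ← Finset.mul_sum, Finset.sum_sub_distrib]
    field_simp
    ring
  simp only [h1, sampleLaw]
  rw [integral_const_mul, integral_fintype_prod_eq_pow (ι := Fin n)
    (fun z => Real.exp (-(α * (ℓ z θ - ℓ z θ₀)))), Fintype.card_fin]
  calc Real.exp (α * n * g) * (∫ z, Real.exp (-(α * (ℓ z θ - ℓ z θ₀))) ∂(P : Measure Z)) ^ n
      ≤ Real.exp (α * n * g) * Real.exp (-(α * g)) ^ n := by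
        gcongr
    _ = 1 := by
        rw [← Real.exp_nat_mul, ← Real.exp_add, Real.exp_eq_one_iff]
        ring

namespace IsBoundedLoss

variable {Z : Type*} [MeasurableSpace Z] {d n : ℕ} {ℓ : Z → (Fin d → ℝ) → ℝ} {C : ℝ}
  (hℓ : IsBoundedLoss ℓ C)
include hℓ

/-- Expand the exponential to second order and control the second moment by Bernstein's condition.
Since αc = 1 - x, the coefficient of -αr is 1 - (1/2 + x/4)(1 - x) = 1/2 + x/4 + x²/4. -/
theorem integral_exp_neg_le {c α : ℝ} (hC : 0 < C) (hc : 0 < c) (hα : α = 1 / (C + c))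
    (P : ProbabilityMeasure Z) (θ θ₀ : Fin d → ℝ)
    (hB : ∫ z, |ℓ z θ - ℓ z θ₀| ^ 2 ∂(P : Measure Z) ≤ c * (risk ℓ P θ - risk ℓ P θ₀)) :
    ∫ z, Real.exp (-(α * (ℓ z θ - ℓ z θ₀))) ∂(P : Measure Z)
      ≤ Real.exp (-(α * (1 / 2 + α * C / 4 + (α * C) ^ 2 / 4) * (risk ℓ P θ - risk ℓ P θ₀))) := by
  have hα0 : 0 < α := by rw [hα]; positivity
  set x := α * C with hx
  have hxc : α * c = 1 - x := by rw [hx, hα]; field_simp; ring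
  have hx1 : x ≤ 1 := by nlinarith
  have hx0 : 0 < x := mul_pos hα0 hC
  set r := risk ℓ P θ - risk ℓ P θ₀ with hr
  have hm : Measurable fun z => ℓ z θ - ℓ z θ₀ := (hℓ.measurable_left θ).sub (hℓ.measurable_left θ₀)
  have hlo : ∀ z, -C ≤ ℓ z θ - ℓ z θ₀ := fun z => by linarith [hℓ.nonneg z θ, hℓ.le z θ₀]
  have hhi : ∀ z, ℓ z θ - ℓ z θ₀ ≤ C := fun z => by linarith [hℓ.nonneg z θ₀, hℓ.le z θ]
  have hi1 : Integrable (fun z => ℓ z θ - ℓ z θ₀) (P : Measure Z) := integrable_of_mem_Icc hm hlo hhi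
  have hi2 : Integrable (fun z => (ℓ z θ - ℓ z θ₀) ^ 2) (P : Measure Z) :=
    integrable_of_mem_Icc (hm.pow_const 2) (fun z => sq_nonneg _) (B := C ^ 2)
      (fun z => sq_le_sq' (hlo z) (hhi z))
  have h1 : ∫ z, (ℓ z θ - ℓ z θ₀) ∂(P : Measure Z) = r :=
    integral_sub (hℓ.integrable P θ) (hℓ.integrable P θ₀)
  have h2 : ∫ z, (ℓ z θ - ℓ z θ₀) ^ 2 ∂(P : Measure Z) ≤ c * r := by simpa only [sq_abs] using hB
  calc ∫ z, Real.exp (-(α * (ℓ z θ - ℓ z θ₀))) ∂(P : Measure Z)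
      ≤ ∫ z, (1 - α * (ℓ z θ - ℓ z θ₀) + (1 / 2 + x / 4) * α ^ 2 * (ℓ z θ - ℓ z θ₀) ^ 2)
          ∂(P : Measure Z) := by
        refine integral_mono ?_ (((integrable_const _).sub (hi1.const_mul _)).add
          (hi2.const_mul _)) fun z => ?_
        · refine integrable_of_mem_Icc (hm.const_mul α).neg.exp (fun z => (Real.exp_pos _).le)
            (B := Real.exp x) fun z => ?_
          rw [Real.exp_le_exp, hx]
          nlinarith [hlo z]
        · have := exp_le_one_add_add_mul_sq (x := x) (u := -(α * (ℓ z θ - ℓ z θ₀))) ?_ hx1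
          · linarith
          · rw [abs_neg, abs_mul, abs_of_pos hα0, hx]
            exact mul_le_mul_of_nonneg_left (abs_le.mpr ⟨hlo z, hhi z⟩) hα0.le
    _ = 1 - α * r + (1 / 2 + x / 4) * α ^ 2 * ∫ z, (ℓ z θ - ℓ z θ₀) ^ 2 ∂(P : Measure Z) := by
        have hi3 : Integrable (fun z => 1 - α * (ℓ z θ - ℓ z θ₀)) (P : Measure Z) :=
          (integrable_const _).sub (hi1.const_mul _)
        rw [integral_add hi3 (hi2.const_mul _),
          integral_sub (integrable_const _) (hi1.const_mul _), integral_const_mul,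
          integral_const_mul, h1]
        simp
    _ ≤ 1 - α * r + (1 / 2 + x / 4) * α ^ 2 * (c * r) := by gcongr
    _ = -(α * (1 / 2 + x / 4 + x ^ 2 / 4) * r) + 1 := by
        have : (1 / 2 + x / 4) * α ^ 2 * (c * r) = (1 / 2 + x / 4) * α * (α * c) * r := by ring
        rw [this, hxc]; ring
    _ ≤ _ := Real.add_one_le_exp _

section Measurability

variable {a : ℝ}

theorem measurable_gibbsPartition {X : Type*} [MeasurableSpace X] (κ : Kernel X (Fin d → ℝ))
    [IsMarkovKernel κ] :
    Measurable fun p : X × (Fin n → Z) => gibbsPartition ℓ a p.2 (κ p.1) := by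
  refine measurable_integral_kernel (κ.comap Prod.fst measurable_fst)
    (f := fun (p : X × (Fin n → Z)) θ => Real.exp (-(a * empRisk ℓ p.2 θ))) ?_
  have h : Measurable fun q : (X × (Fin n → Z)) × (Fin d → ℝ) => (q.1.2, q.2) := by fun_prop
  exact ((hℓ.measurable_empRisk.comp h).const_mul a).neg.exp

theorem measurable_freeEnergy {X : Type*} [MeasurableSpace X] (κ : Kernel X (Fin d → ℝ))
    [IsMarkovKernel κ] :
    Measurable fun p : X × (Fin n → Z) => freeEnergy ℓ a p.2 (κ p.1) :=
  ((Real.measurable_log.comp (hℓ.measurable_gibbsPartition κ)).div_const a).neg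

theorem measurable_integral_risk_gibbs {X : Type*} [MeasurableSpace X]
    (κ : Kernel X (Fin d → ℝ)) [IsMarkovKernel κ] :
    Measurable fun p : X × ProbabilityMeasure Z × (Fin n → Z) =>
      ∫ θ, risk ℓ p.2.1 θ ∂(gibbs ℓ a p.2.2 (κ p.1)) := by
  -- The Gibbs posterior varies with the parameters, but an integral against it is a ratio of two
  -- integrals against the kernel κ, each measurable by the general kernel lemma.
  have h0 : ∀ p : X × ProbabilityMeasure Z × (Fin n → Z),
      ∫ θ, risk ℓ p.2.1 θ ∂(gibbs ℓ a p.2.2 (κ p.1))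
        = (∫ θ, Real.exp (-(a * empRisk ℓ p.2.2 θ)) * risk ℓ p.2.1 θ ∂(κ p.1))
            / gibbsPartition ℓ a p.2.2 (κ p.1) := by
    intro p
    rw [gibbs, integral_tilted, gibbsPartition, ← integral_div]
    refine integral_congr_ae (Filter.Eventually.of_forall fun θ => ?_)
    simp only [smul_eq_mul]
    ring
  simp only [h0]
  refine Measurable.div ?_ ((hℓ.measurable_gibbsPartition (a := a) κ).comp
    (measurable_fst.prodMk measurable_snd.snd))
  refine measurable_integral_kernel (κ.comap Prod.fst measurable_fst)
    (f := fun (p : X × ProbabilityMeasure Z × (Fin n → Z)) θ =>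
      Real.exp (-(a * empRisk ℓ p.2.2 θ)) * risk ℓ p.2.1 θ) ?_
  have h : Measurable fun q : (X × ProbabilityMeasure Z × (Fin n → Z)) × (Fin d → ℝ) =>
    (q.1.2.2, q.2) := by fun_prop
  have h' : Measurable fun q : (X × ProbabilityMeasure Z × (Fin n → Z)) × (Fin d → ℝ) =>
    (q.1.2.1, q.2) := by fun_prop
  exact ((hℓ.measurable_empRisk.comp h).const_mul a).neg.exp.mul (hℓ.measurable_risk.comp h')

end Measurability

/-- For three or more observations, the Gibbs free energy of a task satisfies a one-sided
exponential inequality that controls the risk of the Gibbs posterior. -/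
theorem integral_exp_freeEnergy_le {c α : ℝ} (hC : 0 < C) (hc : 0 < c) (hα : α = 1 / (C + c))
    (hn : 3 ≤ n) (P : ProbabilityMeasure Z) (θ₀ : Fin d → ℝ)
    (hmin : risk ℓ P θ₀ = bestRisk ℓ P)
    (hB : ∀ θ, ∫ z, |ℓ z θ - ℓ z θ₀| ^ 2 ∂(P : Measure Z) ≤ c * (risk ℓ P θ - bestRisk ℓ P))
    (π : Measure (Fin d → ℝ)) [IsProbabilityMeasure π] :
    ∫ S : Fin n → Z, Real.exp (α * (empRisk ℓ S θ₀ - freeEnergy ℓ (α * n) S π)) ∂(sampleLaw n P)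
      ≤ 1 - α / 2 * (∫ S : Fin n → Z, ∫ θ, risk ℓ P θ ∂(gibbs ℓ (α * n) S π) ∂(sampleLaw n P)
          - risk ℓ P θ₀) := by
  have hn0 : 0 < n := by omega
  have hn' : (0 : ℝ) < n := by exact_mod_cast hn0
  have hα0 : 0 < α := by rw [hα]; positivity
  have ha : 0 < α * n := mul_pos hα0 hn'
  set x := α * C with hx
  have hxc : α * c = 1 - x := by rw [hx, hα]; field_simp; ring
  have hx1 : x ≤ 1 := by nlinarith
  have hx0 : 0 < x := mul_pos hα0 hC
  set γ := 1 / 2 + x / 4 + x ^ 2 / 4 with hγ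
  have hγ0 : 0 < γ := by positivity
  have hr0 : ∀ θ, 0 ≤ risk ℓ P θ - risk ℓ P θ₀ := fun θ => by
    rw [hmin]; exact sub_nonneg.mpr (hℓ.bestRisk_le P θ)
  have hrC : ∀ θ, risk ℓ P θ - risk ℓ P θ₀ ≤ C := fun θ => by
    linarith [hℓ.risk_le P θ, hℓ.risk_nonneg P θ₀]
  have hrm : Measurable fun θ => risk ℓ P θ - risk ℓ P θ₀ :=
    (hℓ.measurable_risk_right P).sub_const _
  -- the function whose sample mean is at most one
  let h : (Fin n → Z) → (Fin d → ℝ) → ℝ := fun S θ =>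
    Real.exp (α * n * (γ * (risk ℓ P θ - risk ℓ P θ₀) - empRisk ℓ S θ + empRisk ℓ S θ₀))
  have hh_meas : Measurable (Function.uncurry h) := by
    have h1 : Measurable fun q : (Fin n → Z) × (Fin d → ℝ) => (q.1, θ₀) := by fun_prop
    exact (((((hrm.comp measurable_snd).const_mul γ).sub hℓ.measurable_empRisk).add
      (hℓ.measurable_empRisk.comp h1)).const_mul (α * n)).exp
  have hh_lo : ∀ S θ, 0 ≤ h S θ := fun S θ => (Real.exp_pos _).le
  have hh_hi : ∀ S θ, h S θ ≤ Real.exp (α * n * (γ * C + C)) := fun S θ => by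
    rw [Real.exp_le_exp]
    refine mul_le_mul_of_nonneg_left ?_ ha.le
    have := mul_le_mul_of_nonneg_left (hrC θ) hγ0.le
    linarith [hℓ.empRisk_nonneg S θ, hℓ.empRisk_le hn0 S θ₀]
  have hY_meas : Measurable fun S => ∫ θ, h S θ ∂π :=
    (hh_meas.stronglyMeasurable.integral_prod_right (ν := π)).measurable
  have hY : ∫ S, ∫ θ, h S θ ∂π ∂(sampleLaw n P) ≤ 1 := by
    rw [integral_integral_swap (integrable_of_mem_Icc hh_meas (fun q => hh_lo q.1 q.2)
      (fun q => hh_hi q.1 q.2))]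
    refine (integral_mem_Icc (A := 0) ?_ (fun θ => integral_nonneg fun S => hh_lo S θ)
      fun θ => ?_).2
    · exact (hh_meas.stronglyMeasurable.integral_prod_left (μ := sampleLaw n P)).measurable
    · refine integral_sample_exp_le_one hn0 P θ θ₀ ?_
      have := hℓ.integral_exp_neg_le hC hc hα P θ θ₀ (by rw [hmin]; exact hB θ)
      rwa [mul_assoc α] at this
  -- the pointwise inequality
  have hpt : ∀ S : Fin n → Z, Real.exp (α * (empRisk ℓ S θ₀ - freeEnergy ℓ (α * n) S π))
      ≤ 1 + (∫ θ, h S θ ∂π - 1) / n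
        - α * (∫ θ, risk ℓ P θ ∂(gibbs ℓ (α * n) S π) - risk ℓ P θ₀) / 2 := by
    intro S
    have hp := hℓ.isProbabilityMeasure_gibbs ha hn0 S π
    set G := gibbs ℓ (α * n) S π with hG
    set X := gibbsPartition ℓ (α * n) S π with hX
    have hXpos : 0 < X := hℓ.gibbsPartition_pos ha hn0 S π
    have hiG : Integrable (fun θ => risk ℓ P θ - risk ℓ P θ₀) G :=
      integrable_of_mem_Icc hrm hr0 hrC
    have hm : ∫ θ, (risk ℓ P θ - risk ℓ P θ₀) ∂G = ∫ θ, risk ℓ P θ ∂G - risk ℓ P θ₀ := by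
      rw [integral_sub (integrable_of_mem_Icc (hℓ.measurable_risk_right P) (hℓ.risk_nonneg P)
        (hℓ.risk_le P)) (integrable_const _)]
      simp
    have hm_mem := integral_mem_Icc (μ := G) hrm hr0 hrC
    rw [hm] at hm_mem
    set m := ∫ θ, risk ℓ P θ ∂G - risk ℓ P θ₀ with hmdef
    -- Jensen's inequality under the Gibbs posterior replaces the random excess risk by its
    -- posterior mean m.
    have hJ : Real.exp (α * n * γ * m)
        ≤ ∫ θ, Real.exp (α * n * γ * (risk ℓ P θ - risk ℓ P θ₀)) ∂G := by
      have := convexOn_exp.map_integral_le (μ := G)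
        (f := fun θ => α * n * γ * (risk ℓ P θ - risk ℓ P θ₀))
        Real.continuous_exp.continuousOn isClosed_univ (Filter.Eventually.of_forall fun _ =>
          Set.mem_univ _) (hiG.const_mul _) ?_
      · rwa [integral_const_mul, hm] at this
      · exact integrable_of_mem_Icc (hrm.const_mul (α * n * γ)).exp (fun _ => (Real.exp_pos _).le)
          (B := Real.exp (α * n * γ * C)) fun θ => by
            simp only [Function.comp_apply]
            rw [Real.exp_le_exp]
            exact mul_le_mul_of_nonneg_left (hrC θ) (by positivity)
    -- Change of measure: the factor exp(-αn R̂_S) in `h` is X times the density of the Gibbs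
    -- posterior with respect to π.
    have hYX : ∫ θ, h S θ ∂π = Real.exp (α * n * empRisk ℓ S θ₀) * X *
        ∫ θ, Real.exp (α * n * γ * (risk ℓ P θ - risk ℓ P θ₀)) ∂G := by
      rw [hG, gibbs, integral_exp_tilted, ← gibbsPartition, ← hX, mul_assoc,
        mul_div_cancel₀ _ hXpos.ne', ← integral_const_mul]
      refine integral_congr_ae (Filter.Eventually.of_forall fun θ => ?_)
      simp only [h, Pi.add_apply]
      rw [← Real.exp_add]
      congr 1
      ring
    set Y := ∫ θ, h S θ ∂π with hYdef
    have hYlow : Real.exp (α * n * empRisk ℓ S θ₀) * X * Real.exp (α * n * γ * m) ≤ Y := by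
      rw [hYX]; gcongr
    have hYpos : 0 < Y := lt_of_lt_of_le (by positivity) hYlow
    have hlog : α * n * empRisk ℓ S θ₀ + Real.log X + α * n * γ * m ≤ Real.log Y := by
      have := Real.log_le_log (by positivity) hYlow
      rwa [Real.log_mul (by positivity) (by positivity), Real.log_mul (by positivity)
        (by positivity), Real.log_exp, Real.log_exp] at this
    -- The choice v = (log Y)/n makes e^{nv} equal to Y, and b = αm satisfies b ≤ αC = x because
    -- excess risks are at most C.
    have key := exp_sub_le hn hx1 (b := α * m) (mul_nonneg hα0.le hm_mem.1)
      (mul_le_mul_of_nonneg_left hm_mem.2 hα0.le) (Real.log Y / n)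
    rw [mul_div_cancel₀ _ hn'.ne', Real.exp_log hYpos] at key
    refine le_trans ?_ key
    rw [Real.exp_le_exp, freeEnergy, ← hX]
    have e1 : α * (empRisk ℓ S θ₀ - -(Real.log X / (α * n)))
        = (α * n * empRisk ℓ S θ₀ + Real.log X) / n := by
      field_simp
      ring
    have e2 : Real.log Y / n - (1 / 2 + x / 4 + x ^ 2 / 4) * (α * m)
        = (Real.log Y - α * n * γ * m) / n := by
      rw [← hγ]
      field_simp
    rw [e1, e2]
    gcongr
    linarith
  have hκ : IsMarkovKernel (Kernel.const Unit π) := inferInstance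
  have hG_meas : Measurable fun S : Fin n → Z => ∫ θ, risk ℓ P θ ∂(gibbs ℓ (α * n) S π) :=
    (hℓ.measurable_integral_risk_gibbs (Kernel.const Unit π)).comp
      (f := fun S : Fin n → Z => ((), P, S)) (by fun_prop)
  have hN_meas : Measurable fun S : Fin n → Z => freeEnergy ℓ (α * n) S π :=
    (hℓ.measurable_freeEnergy (Kernel.const Unit π)).comp
      (f := fun S : Fin n → Z => ((), S)) (by fun_prop)
  have hi1 : Integrable (fun S => ∫ θ, h S θ ∂π) (sampleLaw n P) :=
    integrable_of_mem_Icc hY_meas (A := 0) (fun S => integral_nonneg (hh_lo S)) fun S =>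
      (integral_mem_Icc (hh_meas.comp measurable_prodMk_left) (hh_lo S) (hh_hi S)).2
  have hi2 : Integrable (fun S : Fin n → Z => ∫ θ, risk ℓ P θ ∂(gibbs ℓ (α * n) S π))
      (sampleLaw n P) :=
    integrable_of_mem_Icc hG_meas (fun S => (hℓ.integral_risk_gibbs_mem_Icc ha hn0 P S π).1)
      (fun S => (hℓ.integral_risk_gibbs_mem_Icc ha hn0 P S π).2)
  have hi3 : Integrable (fun S => 1 + (∫ θ, h S θ ∂π - 1) / n) (sampleLaw n P) :=
    (integrable_const _).add ((hi1.sub (integrable_const _)).div_const _)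
  have hi4 : Integrable (fun S : Fin n → Z =>
      α * (∫ θ, risk ℓ P θ ∂(gibbs ℓ (α * n) S π) - risk ℓ P θ₀) / 2) (sampleLaw n P) :=
    ((hi2.sub (integrable_const _)).const_mul α).div_const 2
  refine (integral_mono ?_ (hi3.sub hi4) hpt).trans ?_
  · refine integrable_of_mem_Icc (((hℓ.measurable_empRisk_left θ₀).sub hN_meas).const_mul α).exp
      (fun _ => (Real.exp_pos _).le) (B := Real.exp (α * C)) fun S => ?_
    rw [Real.exp_le_exp]
    refine mul_le_mul_of_nonneg_left ?_ hα0.le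
    linarith [(hℓ.freeEnergy_mem_Icc ha hn0 S π).1, hℓ.empRisk_le hn0 S θ₀]
  · simp only [Pi.sub_apply]
    have hi5 : Integrable (fun S => (∫ θ, h S θ ∂π - 1) / n) (sampleLaw n P) :=
      (hi1.sub (integrable_const _)).div_const _
    rw [integral_sub hi3 hi4, integral_add (integrable_const _) hi5, integral_div, integral_div,
      integral_const_mul, integral_sub hi1 (integrable_const _),
      integral_sub hi2 (integrable_const _)]
    simp only [integral_const, probReal_univ, smul_eq_mul, one_mul]
    -- The Y term disappears in expectation, because its mean over samples is at most one.
    have : (∫ S, ∫ θ, h S θ ∂π ∂(sampleLaw n P) - 1) / n ≤ 0 :=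
      div_nonpos_of_nonpos_of_nonneg (by linarith) hn'.le
    linarith

end IsBoundedLoss

end

section

/-! ### PAC-Bayes bound across tasks -/

section Iterated

variable {X D Y : Type*} [MeasurableSpace X] [MeasurableSpace D] [MeasurableSpace Y] {T : ℕ}

theorem prod_mem_Icc {e : Fin T → ℝ} {E : ℝ} (h0 : ∀ t, 0 ≤ e t) (h1 : ∀ t, e t ≤ E) :
    0 ≤ ∏ t, e t ∧ ∏ t, e t ≤ E ^ T := by
  refine ⟨Finset.prod_nonneg fun t _ => h0 t, ?_⟩
  simpa using Finset.prod_le_prod (fun t (_ : t ∈ Finset.univ) => h0 t) (fun t _ => h1 t)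

/-- If each conditional exponential moment is at most one, so is the exponential moment of the
sum over independent tasks, averaged over the prior `Λ`. -/
theorem integral_prod_tasks_le_one (η : Kernel D Y) [IsMarkovKernel η] (𝓓 : Measure D)
    [IsProbabilityMeasure 𝓓] (Λ : Measure X) [IsProbabilityMeasure Λ] {e : X → D → Y → ℝ} {E : ℝ}
    (he : Measurable fun p : X × D × Y => e p.1 p.2.1 p.2.2) (h0 : ∀ m P S, 0 ≤ e m P S)
    (hE : ∀ m P S, e m P S ≤ E) (h1 : ∀ m, ∫ P, ∫ S, e m P S ∂(η P) ∂𝓓 ≤ 1) :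
    (∀ P : Fin T → D, Integrable (fun S : Fin T → Y => ∫ m, ∏ t, e m (P t) (S t) ∂Λ)
      (Measure.pi fun t => η (P t))) ∧
    Integrable (fun P : Fin T → D => ∫ S : Fin T → Y, ∫ m, ∏ t, e m (P t) (S t) ∂Λ
      ∂(Measure.pi fun t => η (P t))) (Measure.pi fun _ => 𝓓) ∧
    ∫ P : Fin T → D, ∫ S : Fin T → Y, ∫ m, ∏ t, e m (P t) (S t) ∂Λ
      ∂(Measure.pi fun t => η (P t)) ∂(Measure.pi fun _ => 𝓓) ≤ 1 := by
  -- Conditional mean given the task. For fixed m, independence of the samples and then of the tasks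
  -- turns the expectation of the product into the T-th power of the mean of `ebar`.
  let ebar : X → D → ℝ := fun m P => ∫ S, e m P S ∂(η P)
  have hbar_meas : Measurable fun p : X × D => ebar p.1 p.2 := by
    refine measurable_integral_kernel (η.comap Prod.snd measurable_snd)
      (f := fun (p : X × D) S => e p.1 p.2 S) ?_
    have : Measurable fun q : (X × D) × Y => (q.1.1, q.1.2, q.2) := by fun_prop
    exact he.comp this
  have hemP : ∀ m P, Measurable fun S => e m P S := fun m P => by
    have : Measurable fun S : Y => (m, P, S) := by fun_prop
    exact he.comp this
  have hbar : ∀ m P, 0 ≤ ebar m P ∧ ebar m P ≤ E := fun m P =>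
    integral_mem_Icc (hemP m P) (h0 m P) (hE m P)
  have hprod_meas : ∀ P : Fin T → D,
      Measurable fun q : (Fin T → Y) × X => ∏ t, e q.2 (P t) (q.1 t) := fun P => by
    refine Finset.measurable_prod _ fun t _ => ?_
    have : Measurable fun q : (Fin T → Y) × X => (q.2, P t, q.1 t) := by fun_prop
    exact he.comp this
  have hprod : ∀ (P : Fin T → D) (S : Fin T → Y) m,
      0 ≤ ∏ t, e m (P t) (S t) ∧ ∏ t, e m (P t) (S t) ≤ E ^ T := fun P S m =>
    prod_mem_Icc (fun t => h0 _ _ _) (fun t => hE _ _ _)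
  have hbarprod : ∀ (P : Fin T → D) m, 0 ≤ ∏ t, ebar m (P t) ∧ ∏ t, ebar m (P t) ≤ E ^ T :=
    fun P m => prod_mem_Icc (fun t => (hbar _ _).1) (fun t => (hbar _ _).2)
  have hbarprod_meas : Measurable fun q : (Fin T → D) × X => ∏ t, ebar q.2 (q.1 t) := by
    refine Finset.measurable_prod _ fun t _ => ?_
    have : Measurable fun q : (Fin T → D) × X => (q.2, q.1 t) := by fun_prop
    exact hbar_meas.comp this
  have hint1 : ∀ P : Fin T → D, Integrable (fun S : Fin T → Y => ∫ m, ∏ t, e m (P t) (S t) ∂Λ)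
      (Measure.pi fun t => η (P t)) := fun P =>
    integrable_of_mem_Icc
      ((hprod_meas P).stronglyMeasurable.integral_prod_right' (ν := Λ)).measurable
      (fun S => integral_nonneg fun m => (hprod P S m).1)
      (fun S => (integral_mem_Icc ((hprod_meas P).comp measurable_prodMk_left)
        (fun m => (hprod P S m).1) (fun m => (hprod P S m).2)).2)
  have hswap1 : ∀ P : Fin T → D, ∫ S : Fin T → Y, ∫ m, ∏ t, e m (P t) (S t) ∂Λ
      ∂(Measure.pi fun t => η (P t)) = ∫ m, ∏ t, ebar m (P t) ∂Λ := by
    intro P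
    rw [integral_integral_swap (integrable_of_mem_Icc (hprod_meas P)
      (fun q => (hprod P q.1 q.2).1) (fun q => (hprod P q.1 q.2).2))]
    refine integral_congr_ae (Filter.Eventually.of_forall fun m => ?_)
    exact integral_fintype_prod_eq_prod (μ := fun t => η (P t)) (fun t S => e m (P t) S)
  simp only [hswap1]
  refine ⟨hint1, ?_, ?_⟩
  · exact integrable_of_mem_Icc
      (hbarprod_meas.stronglyMeasurable.integral_prod_right' (ν := Λ)).measurable
      (fun P => integral_nonneg fun m => (hbarprod P m).1)
      (fun P => (integral_mem_Icc (hbarprod_meas.comp measurable_prodMk_left)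
        (fun m => (hbarprod P m).1) (fun m => (hbarprod P m).2)).2)
  · rw [integral_integral_swap (integrable_of_mem_Icc hbarprod_meas
      (fun q => (hbarprod q.1 q.2).1) (fun q => (hbarprod q.1 q.2).2))]
    have hpow : ∀ m, ∫ P : Fin T → D, ∏ t, ebar m (P t) ∂(Measure.pi fun _ => 𝓓)
        = (∫ P, ebar m P ∂𝓓) ^ T := fun m => by
      rw [integral_fintype_prod_eq_pow (ι := Fin T) (fun P => ebar m P), Fintype.card_fin]
    simp only [hpow]
    have hm1 : Measurable fun m => ∫ P, ebar m P ∂𝓓 :=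
      (hbar_meas.stronglyMeasurable.integral_prod_right' (ν := 𝓓)).measurable
    have hm0 : ∀ m, 0 ≤ ∫ P, ebar m P ∂𝓓 := fun m => integral_nonneg fun P => (hbar m P).1
    exact (integral_mem_Icc (hm1.pow_const T) (fun m => pow_nonneg (hm0 m) T)
      (fun m => pow_le_one₀ (hm0 m) (h1 m))).2

theorem integral_sum_tasks (η : Kernel D Y) [IsMarkovKernel η] (𝓓 : Measure D)
    [IsProbabilityMeasure 𝓓] {u : D → Y → ℝ} {A B : ℝ} (hu : Measurable (Function.uncurry u))
    (hA : ∀ P S, A ≤ u P S) (hB : ∀ P S, u P S ≤ B) :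
    (∀ P : Fin T → D, Integrable (fun S : Fin T → Y => ∑ t, u (P t) (S t))
      (Measure.pi fun t => η (P t))) ∧
    Integrable (fun P : Fin T → D => ∫ S : Fin T → Y, ∑ t, u (P t) (S t)
      ∂(Measure.pi fun t => η (P t))) (Measure.pi fun _ => 𝓓) ∧
    ∫ P : Fin T → D, ∫ S : Fin T → Y, ∑ t, u (P t) (S t)
      ∂(Measure.pi fun t => η (P t)) ∂(Measure.pi fun _ => 𝓓)
      = T * ∫ P, ∫ S, u P S ∂(η P) ∂𝓓 := by
  have huP : ∀ P, Measurable (u P) := fun P => hu.comp measurable_prodMk_left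
  have hbar_meas : Measurable fun P => ∫ S, u P S ∂(η P) := measurable_integral_kernel η hu
  have hbar : ∀ P, A ≤ ∫ S, u P S ∂(η P) ∧ ∫ S, u P S ∂(η P) ≤ B := fun P =>
    integral_mem_Icc (huP P) (hA P) (hB P)
  have hi : ∀ (P : Fin T → D) t, Integrable (fun S : Fin T → Y => u (P t) (S t))
      (Measure.pi fun t => η (P t)) := fun P t =>
    integrable_of_mem_Icc ((huP _).comp (measurable_pi_apply t)) (fun S => hA _ _) (fun S => hB _ _)
  have h1 : ∀ P : Fin T → D, ∫ S : Fin T → Y, ∑ t, u (P t) (S t) ∂(Measure.pi fun t => η (P t))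
      = ∑ t, ∫ S, u (P t) S ∂(η (P t)) := fun P => by
    rw [integral_finsetSum _ fun t _ => hi P t]
    exact Finset.sum_congr rfl fun t _ => integral_comp_eval (μ := fun t => η (P t)) (i := t)
      (f := u (P t)) (huP _).aestronglyMeasurable
  have hi2 : ∀ t : Fin T, Integrable (fun P : Fin T → D => ∫ S, u (P t) S ∂(η (P t)))
      (Measure.pi fun _ => 𝓓) := fun t =>
    integrable_of_mem_Icc (hbar_meas.comp (measurable_pi_apply t)) (fun P => (hbar _).1)
      (fun P => (hbar _).2)
  simp only [h1]
  refine ⟨fun P => integrable_finsetSum _ fun t _ => hi P t,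
    integrable_finsetSum _ fun t _ => hi2 t, ?_⟩
  rw [integral_finsetSum _ fun t _ => hi2 t]
  have : ∀ t : Fin T, ∫ P : Fin T → D, ∫ S, u (P t) S ∂(η (P t)) ∂(Measure.pi fun _ => 𝓓)
      = ∫ P, ∫ S, u P S ∂(η P) ∂𝓓 := fun t =>
    integral_comp_eval (μ := fun _ : Fin T => 𝓓) (i := t) (f := fun P => ∫ S, u P S ∂(η P))
      hbar_meas.aestronglyMeasurable
  simp [this]

/-- Only the real majorant V has to be integrable; monotonicity of the lower integral asks nothing
of A, which later depends on the data through Q̂. -/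
theorem lintegral_lintegral_le_ofReal {μ : Measure X} {ν : X → Measure Y} {A : X → Y → ℝ≥0∞}
    {V : X → Y → ℝ} (hV0 : ∀ x y, 0 ≤ V x y) (hAV : ∀ x y, A x y ≤ ENNReal.ofReal (V x y))
    (hV1 : ∀ x, Integrable (V x) (ν x)) (hV2 : Integrable (fun x => ∫ y, V x y ∂(ν x)) μ) :
    ∫⁻ x, ∫⁻ y, A x y ∂(ν x) ∂μ ≤ ENNReal.ofReal (∫ x, ∫ y, V x y ∂(ν x) ∂μ) := by
  rw [ofReal_integral_eq_lintegral_ofReal hV2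
    (Filter.Eventually.of_forall fun x => integral_nonneg (hV0 x))]
  refine lintegral_mono fun x => ?_
  rw [ofReal_integral_eq_lintegral_ofReal (hV1 x) (Filter.Eventually.of_forall (hV0 x))]
  exact lintegral_mono (hAV x)

end Iterated

/-- Real-valued meta-risk of the Gibbs posteriors. -/
def gibbsMetaRisk {Z : Type*} [MeasurableSpace Z] {d : ℕ} (n : ℕ) (ℓ : Z → (Fin d → ℝ) → ℝ) (a : ℝ)
    (𝓓 : Measure (ProbabilityMeasure Z)) (π : Measure (Fin d → ℝ)) : ℝ :=
  ∫ P, ∫ S : Fin n → Z, ∫ θ, risk ℓ P θ ∂(gibbs ℓ a S π) ∂(sampleLaw n P) ∂𝓓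

/-- Expected free energy of a prior. -/
def meanFreeEnergy {Z : Type*} [MeasurableSpace Z] {d : ℕ} (n : ℕ) (ℓ : Z → (Fin d → ℝ) → ℝ)
    (a : ℝ) (𝓓 : Measure (ProbabilityMeasure Z)) (π : Measure (Fin d → ℝ)) : ℝ :=
  ∫ P, ∫ S : Fin n → Z, freeEnergy ℓ a S π ∂(sampleLaw n P) ∂𝓓

namespace IsBoundedLoss

variable {Z : Type*} [MeasurableSpace Z] {d n T : ℕ} {ℓ : Z → (Fin d → ℝ) → ℝ} {C : ℝ}
  (hℓ : IsBoundedLoss ℓ C) {X : Type*} [MeasurableSpace X] (κ : Kernel X (Fin d → ℝ))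
  [IsMarkovKernel κ] (𝓓 : Measure (ProbabilityMeasure Z)) [IsProbabilityMeasure 𝓓]
include hℓ

theorem measurable_uncurry_integral_risk_gibbs (n : ℕ) (a : ℝ) :
    Measurable (Function.uncurry fun (p : X × ProbabilityMeasure Z) (S : Fin n → Z) =>
      ∫ θ, risk ℓ p.2 θ ∂(gibbs ℓ a S (κ p.1))) := by
  have h : Measurable fun q : (X × ProbabilityMeasure Z) × (Fin n → Z) => (q.1.1, q.1.2, q.2) := by
    fun_prop
  have h1 := (hℓ.measurable_integral_risk_gibbs (n := n) (a := a) κ).comp h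
  simpa only [Function.comp_def, Function.uncurry_def] using h1

theorem measurable_integral_sample_gibbs (n : ℕ) (a : ℝ) :
    Measurable fun p : X × ProbabilityMeasure Z =>
      ∫ S : Fin n → Z, ∫ θ, risk ℓ p.2 θ ∂(gibbs ℓ a S (κ p.1)) ∂(sampleLaw n p.2) :=
  measurable_integral_kernel
    ((sampleKernel Z n).comap (Prod.snd : X × ProbabilityMeasure Z → _) measurable_snd)
    (hℓ.measurable_uncurry_integral_risk_gibbs κ n a)

theorem measurable_integral_sample_freeEnergy (n : ℕ) (a : ℝ) :
    Measurable fun p : X × ProbabilityMeasure Z =>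
      ∫ S : Fin n → Z, freeEnergy ℓ a S (κ p.1) ∂(sampleLaw n p.2) := by
  refine measurable_integral_kernel ((sampleKernel Z n).comap Prod.snd measurable_snd)
    (f := fun (p : X × ProbabilityMeasure Z) S => freeEnergy ℓ a S (κ p.1)) ?_
  have : Measurable fun q : (X × ProbabilityMeasure Z) × (Fin n → Z) => (q.1.1, q.2) := by
    fun_prop
  exact (hℓ.measurable_freeEnergy κ).comp this

theorem measurable_gibbsMetaRisk (n : ℕ) (a : ℝ) :
    Measurable fun m => gibbsMetaRisk n ℓ a 𝓓 (κ m) :=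
  ((hℓ.measurable_integral_sample_gibbs κ n a).stronglyMeasurable.integral_prod_right'
    (ν := 𝓓)).measurable

theorem measurable_meanFreeEnergy (n : ℕ) (a : ℝ) :
    Measurable fun m => meanFreeEnergy n ℓ a 𝓓 (κ m) :=
  ((hℓ.measurable_integral_sample_freeEnergy κ n a).stronglyMeasurable.integral_prod_right'
    (ν := 𝓓)).measurable

theorem integral_sample_gibbs_mem_Icc {a : ℝ} (ha : 0 < a) (hn : 0 < n)
    (π : Measure (Fin d → ℝ)) [IsProbabilityMeasure π] (P : ProbabilityMeasure Z) :
    0 ≤ ∫ S : Fin n → Z, ∫ θ, risk ℓ P θ ∂(gibbs ℓ a S π) ∂(sampleLaw n P) ∧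
      ∫ S : Fin n → Z, ∫ θ, risk ℓ P θ ∂(gibbs ℓ a S π) ∂(sampleLaw n P) ≤ C := by
  have hm : Measurable fun S : Fin n → Z => ∫ θ, risk ℓ P θ ∂(gibbs ℓ a S π) :=
    (hℓ.measurable_integral_risk_gibbs (Kernel.const Unit π)).comp
      (f := fun S : Fin n → Z => ((), P, S)) (by fun_prop)
  exact integral_mem_Icc hm (fun S => (hℓ.integral_risk_gibbs_mem_Icc ha hn P S π).1)
    (fun S => (hℓ.integral_risk_gibbs_mem_Icc ha hn P S π).2)

theorem integral_sample_freeEnergy_mem_Icc {a : ℝ} (ha : 0 < a) (hn : 0 < n)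
    (π : Measure (Fin d → ℝ)) [IsProbabilityMeasure π] (P : ProbabilityMeasure Z) :
    0 ≤ ∫ S : Fin n → Z, freeEnergy ℓ a S π ∂(sampleLaw n P) ∧
      ∫ S : Fin n → Z, freeEnergy ℓ a S π ∂(sampleLaw n P) ≤ C := by
  have hm : Measurable fun S : Fin n → Z => freeEnergy ℓ a S π :=
    (hℓ.measurable_freeEnergy (Kernel.const Unit π)).comp
      (f := fun S : Fin n → Z => ((), S)) (by fun_prop)
  exact integral_mem_Icc hm (fun S => (hℓ.freeEnergy_mem_Icc ha hn S π).1)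
    (fun S => (hℓ.freeEnergy_mem_Icc ha hn S π).2)

theorem gibbsMetaRisk_mem_Icc {a : ℝ} (ha : 0 < a) (hn : 0 < n) (π : Measure (Fin d → ℝ))
    [IsProbabilityMeasure π] :
    0 ≤ gibbsMetaRisk n ℓ a 𝓓 π ∧ gibbsMetaRisk n ℓ a 𝓓 π ≤ C :=
  integral_mem_Icc ((hℓ.measurable_integral_sample_gibbs (Kernel.const Unit π) n a).comp
      (f := fun P => ((), P)) (by fun_prop))
    (fun P => (hℓ.integral_sample_gibbs_mem_Icc ha hn π P).1)
    (fun P => (hℓ.integral_sample_gibbs_mem_Icc ha hn π P).2)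

theorem meanFreeEnergy_mem_Icc {a : ℝ} (ha : 0 < a) (hn : 0 < n) (π : Measure (Fin d → ℝ))
    [IsProbabilityMeasure π] :
    0 ≤ meanFreeEnergy n ℓ a 𝓓 π ∧ meanFreeEnergy n ℓ a 𝓓 π ≤ C :=
  integral_mem_Icc ((hℓ.measurable_integral_sample_freeEnergy (Kernel.const Unit π) n a).comp
      (f := fun P => ((), P)) (by fun_prop))
    (fun P => (hℓ.integral_sample_freeEnergy_mem_Icc ha hn π P).1)
    (fun P => (hℓ.integral_sample_freeEnergy_mem_Icc ha hn π P).2)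

end IsBoundedLoss

end

/-! ### Donsker-Varadhan over the tasks and the oracle inequality for the meta-learner -/

section

/-- Donsker-Varadhan inequality for a sum over tasks. -/
theorem integral_le_of_criterion {X : Type*} [MeasurableSpace X] {T : ℕ} {Λ Qh : Measure X}
    [IsProbabilityMeasure Λ] [IsProbabilityMeasure Qh] {α O B : ℝ} (hα : 0 < α) (hT : 1 ≤ T)
    {F : X → ℝ} {N : Fin T → X → ℝ} {r : Fin T → ℝ} (hKL : klDiv Qh Λ ≠ ∞)
    (hF : Integrable F Qh) (hN : ∀ t, Integrable (N t) Qh)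
    (hexp : Integrable (fun m => ∏ t, Real.exp (α * ((F m - O) / 2 + (r t - N t m)))) Λ)
    (hB : α * ∑ t, ∫ m, N t m ∂Qh + (klDiv Qh Λ).toReal ≤ B) :
    ∫ m, F m ∂Qh ≤ O + 2 / (α * T) * (B - 1 - α * ∑ t, r t
      + ∫ m, ∏ t, Real.exp (α * ((F m - O) / 2 + (r t - N t m))) ∂Λ) := by
  have hT' : (0 : ℝ) < T := by exact_mod_cast hT
  have hit : ∀ t, Integrable (fun m => α * ((F m - O) / 2 + (r t - N t m))) Qh := fun t =>
    (((hF.sub (integrable_const _)).div_const 2).add ((integrable_const _).sub (hN t))).const_mul α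
  simp only [← Real.exp_sum] at hexp ⊢
  have hDV := integral_le_klDiv_add_log hKL (integrable_finsetSum _ fun t _ => hit t) hexp
  -- Replacing log W by W - 1 keeps the bound linear in W, so that it can be averaged over the data
  -- using only E W ≤ 1.
  have hlog := Real.log_le_sub_one_of_pos (integral_exp_pos hexp)
  set W := ∫ m, Real.exp (∑ t, α * ((F m - O) / 2 + (r t - N t m))) ∂Λ
  rw [integral_finsetSum _ fun t _ => hit t] at hDV
  have h1 : ∀ t, ∫ m, α * ((F m - O) / 2 + (r t - N t m)) ∂Qh
      = α * ((∫ m, F m ∂Qh - O) / 2) + (α * r t - α * ∫ m, N t m ∂Qh) := fun t => by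
    have hi1 : Integrable (fun m => (F m - O) / 2) Qh :=
      (hF.sub (integrable_const _)).div_const 2
    have hi2 : Integrable (fun m => r t - N t m) Qh := (integrable_const _).sub (hN t)
    rw [integral_const_mul, integral_add hi1 hi2, integral_div,
      integral_sub hF (integrable_const _), integral_sub (integrable_const _) (hN t)]
    simp only [integral_const, probReal_univ, smul_eq_mul, one_mul]
    ring
  simp only [h1, Finset.sum_add_distrib, Finset.sum_sub_distrib, ← Finset.mul_sum,
    Finset.sum_const, Finset.card_univ, Fintype.card_fin, nsmul_eq_mul] at hDV
  have hq : 0 < α * T / 2 := by positivity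
  have e1 : 2 / (α * T) = 1 / (α * T / 2) := by field_simp
  rw [e1, one_div, ← div_eq_inv_mul, ← sub_le_iff_le_add', le_div_iff₀ hq]
  linarith

namespace IsBoundedLoss

variable {Z : Type*} [MeasurableSpace Z] {d n T : ℕ} {ℓ : Z → (Fin d → ℝ) → ℝ} {C : ℝ}
  (hℓ : IsBoundedLoss ℓ C) {X : Type*} [MeasurableSpace X] (κ : Kernel X (Fin d → ℝ))
  [IsMarkovKernel κ] (𝓓 : Measure (ProbabilityMeasure Z)) [IsProbabilityMeasure 𝓓]
include hℓ

theorem measurable_risk_comp {θ : ProbabilityMeasure Z → Fin d → ℝ} (hθ : Measurable θ) :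
    Measurable fun P => risk ℓ P (θ P) := by
  have : Measurable fun P : ProbabilityMeasure Z => (P, θ P) := by fun_prop
  exact hℓ.measurable_risk.comp this

theorem measurable_empRisk_comp {θ : ProbabilityMeasure Z → Fin d → ℝ} (hθ : Measurable θ) :
    Measurable fun p : ProbabilityMeasure Z × (Fin n → Z) => empRisk ℓ p.2 (θ p.1) := by
  have : Measurable fun p : ProbabilityMeasure Z × (Fin n → Z) => (p.2, θ p.1) := by fun_prop
  exact hℓ.measurable_empRisk.comp this

/-- The within-task bound is affine in the excess risk of the posterior, so integrating it over
tasks gives 1 - (α/2)(F - O) exactly, whatever the spread of the risks between tasks. The constant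
factor exp((α/2)(F - O)) is then cancelled by 1 - u ≤ e^{-u}. -/
theorem integral_integral_exp_le_one {c α : ℝ} (hC : 0 < C) (hc : 0 < c) (hα : α = 1 / (C + c))
    (hn : 3 ≤ n) {θstar : ProbabilityMeasure Z → Fin d → ℝ} (hθ : Measurable θstar)
    (hmin : ∀ᵐ P ∂𝓓, risk ℓ P (θstar P) = bestRisk ℓ P)
    (hB : ∀ᵐ (P : ProbabilityMeasure Z) ∂𝓓, ∀ θ : Fin d → ℝ,
      ∫ z, |ℓ z θ - ℓ z (θstar P)| ^ 2 ∂(P : Measure Z) ≤ c * (risk ℓ P θ - bestRisk ℓ P))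
    (π : Measure (Fin d → ℝ)) [IsProbabilityMeasure π] :
    ∫ P, ∫ S : Fin n → Z, Real.exp (α * ((gibbsMetaRisk n ℓ (α * n) 𝓓 π
        - ∫ P, risk ℓ P (θstar P) ∂𝓓) / 2 + (empRisk ℓ S (θstar P) - freeEnergy ℓ (α * n) S π)))
      ∂(sampleLaw n P) ∂𝓓 ≤ 1 := by
  have hn0 : 0 < n := by omega
  have hα0 : 0 < α := by rw [hα]; positivity
  have ha : 0 < α * n := mul_pos hα0 (by exact_mod_cast hn0)
  set F := gibbsMetaRisk n ℓ (α * n) 𝓓 π with hF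
  set O := ∫ P, risk ℓ P (θstar P) ∂𝓓 with hO
  have hG_meas := (hℓ.measurable_integral_sample_gibbs (Kernel.const Unit π) n (α * n)).comp
      (f := fun P => ((), P)) (by fun_prop)
  have hG_int : Integrable (fun P => ∫ S : Fin n → Z,
      ∫ θ, risk ℓ P θ ∂(gibbs ℓ (α * n) S π) ∂(sampleLaw n P)) 𝓓 :=
    integrable_of_mem_Icc hG_meas (fun P => (hℓ.integral_sample_gibbs_mem_Icc ha hn0 π P).1)
      (fun P => (hℓ.integral_sample_gibbs_mem_Icc ha hn0 π P).2)
  have hr_int : Integrable (fun P => risk ℓ P (θstar P)) 𝓓 :=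
    integrable_of_mem_Icc (hℓ.measurable_risk_comp hθ) (fun P => hℓ.risk_nonneg P _)
      (fun P => hℓ.risk_le P _)
  have h1 : ∀ᵐ P ∂𝓓, ∫ S : Fin n → Z, Real.exp (α * ((F - O) / 2
        + (empRisk ℓ S (θstar P) - freeEnergy ℓ (α * n) S π))) ∂(sampleLaw n P)
      ≤ Real.exp (α / 2 * (F - O)) * (1 - α / 2 * (∫ S : Fin n → Z,
          ∫ θ, risk ℓ P θ ∂(gibbs ℓ (α * n) S π) ∂(sampleLaw n P) - risk ℓ P (θstar P))) := by
    filter_upwards [hmin, hB] with P hP1 hP2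
    have : ∀ S : Fin n → Z, Real.exp (α * ((F - O) / 2
        + (empRisk ℓ S (θstar P) - freeEnergy ℓ (α * n) S π)))
        = Real.exp (α / 2 * (F - O)) *
          Real.exp (α * (empRisk ℓ S (θstar P) - freeEnergy ℓ (α * n) S π)) := fun S => by
      rw [← Real.exp_add]; congr 1; ring
    simp only [this]
    rw [integral_const_mul]
    exact mul_le_mul_of_nonneg_left
      (hℓ.integral_exp_freeEnergy_le hC hc hα hn P (θstar P) hP1 hP2 π) (Real.exp_pos _).le
  have hi : Integrable (fun P => Real.exp (α / 2 * (F - O)) * (1 - α / 2 * (∫ S : Fin n → Z,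
          ∫ θ, risk ℓ P θ ∂(gibbs ℓ (α * n) S π) ∂(sampleLaw n P) - risk ℓ P (θstar P)))) 𝓓 :=
    ((integrable_const _).sub ((hG_int.sub hr_int).const_mul _)).const_mul _
  refine (integral_mono_of_nonneg (Filter.Eventually.of_forall fun P =>
    integral_nonneg fun S => (Real.exp_pos _).le) hi h1).trans ?_
  have hi' : Integrable (fun P => α / 2 * (∫ S : Fin n → Z,
      ∫ θ, risk ℓ P θ ∂(gibbs ℓ (α * n) S π) ∂(sampleLaw n P) - risk ℓ P (θstar P))) 𝓓 :=
    (hG_int.sub hr_int).const_mul _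
  rw [integral_const_mul, integral_sub (integrable_const _) hi',
    integral_const_mul, integral_sub hG_int hr_int]
  have hF' : ∫ P, ∫ S : Fin n → Z, ∫ θ, risk ℓ P θ ∂(gibbs ℓ (α * n) S π) ∂(sampleLaw n P) ∂𝓓
      = F := rfl
  rw [hF', ← hO]
  simp only [integral_const, probReal_univ, smul_eq_mul, mul_one]
  have h2 : 1 - α / 2 * (F - O) ≤ Real.exp (-(α / 2 * (F - O))) := by
    linarith [Real.add_one_le_exp (-(α / 2 * (F - O)))]
  calc _ ≤ Real.exp (α / 2 * (F - O)) * Real.exp (-(α / 2 * (F - O))) := by gcongr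
    _ = 1 := by rw [← Real.exp_add]; simp

theorem measurable_freeEnergy_comp (S : Fin n → Z) (a : ℝ) :
    Measurable fun m => freeEnergy ℓ a S (κ m) :=
  (hℓ.measurable_freeEnergy κ).comp (f := fun m : X => (m, S)) (by fun_prop)

theorem integral_integral_integral_freeEnergy {a : ℝ} (ha : 0 < a) (hn : 0 < n)
    (Q : Measure X) [IsProbabilityMeasure Q] :
    ∫ P, ∫ S : Fin n → Z, ∫ m, freeEnergy ℓ a S (κ m) ∂Q ∂(sampleLaw n P) ∂𝓓
      = ∫ m, meanFreeEnergy n ℓ a 𝓓 (κ m) ∂Q := by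
  have h1 : ∀ P : ProbabilityMeasure Z,
      ∫ S : Fin n → Z, ∫ m, freeEnergy ℓ a S (κ m) ∂Q ∂(sampleLaw n P)
        = ∫ m, ∫ S : Fin n → Z, freeEnergy ℓ a S (κ m) ∂(sampleLaw n P) ∂Q := fun P => by
    have hm : Measurable fun q : (Fin n → Z) × X => freeEnergy ℓ a q.1 (κ q.2) :=
      (hℓ.measurable_freeEnergy (n := n) (a := a) κ).comp measurable_swap
    exact integral_integral_swap (integrable_of_mem_Icc hm
      (fun q => (hℓ.freeEnergy_mem_Icc ha hn q.1 (κ q.2)).1)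
      (fun q => (hℓ.freeEnergy_mem_Icc ha hn q.1 (κ q.2)).2))
  simp only [h1]
  have hm : Measurable fun q : ProbabilityMeasure Z × X =>
      ∫ S : Fin n → Z, freeEnergy ℓ a S (κ q.2) ∂(sampleLaw n q.1) :=
    (hℓ.measurable_integral_sample_freeEnergy κ n a).comp measurable_swap
  exact integral_integral_swap (integrable_of_mem_Icc hm
    (fun q => (hℓ.integral_sample_freeEnergy_mem_Icc ha hn (κ q.2) q.1).1)
    (fun q => (hℓ.integral_sample_freeEnergy_mem_Icc ha hn (κ q.2) q.1).2))

/-- Oracle inequality for a meta-learner that improves on `Q` for the penalized criterion. -/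
theorem lintegral_gibbsMetaRisk_le {c α : ℝ} (hC : 0 < C) (hc : 0 < c) (hα : α = 1 / (C + c))
    (hn : 3 ≤ n) (hT : 1 ≤ T) {θstar : ProbabilityMeasure Z → Fin d → ℝ} (hθ : Measurable θstar)
    (hmin : ∀ᵐ P ∂𝓓, risk ℓ P (θstar P) = bestRisk ℓ P)
    (hB : ∀ᵐ (P : ProbabilityMeasure Z) ∂𝓓, ∀ θ : Fin d → ℝ,
      ∫ z, |ℓ z θ - ℓ z (θstar P)| ^ 2 ∂(P : Measure Z) ≤ c * (risk ℓ P θ - bestRisk ℓ P))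
    (Λ Q : Measure X) [IsProbabilityMeasure Λ] [IsProbabilityMeasure Q]
    (Qhat : (Fin T → Fin n → Z) → Measure X) (hQhat : ∀ S, IsProbabilityMeasure (Qhat S))
    (hKL : ∀ S, klDiv (Qhat S) Λ ≠ ∞)
    (hcrit : ∀ S, α * ∑ t, ∫ m, freeEnergy ℓ (α * n) (S t) (κ m) ∂(Qhat S)
        + (klDiv (Qhat S) Λ).toReal
      ≤ α * ∑ t, ∫ m, freeEnergy ℓ (α * n) (S t) (κ m) ∂Q + (klDiv Q Λ).toReal) :
    ∫⁻ P : Fin T → ProbabilityMeasure Z, ∫⁻ S : Fin T → Fin n → Z,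
        ∫⁻ m, ENNReal.ofReal (gibbsMetaRisk n ℓ (α * n) 𝓓 (κ m)) ∂(Qhat S)
          ∂(Measure.pi fun t => sampleLaw n (P t)) ∂(Measure.pi fun _ => 𝓓)
      ≤ ENNReal.ofReal (2 * (klDiv Q Λ).toReal / (α * T)
          + 2 * ∫ m, meanFreeEnergy n ℓ (α * n) 𝓓 (κ m) ∂Q - ∫ P, risk ℓ P (θstar P) ∂𝓓) := by
  have hn0 : 0 < n := by omega
  have hα0 : 0 < α := by rw [hα]; positivity
  have ha : 0 < α * n := mul_pos hα0 (by exact_mod_cast hn0)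
  have hT' : (0 : ℝ) < T := by exact_mod_cast hT
  set O := ∫ P, risk ℓ P (θstar P) ∂𝓓 with hO
  set a := α * n with ha_def
  obtain ⟨F, hF⟩ : ∃ F : X → ℝ, F = fun m => gibbsMetaRisk n ℓ a 𝓓 (κ m) := ⟨_, rfl⟩
  have hF_meas : Measurable F := by rw [hF]; exact hℓ.measurable_gibbsMetaRisk κ 𝓓 n a
  have hF_mem : ∀ m, 0 ≤ F m ∧ F m ≤ C := fun m => by
    rw [hF]; exact hℓ.gibbsMetaRisk_mem_Icc 𝓓 ha hn0 (κ m)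
  have hF' : ∀ m, gibbsMetaRisk n ℓ a 𝓓 (κ m) = F m := fun m => by rw [hF]
  simp only [hF']
  have hO_mem : 0 ≤ O ∧ O ≤ C := integral_mem_Icc (hℓ.measurable_risk_comp hθ)
    (fun P => hℓ.risk_nonneg P _) (fun P => hℓ.risk_le P _)
  have hN_mem : ∀ (S : Fin n → Z) m, 0 ≤ freeEnergy ℓ a S (κ m) ∧ freeEnergy ℓ a S (κ m) ≤ C :=
    fun S m => hℓ.freeEnergy_mem_Icc ha hn0 S (κ m)
  obtain ⟨e, he⟩ : ∃ e : X → ProbabilityMeasure Z → (Fin n → Z) → ℝ, ∀ m P S, e m P S =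
    Real.exp (α * ((F m - O) / 2 + (empRisk ℓ S (θstar P) - freeEnergy ℓ a S (κ m)))) :=
    ⟨_, fun _ _ _ => rfl⟩
  have he_meas : Measurable fun p : X × ProbabilityMeasure Z × (Fin n → Z) => e p.1 p.2.1 p.2.2 := by
    have h1 : Measurable fun p : X × ProbabilityMeasure Z × (Fin n → Z) => (p.1, p.2.2) := by
      fun_prop
    simp only [he]
    exact ((((hF_meas.comp measurable_fst).sub_const O).div_const 2).add
      (((hℓ.measurable_empRisk_comp hθ).comp measurable_snd).sub
        ((hℓ.measurable_freeEnergy κ).comp h1))).const_mul α |>.exp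
  have he0 : ∀ m P S, 0 ≤ e m P S := fun m P S => by
    rw [he]; exact (Real.exp_pos _).le
  have he_meas' : ∀ P S, Measurable fun m => e m P S := fun P S => by
    have h1 : Measurable fun m : X => (m, P, S) := by fun_prop
    exact he_meas.comp h1
  have heE : ∀ m P S, e m P S ≤ Real.exp (α * (C / 2 + C)) := fun m P S => by
    rw [he, Real.exp_le_exp]
    refine mul_le_mul_of_nonneg_left ?_ hα0.le
    linarith [(hF_mem m).2, hO_mem.1, hℓ.empRisk_le hn0 S (θstar P), (hN_mem S m).1]
  obtain ⟨hW1, hW2, hW3⟩ := integral_prod_tasks_le_one (T := T) (sampleKernel Z n) 𝓓 Λ he_meas he0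
    heE (fun m => by
      have h := hℓ.integral_integral_exp_le_one 𝓓 hC hc hα hn hθ hmin hB (κ m)
      rw [hF', ← hO] at h
      simp only [he]
      exact h)
  obtain ⟨u, hu⟩ : ∃ u : ProbabilityMeasure Z → (Fin n → Z) → ℝ, u = fun P S =>
    ∫ m, freeEnergy ℓ a S (κ m) ∂Q - empRisk ℓ S (θstar P) := ⟨_, rfl⟩
  have hNQ_meas : Measurable fun S : Fin n → Z => ∫ m, freeEnergy ℓ a S (κ m) ∂Q := by
    have hm : Measurable fun q : (Fin n → Z) × X => freeEnergy ℓ a q.1 (κ q.2) :=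
      (hℓ.measurable_freeEnergy (n := n) (a := a) κ).comp measurable_swap
    exact (hm.stronglyMeasurable.integral_prod_right' (ν := Q)).measurable
  have hNQ_mem : ∀ S : Fin n → Z, 0 ≤ ∫ m, freeEnergy ℓ a S (κ m) ∂Q ∧
      ∫ m, freeEnergy ℓ a S (κ m) ∂Q ≤ C := fun S =>
    integral_mem_Icc (hℓ.measurable_freeEnergy_comp κ S a) (fun m => (hN_mem S m).1)
      (fun m => (hN_mem S m).2)
  have hu_meas : Measurable (Function.uncurry u) := by
    rw [hu]
    exact (hNQ_meas.comp measurable_snd).sub (hℓ.measurable_empRisk_comp hθ)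
  obtain ⟨hu1, hu2, hu3⟩ := integral_sum_tasks (T := T) (sampleKernel Z n) 𝓓 hu_meas (A := -C)
    (B := C) (fun P S => by
      simp only [hu]; linarith [(hNQ_mem S).1, hℓ.empRisk_le hn0 S (θstar P)])
    (fun P S => by
      simp only [hu]; linarith [(hNQ_mem S).2, hℓ.empRisk_nonneg S (θstar P)])
  have hu_int : ∫ P, ∫ S, u P S ∂(sampleKernel Z n P) ∂𝓓
      = ∫ m, meanFreeEnergy n ℓ a 𝓓 (κ m) ∂Q - O := by
    rw [← hℓ.integral_integral_integral_freeEnergy κ 𝓓 ha hn0 Q, hO, ← integral_sub]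
    · refine integral_congr_ae (Filter.Eventually.of_forall fun P => ?_)
      change ∫ S, u P S ∂(sampleLaw n P) = _
      simp only [hu]
      rw [integral_sub, hℓ.integral_empRisk hn0]
      · exact integrable_of_mem_Icc hNQ_meas (fun S => (hNQ_mem S).1) (fun S => (hNQ_mem S).2)
      · exact integrable_of_mem_Icc (hℓ.measurable_empRisk_left _) (fun S => hℓ.empRisk_nonneg S _)
          (fun S => hℓ.empRisk_le hn0 S _)
    · have hm : Measurable fun P => ∫ S, ∫ m, freeEnergy ℓ a S (κ m) ∂Q ∂(sampleKernel Z n P) :=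
        measurable_integral_kernel (sampleKernel Z n) (hNQ_meas.comp measurable_snd)
      exact integrable_of_mem_Icc hm
        (fun P => (integral_mem_Icc hNQ_meas (fun S => (hNQ_mem S).1) (fun S => (hNQ_mem S).2)).1)
        (fun P => (integral_mem_Icc hNQ_meas (fun S => (hNQ_mem S).1) (fun S => (hNQ_mem S).2)).2)
    · exact integrable_of_mem_Icc (hℓ.measurable_risk_comp hθ) (fun P => hℓ.risk_nonneg P _)
        (fun P => hℓ.risk_le P _)
  let c0 : ℝ := O + 2 / (α * T) * ((klDiv Q Λ).toReal - 1)
  -- Majorant of the meta-risk under Q̂ that no longer involves Q̂. In expectation, each `u` term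
  -- becomes the mean free energy under Q minus O, and the last integral is at most 1, which cancels
  -- the -1 in `c0`.
  let V : (Fin T → ProbabilityMeasure Z) → (Fin T → Fin n → Z) → ℝ := fun P S =>
    c0 + 2 / T * ∑ t, u (P t) (S t) + 2 / (α * T) * ∫ m, ∏ t, e m (P t) (S t) ∂Λ
  have hpt : ∀ P S, ∫ m, F m ∂(Qhat S) ≤ V P S := by
    intro P S
    have := hQhat S
    have h := integral_le_of_criterion hα0 hT (F := F) (N := fun t m => freeEnergy ℓ a (S t) (κ m))
      (r := fun t => empRisk ℓ (S t) (θstar (P t))) (O := O) (hKL S)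
      (integrable_of_mem_Icc hF_meas (fun m => (hF_mem m).1) (fun m => (hF_mem m).2))
      (fun t => integrable_of_mem_Icc (hℓ.measurable_freeEnergy_comp κ (S t) a)
        (fun m => (hN_mem _ m).1) (fun m => (hN_mem _ m).2)) ?_ (hcrit S)
    · refine h.trans (le_of_eq ?_)
      simp only [V, c0, hu, he, Finset.sum_sub_distrib]
      field_simp
      ring
    · simp only [← he]
      exact integrable_of_mem_Icc (Finset.measurable_prod _ fun t _ => he_meas' _ _)
        (fun m => (prod_mem_Icc (fun t => he0 m (P t) (S t)) (fun t => heE _ _ _)).1)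
        (fun m => (prod_mem_Icc (fun t => he0 m (P t) (S t)) (fun t => heE _ _ _)).2)
  have hVi1 : ∀ P, Integrable (V P) (Measure.pi fun t => sampleLaw n (P t)) := fun P =>
    ((integrable_const c0).add ((hu1 P).const_mul _)).add ((hW1 P).const_mul _)
  have hVint : ∀ P : Fin T → ProbabilityMeasure Z,
      ∫ S, V P S ∂(Measure.pi fun t => sampleLaw n (P t))
      = c0 + 2 / T * ∫ S : Fin T → Fin n → Z, ∑ t, u (P t) (S t)
          ∂(Measure.pi fun t => sampleKernel Z n (P t))
        + 2 / (α * T) * ∫ S : Fin T → Fin n → Z, ∫ m, ∏ t, e m (P t) (S t) ∂Λ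
          ∂(Measure.pi fun t => sampleKernel Z n (P t)) := fun P => by
    have hi : Integrable (fun S : Fin T → Fin n → Z => c0 + 2 / T * ∑ t, u (P t) (S t))
        (Measure.pi fun t => sampleKernel Z n (P t)) :=
      (integrable_const c0).add ((hu1 P).const_mul _)
    change ∫ S, V P S ∂(Measure.pi fun t => sampleKernel Z n (P t)) = _
    simp only [V]
    rw [integral_add hi ((hW1 P).const_mul _), integral_add (integrable_const c0)
      ((hu1 P).const_mul _), integral_const_mul, integral_const_mul]
    simp
  refine (lintegral_lintegral_le_ofReal (V := V) (fun P S =>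
    (integral_nonneg fun m => (hF_mem m).1).trans (hpt P S)) (fun P S => ?_) hVi1 ?_).trans ?_
  · have := hQhat S
    rw [← ofReal_integral_eq_lintegral_ofReal]
    · exact ENNReal.ofReal_le_ofReal (hpt P S)
    · exact integrable_of_mem_Icc hF_meas (fun m => (hF_mem m).1) (fun m => (hF_mem m).2)
    · exact Filter.Eventually.of_forall fun m => (hF_mem m).1
  · simp only [hVint]
    exact ((integrable_const c0).add (hu2.const_mul _)).add (hW2.const_mul _)
  · refine ENNReal.ofReal_le_ofReal ?_
    simp only [hVint]
    have hi : Integrable (fun P : Fin T → ProbabilityMeasure Z => c0 + 2 / T *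
        ∫ S : Fin T → Fin n → Z, ∑ t, u (P t) (S t) ∂(Measure.pi fun t => sampleKernel Z n (P t)))
        (Measure.pi fun _ => 𝓓) := (integrable_const c0).add (hu2.const_mul _)
    rw [integral_add hi (hW2.const_mul _), integral_add (integrable_const c0) (hu2.const_mul _), integral_const_mul,
      integral_const_mul, hu3, hu_int]
    simp only [integral_const, probReal_univ, smul_eq_mul, one_mul]
    have h2 : 2 / (α * T) * ∫ P : Fin T → ProbabilityMeasure Z, ∫ S : Fin T → Fin n → Z,
        ∫ m, ∏ t, e m (P t) (S t) ∂Λ ∂(Measure.pi fun t => sampleKernel Z n (P t))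
        ∂(Measure.pi fun _ => 𝓓) ≤ 2 / (α * T) * 1 :=
      mul_le_mul_of_nonneg_left hW3 (by positivity)
    refine (add_le_add_right h2 _).trans (le_of_eq ?_)
    simp only [c0]
    field_simp
    ring

end IsBoundedLoss

end

section

/-! ### Divergences of product measures -/

section KLProd

variable {Ω : Type*} [MeasurableSpace Ω] {μ ν : Measure Ω}

/-- Only an inequality: where the density vanishes, `llr` takes the value 0 because log 0 = 0, and
its exponential is 1. -/
theorem rnDeriv_le_exp_llr [SigmaFinite μ] :
    (fun x => μ.rnDeriv ν x) ≤ᵐ[ν] fun x => ENNReal.ofReal (Real.exp (llr μ ν x)) := by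
  filter_upwards [exp_llr μ ν, Measure.rnDeriv_lt_top μ ν] with x hx hlt
  rw [hx]
  split_ifs with h
  · simp [h]
  · rw [ENNReal.ofReal_toReal hlt.ne]

theorem toReal_klDiv_eq_integral_llr [IsProbabilityMeasure μ] [IsProbabilityMeasure ν]
    (h : klDiv μ ν ≠ ∞) : (klDiv μ ν).toReal = ∫ x, llr μ ν x ∂μ :=
  toReal_klDiv_of_measure_eq (klDiv_ne_top_iff.mp h).1 (by simp)

/-- If ν contains the fraction c of ν', the density of μ grows by at most the factor 1/c. Applied to
one component of a mixture (cost -log w_k) and to one value of K in Λ (cost log T). -/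
theorem klDiv_le_add_log [IsProbabilityMeasure μ] [IsProbabilityMeasure ν] {ν' : Measure Ω}
    [IsProbabilityMeasure ν'] {c : ℝ} (hc : 0 < c) (hle : ENNReal.ofReal c • ν' ≤ ν) :
    klDiv μ ν ≤ klDiv μ ν' + ENNReal.ofReal (-Real.log c) := by
  by_cases h : klDiv μ ν' = ∞
  · simp [h]
  obtain ⟨hac, hint⟩ := klDiv_ne_top_iff.mp h
  have hm := measurable_llr μ ν'
  have hle' : ν' ≤ ENNReal.ofReal c⁻¹ • ν := by
    calc ν' = ENNReal.ofReal c⁻¹ • (ENNReal.ofReal c • ν') := by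
          rw [smul_smul, ← ENNReal.ofReal_mul (inv_nonneg.mpr hc.le), inv_mul_cancel₀ hc.ne']
          simp
      _ ≤ _ := by gcongr
  have h1 : μ ≤ ν.withDensity fun x => ENNReal.ofReal (Real.exp (llr μ ν' x - Real.log c)) := by
    calc μ = ν'.withDensity (μ.rnDeriv ν') := (Measure.withDensity_rnDeriv_eq _ _ hac).symm
      _ ≤ ν'.withDensity fun x => ENNReal.ofReal (Real.exp (llr μ ν' x)) :=
          withDensity_mono rnDeriv_le_exp_llr
      _ ≤ (ENNReal.ofReal c⁻¹ • ν).withDensity fun x => ENNReal.ofReal (Real.exp (llr μ ν' x)) := by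
          refine Measure.le_iff.mpr fun s hs => ?_
          rw [withDensity_apply _ hs, withDensity_apply _ hs]
          exact lintegral_mono' (Measure.restrict_mono le_rfl hle') le_rfl
      _ = _ := by
          rw [withDensity_smul_measure, ← withDensity_smul _ hm.exp.ennreal_ofReal]
          congr 1
          ext x
          rw [Pi.smul_apply, smul_eq_mul, ← ENNReal.ofReal_mul (inv_nonneg.mpr hc.le), Real.exp_sub,
            Real.exp_log hc, div_eq_inv_mul]
  refine (klDiv_le_of_le_withDensity (hm.sub_const _) (hint.sub (integrable_const _)) h1).trans ?_
  rw [integral_sub hint (integrable_const _), ← toReal_klDiv_eq_integral_llr h]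
  simp only [integral_const, probReal_univ, smul_eq_mul, one_mul, sub_eq_add_neg]
  refine ENNReal.ofReal_add_le.trans ?_
  rw [ENNReal.ofReal_toReal h]

/-- Densities of products multiply, so the sum of the two log-likelihood ratios bounds the log
density of the product. -/
theorem klDiv_prod_le {Ω' : Type*} [MeasurableSpace Ω'] {μ' ν' : Measure Ω'}
    [IsProbabilityMeasure μ] [IsProbabilityMeasure ν] [IsProbabilityMeasure μ']
    [IsProbabilityMeasure ν'] :
    klDiv (μ.prod μ') (ν.prod ν') ≤ klDiv μ ν + klDiv μ' ν' := by
  by_cases h : klDiv μ ν = ∞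
  · simp [h]
  by_cases h' : klDiv μ' ν' = ∞
  · simp [h']
  obtain ⟨hac, hint⟩ := klDiv_ne_top_iff.mp h
  obtain ⟨hac', hint'⟩ := klDiv_ne_top_iff.mp h'
  have hi : Integrable (fun p : Ω × Ω' => llr μ ν p.1) (μ.prod μ') := hint.comp_fst μ'
  have hi' : Integrable (fun p : Ω × Ω' => llr μ' ν' p.2) (μ.prod μ') := hint'.comp_snd μ
  refine (klDiv_le_of_le_withDensity (f := fun p => llr μ ν p.1 + llr μ' ν' p.2)
    (((measurable_llr μ ν).comp measurable_fst).add ((measurable_llr μ' ν').comp measurable_snd))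
    (hi.add hi') ?_).trans ?_
  · calc μ.prod μ' = (ν.withDensity (μ.rnDeriv ν)).prod (ν'.withDensity (μ'.rnDeriv ν')) := by
          rw [Measure.withDensity_rnDeriv_eq _ _ hac, Measure.withDensity_rnDeriv_eq _ _ hac']
      _ = (ν.prod ν').withDensity fun p => μ.rnDeriv ν p.1 * μ'.rnDeriv ν' p.2 :=
          prod_withDensity (Measure.measurable_rnDeriv _ _) (Measure.measurable_rnDeriv _ _)
      _ ≤ _ := by
          refine withDensity_mono ?_
          filter_upwards [Measure.quasiMeasurePreserving_fst.ae (rnDeriv_le_exp_llr (μ := μ)),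
            Measure.quasiMeasurePreserving_snd.ae (rnDeriv_le_exp_llr (μ := μ'))] with p h1 h2
          rw [Real.exp_add, ENNReal.ofReal_mul (Real.exp_pos _).le]
          exact mul_le_mul' h1 h2
  · rw [integral_add hi hi', integral_fun_fst, integral_fun_snd]
    simp only [probReal_univ, one_smul]
    refine ENNReal.ofReal_add_le.trans ?_
    rw [← toReal_klDiv_eq_integral_llr h, ← toReal_klDiv_eq_integral_llr h',
      ENNReal.ofReal_toReal h, ENNReal.ofReal_toReal h']

theorem lintegral_pi_prod {ι : Type*} [Fintype ι] {E : ι → Type*} [∀ i, MeasurableSpace (E i)]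
    (ν : ∀ i, Measure (E i)) [∀ i, IsProbabilityMeasure (ν i)] {g : ∀ i, E i → ℝ≥0∞}
    (hg : ∀ i, Measurable (g i)) :
    ∫⁻ x, ∏ i, g i (x i) ∂(Measure.pi ν) = ∏ i, ∫⁻ x, g i x ∂(ν i) := by
  rw [lintegral_prod_eq_prod_lintegral_of_indepFun (X := fun i (x : ∀ i, E i) => g i (x i))]
  · refine Finset.prod_congr rfl fun i _ => ?_
    exact (measurePreserving_eval ν i).lintegral_comp (hg i)
  · exact iIndepFun_pi fun i => (hg i).aemeasurable
  · exact fun i => (hg i).comp (measurable_pi_apply i)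

theorem pi_withDensity {ι : Type*} [Fintype ι] {E : ι → Type*} [∀ i, MeasurableSpace (E i)]
    (ν : ∀ i, Measure (E i)) [∀ i, IsProbabilityMeasure (ν i)] {g : ∀ i, E i → ℝ≥0∞}
    (hg : ∀ i, Measurable (g i)) [∀ i, SigmaFinite ((ν i).withDensity (g i))] :
    Measure.pi (fun i => (ν i).withDensity (g i))
      = (Measure.pi ν).withDensity fun x => ∏ i, g i (x i) := by
  refine Measure.pi_eq fun s hs => ?_
  rw [withDensity_apply _ (MeasurableSet.univ_pi hs),
    ← lintegral_indicator (MeasurableSet.univ_pi hs)]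
  have h1 : ∀ x : ∀ i, E i, (Set.univ.pi s).indicator (fun x => ∏ i, g i (x i)) x
      = ∏ i, (s i).indicator (g i) (x i) := fun x => by
    by_cases hx : x ∈ Set.univ.pi s
    · rw [Set.indicator_of_mem hx]
      exact Finset.prod_congr rfl fun i _ =>
        (Set.indicator_of_mem (hx i (Set.mem_univ i)) _).symm
    · rw [Set.indicator_of_notMem hx]
      simp only [Set.mem_univ_pi, not_forall] at hx
      obtain ⟨i, hi⟩ := hx
      exact (Finset.prod_eq_zero (Finset.mem_univ i) (Set.indicator_of_notMem hi _)).symm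
  simp only [h1]
  rw [lintegral_pi_prod ν fun i => (hg i).indicator (hs i)]
  refine Finset.prod_congr rfl fun i _ => ?_
  rw [lintegral_indicator (hs i), withDensity_apply _ (hs i)]

theorem klDiv_pi_le {ι : Type*} [Fintype ι] {E : ι → Type*} [∀ i, MeasurableSpace (E i)]
    (μ ν : ∀ i, Measure (E i)) [∀ i, IsProbabilityMeasure (μ i)]
    [∀ i, IsProbabilityMeasure (ν i)] :
    klDiv (Measure.pi μ) (Measure.pi ν) ≤ ∑ i, klDiv (μ i) (ν i) := by
  by_cases h : ∃ i, klDiv (μ i) (ν i) = ∞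
  · obtain ⟨i, hi⟩ := h
    exact le_top.trans (hi ▸ Finset.single_le_sum (f := fun i => klDiv (μ i) (ν i))
      (fun _ _ => zero_le) (Finset.mem_univ i))
  push Not at h
  have hac := fun i => (klDiv_ne_top_iff.mp (h i)).1
  have hi : ∀ i, Integrable (fun x : ∀ i, E i => llr (μ i) (ν i) (x i)) (Measure.pi μ) := fun i =>
    integrable_comp_eval (klDiv_ne_top_iff.mp (h i)).2
  have hd : ∀ i, (ν i).withDensity ((μ i).rnDeriv (ν i)) = μ i := fun i =>
    Measure.withDensity_rnDeriv_eq _ _ (hac i)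
  have : ∀ i, SigmaFinite ((ν i).withDensity ((μ i).rnDeriv (ν i))) := fun i => by
    rw [hd]; infer_instance
  have hm : Measurable fun x : ∀ i, E i => ∑ i, llr (μ i) (ν i) (x i) :=
    Finset.measurable_fun_sum _ fun i _ => (measurable_llr (μ i) (ν i)).comp (measurable_pi_apply i)
  refine (klDiv_le_of_le_withDensity hm
    (integrable_finsetSum _ fun i _ => hi i) ?_).trans ?_
  · calc Measure.pi μ = Measure.pi fun i => (ν i).withDensity ((μ i).rnDeriv (ν i)) := by
          simp only [hd]
      _ = (Measure.pi ν).withDensity fun x => ∏ i, (μ i).rnDeriv (ν i) (x i) :=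
          pi_withDensity ν fun i => Measure.measurable_rnDeriv _ _
      _ ≤ _ := by
          refine withDensity_mono ?_
          have h1 : ∀ᵐ x ∂(Measure.pi ν), ∀ i, (μ i).rnDeriv (ν i) (x i)
              ≤ ENNReal.ofReal (Real.exp (llr (μ i) (ν i) (x i))) := by
            rw [ae_all_iff]
            exact fun i => (Measure.quasiMeasurePreserving_eval ν i).ae rnDeriv_le_exp_llr
          filter_upwards [h1] with x hx
          rw [Real.exp_sum, ENNReal.ofReal_prod_of_nonneg fun i _ => (Real.exp_pos _).le]
          exact Finset.prod_le_prod' fun i _ => hx i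
  · rw [integral_finsetSum _ fun i _ => hi i]
    have h2 : ∀ i, ∫ x : ∀ i, E i, llr (μ i) (ν i) (x i) ∂(Measure.pi μ)
        = (klDiv (μ i) (ν i)).toReal := fun i => by
      rw [toReal_klDiv_eq_integral_llr (h i)]
      exact integral_comp_eval (measurable_llr _ _).aestronglyMeasurable
    simp only [h2]
    rw [ENNReal.ofReal_sum_of_nonneg fun i _ => ENNReal.toReal_nonneg]
    exact (Finset.sum_congr rfl fun i _ => ENNReal.ofReal_toReal (h i)).le

end KLProd

end

section

/-! ### Gaussian and Gamma distributions on the line -/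

theorem integral_sq_sub_gaussianReal (m c : ℝ) (s : ℝ≥0) :
    Integrable (fun x => (x - c) ^ 2) (gaussianReal m s) ∧
      ∫ x, (x - c) ^ 2 ∂(gaussianReal m s) = s + (m - c) ^ 2 := by
  have h1 : Integrable (fun x : ℝ => x) (gaussianReal m s) :=
    (memLp_id_gaussianReal 1).integrable (by norm_num)
  have h2 : Integrable (fun x : ℝ => x ^ 2) (gaussianReal m s) :=
    (memLp_id_gaussianReal 2).integrable_sq
  have hv : ∫ x, (x - m) ^ 2 ∂(gaussianReal m s) = s := by
    have := variance_fun_id_gaussianReal (μ := m) (v := s)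
    rw [variance_eq_integral (by fun_prop)] at this
    simpa using this
  have h3 : Integrable (fun x : ℝ => (x - m) ^ 2) (gaussianReal m s) := by
    have : (fun x : ℝ => (x - m) ^ 2) = fun x => x ^ 2 - 2 * m * x + m ^ 2 := by ext x; ring
    rw [this]
    exact (h2.sub (h1.const_mul _)).add (integrable_const _)
  have h4 : (fun x : ℝ => (x - c) ^ 2)
      = fun x => (x - m) ^ 2 + (2 * (m - c) * x + ((m - c) ^ 2 - 2 * (m - c) * m)) := by
    ext x; ring
  have h5 : Integrable (fun x : ℝ => 2 * (m - c) * x + ((m - c) ^ 2 - 2 * (m - c) * m))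
      (gaussianReal m s) := (h1.const_mul _).add (integrable_const _)
  rw [h4]
  refine ⟨h3.add h5, ?_⟩
  rw [integral_add h3 h5, integral_add (h1.const_mul _) (integrable_const _), integral_const_mul,
    integral_id_gaussianReal, hv]
  simp

theorem klDiv_gaussianReal_le (m m' : ℝ) {s s' : ℝ≥0} (hs : s ≠ 0) (hs' : s' ≠ 0) :
    klDiv (gaussianReal m s) (gaussianReal m' s')
      ≤ ENNReal.ofReal (1 / 2 * (Real.log (s' / s) - 1 + (s + (m - m') ^ 2) / s')) := by
  have hs0 : (0 : ℝ) < s := by positivity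
  have hs0' : (0 : ℝ) < s' := by positivity
  obtain ⟨i1, e1⟩ := integral_sq_sub_gaussianReal m m s
  obtain ⟨i2, e2⟩ := integral_sq_sub_gaussianReal m m' s
  obtain ⟨cst, hcst⟩ : ∃ cst, cst = 1 / 2 * Real.log (s' / s) := ⟨_, rfl⟩
  -- The logarithm of the ratio of the two Gaussian densities.
  let f : ℝ → ℝ := fun x =>
    cst - 1 / (2 * s) * (x - m) ^ 2 + 1 / (2 * s') * (x - m') ^ 2
  have hf : Measurable f := by fun_prop
  have i3 : Integrable (fun x => cst - 1 / (2 * s) * (x - m) ^ 2)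
      (gaussianReal m s) := (integrable_const _).sub (i1.const_mul _)
  refine (klDiv_le_of_le_withDensity hf (i3.add (i2.const_mul _)) (le_of_eq ?_)).trans
    (ENNReal.ofReal_le_ofReal (le_of_eq ?_))
  · rw [gaussianReal_of_var_ne_zero _ hs, gaussianReal_of_var_ne_zero _ hs',
      ← withDensity_mul _ (measurable_gaussianPDF _ _) hf.exp.ennreal_ofReal]
    congr 1
    ext x
    rw [Pi.mul_apply, gaussianPDF, gaussianPDF,
      ← ENNReal.ofReal_mul (gaussianPDFReal_nonneg _ _ _)]
    congr 1
    have h1 : Real.exp cst = √(2 * Real.pi * s') / √(2 * Real.pi * s) := by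
      rw [hcst, mul_comm, Real.exp_mul, Real.exp_log (by positivity), ← Real.sqrt_eq_rpow,
        ← Real.sqrt_div (by positivity), mul_div_mul_left _ _ (by positivity)]
    have h2 : Real.exp (-(x - m') ^ 2 / (2 * s')) * Real.exp (f x)
        = Real.exp cst * Real.exp (-(x - m) ^ 2 / (2 * s)) := by
      rw [← Real.exp_add, ← Real.exp_add]
      congr 1
      simp only [f]
      ring
    simp only [gaussianPDFReal]
    rw [mul_assoc (√(2 * Real.pi * s'))⁻¹, h2, h1]
    have h3 : 0 < √(2 * Real.pi * s') := by positivity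
    have h4 : 0 < √(2 * Real.pi * s) := by positivity
    field_simp
  · simp only [f]
    rw [integral_add i3 (i2.const_mul _), integral_sub (integrable_const _) (i1.const_mul _),
      integral_const_mul, integral_const_mul, e1, e2]
    simp only [integral_const, probReal_univ, smul_eq_mul, one_mul, hcst]
    field_simp
    ring

theorem measurable_gammaPDF (a r : ℝ) : Measurable (gammaPDF a r) :=
  (measurable_gammaPDFReal a r).ennreal_ofReal

theorem lintegral_gammaMeasure {a r : ℝ} {g : ℝ → ℝ≥0∞} (hg : Measurable g) :
    ∫⁻ x, g x ∂(gammaMeasure a r) = ∫⁻ x, gammaPDF a r x * g x := by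
  rw [gammaMeasure, lintegral_withDensity_eq_lintegral_mul _
    (measurable_gammaPDF a r) hg]
  rfl

theorem lintegral_id_gammaMeasure {a r : ℝ} (ha : 0 < a) (hr : 0 < r) :
    ∫⁻ x, ENNReal.ofReal x ∂(gammaMeasure a r) = ENNReal.ofReal (a / r) := by
  rw [lintegral_gammaMeasure (by fun_prop)]
  have h : ∀ x, gammaPDF a r x * ENNReal.ofReal x
      = ENNReal.ofReal (a / r) * gammaPDF (a + 1) r x := by
    intro x
    rcases lt_or_ge x 0 with hx | hx
    · simp [gammaPDF_of_neg hx]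
    · rw [gammaPDF, gammaPDF, ← ENNReal.ofReal_mul (gammaPDFReal_nonneg ha hr x),
        ← ENNReal.ofReal_mul (by positivity)]
      congr 1
      have hG := (Real.Gamma_pos_of_pos ha).ne'
      simp only [gammaPDFReal, if_pos hx, Real.Gamma_add_one ha.ne', Real.rpow_add_one hr.ne',
        add_sub_cancel_right]
      have : x ^ a = x ^ (a - 1) * x := by
        rcases hx.eq_or_lt with rfl | hx'
        · simp [Real.zero_rpow ha.ne']
        · rw [← Real.rpow_add_one hx'.ne', sub_add_cancel]
      rw [this]
      field_simp
  simp only [h]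
  rw [lintegral_const_mul _ (measurable_gammaPDF _ r),
    lintegral_gammaPDF_eq_one (by linarith) hr, mul_one]

/-- Dividing the Γ(2, r) density by x gives r times the Γ(1, r) density. Shape 2 keeps the mean of
the inverse variance finite; with shape 1 it would diverge. -/
theorem lintegral_inv_gammaMeasure_two_le {r : ℝ} (hr : 0 < r) :
    ∫⁻ x, ENNReal.ofReal x⁻¹ ∂(gammaMeasure 2 r) ≤ ENNReal.ofReal r := by
  rw [lintegral_gammaMeasure (by fun_prop)]
  calc ∫⁻ x, gammaPDF 2 r x * ENNReal.ofReal x⁻¹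
      ≤ ∫⁻ x, ENNReal.ofReal r * gammaPDF 1 r x := by
        refine lintegral_mono fun x => ?_
        rcases lt_trichotomy x 0 with hx | rfl | hx
        · simp [gammaPDF_of_neg hx]
        · simp
        · rw [gammaPDF, gammaPDF, ← ENNReal.ofReal_mul (gammaPDFReal_nonneg (by norm_num) hr x),
            ← ENNReal.ofReal_mul hr.le]
          refine ENNReal.ofReal_le_ofReal (le_of_eq ?_)
          have e2 : (2 : ℝ) - 1 = 1 := by norm_num
          simp only [gammaPDFReal, if_pos hx.le, e2, Real.rpow_one, sub_self, Real.rpow_zero,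
            Real.Gamma_one, Real.Gamma_two]
          rw [Real.rpow_two]
          field_simp
    _ = ENNReal.ofReal r := by
        rw [lintegral_const_mul _ (measurable_gammaPDF _ r),
          lintegral_gammaPDF_eq_one one_pos hr, mul_one]

theorem ae_pos_gammaMeasure (a r : ℝ) : ∀ᵐ x ∂(gammaMeasure a r), 0 < x := by
  rw [gammaMeasure, ae_withDensity_iff (measurable_gammaPDF a r)]
  filter_upwards [compl_mem_ae_iff.mpr (measure_singleton (μ := volume) (0 : ℝ))] with x hx h
  by_contra hx'
  exact h (gammaPDF_of_neg (lt_of_le_of_ne (not_lt.mp hx') hx))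

theorem integrable_id_gammaMeasure {a r : ℝ} (ha : 0 < a) (hr : 0 < r) :
    Integrable (fun x => x) (gammaMeasure a r) ∧ ∫ x, x ∂(gammaMeasure a r) = a / r := by
  have h0 : 0 ≤ᵐ[gammaMeasure a r] fun x => x := (ae_pos_gammaMeasure a r).mono fun x hx => hx.le
  have h := lintegral_id_gammaMeasure ha hr
  have hm : AEStronglyMeasurable (fun x : ℝ => x) (gammaMeasure a r) :=
    measurable_id.aestronglyMeasurable
  refine ⟨(lintegral_ofReal_ne_top_iff_integrable hm h0).mp (by rw [h]; simp), ?_⟩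
  rw [integral_eq_lintegral_of_nonneg_ae h0 hm, h, ENNReal.toReal_ofReal (by positivity)]

theorem klDiv_gammaMeasure_two_le {b b' : ℝ} (hb : 0 < b) (hb' : 0 < b') :
    klDiv (gammaMeasure 2 b) (gammaMeasure 2 b')
      ≤ ENNReal.ofReal (2 * (Real.log (b / b') + b' / b - 1)) := by
  have := isProbabilityMeasure_gammaMeasure two_pos hb
  have := isProbabilityMeasure_gammaMeasure two_pos hb'
  obtain ⟨i1, e1⟩ := integrable_id_gammaMeasure two_pos hb
  obtain ⟨cst, hcst⟩ : ∃ cst, cst = 2 * Real.log (b / b') := ⟨_, rfl⟩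
  let f : ℝ → ℝ := fun x => cst - (b - b') * x
  have hf : Measurable f := by fun_prop
  refine (klDiv_le_of_le_withDensity hf ((integrable_const _).sub (i1.const_mul _))
    (le_of_eq ?_)).trans (ENNReal.ofReal_le_ofReal (le_of_eq ?_))
  · rw [gammaMeasure, gammaMeasure, ← withDensity_mul _
      (measurable_gammaPDF _ _) hf.exp.ennreal_ofReal]
    congr 1
    ext x
    rw [Pi.mul_apply]
    rcases lt_or_ge x 0 with hx | hx
    · simp [gammaPDF_of_neg hx]
    · rw [gammaPDF, gammaPDF, ← ENNReal.ofReal_mul (gammaPDFReal_nonneg two_pos hb' x)]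
      congr 1
      simp only [gammaPDFReal, if_pos hx, f]
      have h1 : Real.exp cst = (b / b') ^ 2 := by
        rw [hcst, mul_comm, Real.exp_mul, Real.exp_log (by positivity), Real.rpow_two]
      have h2 : Real.exp (-(b * x)) = Real.exp (-(b' * x)) / Real.exp ((b - b') * x) := by
        rw [← Real.exp_sub]; congr 1; ring
      rw [Real.exp_sub, h1, h2, Real.rpow_two, Real.rpow_two, Real.Gamma_two]
      field_simp
  · simp only [f]
    rw [integral_sub (integrable_const _) (i1.const_mul _), integral_const_mul, e1]
    simp only [integral_const, probReal_univ, smul_eq_mul, one_mul, hcst]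
    field_simp
    ring

/-- Only (0, 1] contributes to the positive part of -log x. There the exponential density is at most
1, and -log x has integral 1. -/
theorem lintegral_neg_log_exp_le :
    ∫⁻ x, ENNReal.ofReal (-Real.log x) ∂(gammaMeasure 1 1) ≤ 1 := by
  rw [lintegral_gammaMeasure (by fun_prop)]
  calc ∫⁻ x, gammaPDF 1 1 x * ENNReal.ofReal (-Real.log x)
      ≤ ∫⁻ x, (Set.Ioc (0 : ℝ) 1).indicator (fun x => ENNReal.ofReal (-Real.log x)) x := by
        refine lintegral_mono fun x => ?_
        rcases lt_trichotomy x 0 with hx | rfl | hx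
        · simp [gammaPDF_of_neg hx]
        · simp
        · rcases le_or_gt x 1 with hx1 | hx1
          · rw [Set.indicator_of_mem (Set.mem_Ioc.mpr ⟨hx, hx1⟩)]
            refine mul_le_of_le_one_left zero_le ?_
            rw [gammaPDF, ENNReal.ofReal_le_one]
            simp only [gammaPDFReal, if_pos hx.le]
            simp
            exact hx.le
          · rw [ENNReal.ofReal_of_nonpos (neg_nonpos.mpr (Real.log_nonneg hx1.le))]
            simp
    _ = 1 := by
        rw [lintegral_indicator measurableSet_Ioc, ← ofReal_integral_eq_lintegral_ofReal]
        · rw [← intervalIntegral.integral_of_le zero_le_one, intervalIntegral.integral_neg,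
            integral_log]
          simp
        · have := (intervalIntegral.intervalIntegrable_log' (a := 0) (b := 1)).neg
          rwa [intervalIntegrable_iff_integrableOn_Ioc_of_le zero_le_one] at this
        · filter_upwards [ae_restrict_mem measurableSet_Ioc] with x hx
          exact neg_nonneg.mpr (Real.log_nonpos hx.1.le hx.2)

end

section

/-! ### Mixtures of Gaussians and their hyper-distributions -/

theorem measurable_measurePi {X ι : Type*} [MeasurableSpace X] [Fintype ι] {E : ι → Type*}
    [∀ i, MeasurableSpace (E i)] {μ : X → ∀ i, Measure (E i)}
    [∀ x i, IsProbabilityMeasure (μ x i)] (h : ∀ i, Measurable fun x => μ x i) :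
    Measurable fun x => Measure.pi (μ x) := by
  refine Measurable.measure_of_isPiSystem_of_isProbabilityMeasure generateFrom_pi.symm
    isPiSystem_pi ?_
  rintro _ ⟨s, hs, rfl⟩
  simp only [Measure.pi_pi]
  exact Finset.measurable_prod _ fun i _ =>
    (Measure.measurable_coe (hs i (Set.mem_univ i))).comp (h i)

theorem measurable_sigma {K : Type*} {E : K → Type*} [∀ k, MeasurableSpace (E k)] {Y : Type*}
    [MeasurableSpace Y] {f : (Σ k, E k) → Y} (h : ∀ k, Measurable fun e : E k => f ⟨k, e⟩) :
    Measurable f := by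
  intro s hs
  rw [Sigma.instMeasurableSpace, MeasurableSpace.measurableSet_iInf]
  exact fun k => h k hs

theorem measurable_sigmaMk {K : Type*} {E : K → Type*} [∀ k, MeasurableSpace (E k)] (k : K) :
    Measurable (Sigma.mk k : E k → Σ k, E k) := by
  intro s hs
  rw [Sigma.instMeasurableSpace, MeasurableSpace.measurableSet_iInf] at hs
  exact hs k

variable {d K : ℕ}

/-- The isotropic Gaussian `N(μ, v I_d)`. -/
abbrev isoGaussian (μ : Fin d → ℝ) (v : ℝ) : Measure (Fin d → ℝ) :=
  Measure.pi fun i => gaussianReal (μ i) v.toNNReal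

theorem measurable_isoGaussian :
    Measurable fun p : (Fin d → ℝ) × ℝ => isoGaussian p.1 p.2 := by
  refine measurable_measurePi fun i => ?_
  have h : Measurable fun p : (Fin d → ℝ) × ℝ => (p.1 i, p.2.toNNReal) := by fun_prop
  exact measurable_gaussianReal.comp h

theorem measurable_mixture : Measurable (mixture : MixParam d → Measure (Fin d → ℝ)) := by
  refine measurable_sigma fun K => Measure.measurable_of_measurable_coe _ fun s hs => ?_
  simp only [mixture, Measure.coe_finsetSum, Finset.sum_apply, Measure.smul_apply, smul_eq_mul]
  change Measurable fun p : CompParam d K =>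
    ∑ k : Fin K, ENNReal.ofReal (p.1 k) * isoGaussian (p.2.1 k) (p.2.2 k) s
  refine Finset.measurable_fun_sum _ fun k _ => ?_
  have h' : Measurable fun p : CompParam d K => ENNReal.ofReal (p.1 k) := by fun_prop
  refine h'.mul ?_
  have h : Measurable fun p : CompParam d K => (p.2.1 k, p.2.2 k) := by fun_prop
  exact (Measure.measurable_coe hs).comp (measurable_isoGaussian.comp h)

theorem measurableSet_mixture_univ : MeasurableSet {m : MixParam d | mixture m Set.univ = 1} :=
  ((Measure.measurable_coe MeasurableSet.univ).comp measurable_mixture) (measurableSet_singleton 1)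

theorem mixture_univ (m : MixParam d) :
    mixture m Set.univ = ∑ k, ENNReal.ofReal (m.2.1 k) := by
  simp [mixture]

/-- The prior `mixture m`, where degenerate parameters are sent to a Dirac mass. -/
def priorKernel (d : ℕ) : Kernel (MixParam d) (Fin d → ℝ) :=
  open scoped Classical in
  ⟨fun m => if mixture m Set.univ = 1 then mixture m else Measure.dirac 0,
    Measurable.ite measurableSet_mixture_univ measurable_mixture measurable_const⟩

theorem priorKernel_apply {m : MixParam d} (h : mixture m Set.univ = 1) :
    priorKernel d m = mixture m := if_pos h

instance : IsMarkovKernel (priorKernel d) := by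
  refine ⟨fun m => ?_⟩
  by_cases h : mixture m Set.univ = 1
  · rw [priorKernel_apply h]; exact ⟨h⟩
  · have : priorKernel d m = Measure.dirac 0 := if_neg h
    rw [this]; infer_instance

theorem measurable_normalize : Measurable fun (g : Fin K → ℝ) k => g k / ∑ j, g j := by
  fun_prop

theorem isProbabilityMeasure_dirichlet {δ : Fin K → ℝ} (hδ : ∀ k, 0 < δ k) :
    IsProbabilityMeasure (dirichlet δ) := by
  have := fun k => isProbabilityMeasure_gammaMeasure (hδ k) one_pos
  exact Measure.isProbabilityMeasure_map measurable_normalize.aemeasurable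

theorem ae_dirichlet (hK : 0 < K) {δ : Fin K → ℝ} (hδ : ∀ k, 0 < δ k) :
    ∀ᵐ w ∂(dirichlet δ), (∀ k, 0 < w k) ∧ ∑ k, w k = 1 := by
  have := fun k => isProbabilityMeasure_gammaMeasure (hδ k) one_pos
  have hm : MeasurableSet {w : Fin K → ℝ | (∀ k, 0 < w k) ∧ ∑ k, w k = 1} := by
    have h : {w : Fin K → ℝ | (∀ k, 0 < w k) ∧ ∑ k, w k = 1}
        = (⋂ k, {w | 0 < w k}) ∩ {w | ∑ k, w k = 1} := by ext w; simp
    rw [h]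
    exact (MeasurableSet.iInter fun k => measurableSet_lt measurable_const
      (measurable_pi_apply k)).inter (measurableSet_eq_fun (by fun_prop) measurable_const)
  rw [dirichlet, ae_map_iff measurable_normalize.aemeasurable hm]
  have h : ∀ᵐ g ∂(Measure.pi fun k => gammaMeasure (δ k) 1), ∀ k, 0 < g k := by
    rw [ae_all_iff]
    intro k
    exact (measurePreserving_eval (fun k => gammaMeasure (δ k) 1) k).quasiMeasurePreserving.ae
      (ae_pos_gammaMeasure (δ k) 1)
  filter_upwards [h] with g hg
  have : Nonempty (Fin K) := ⟨⟨0, hK⟩⟩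
  have hs : 0 < ∑ j, g j := Finset.sum_pos (fun j _ => hg j) Finset.univ_nonempty
  exact ⟨fun k => div_pos (hg k) hs, by rw [← Finset.sum_div, div_self hs.ne']⟩

section CompHyper

variable {δ : Fin K → ℝ} {τ : Fin K → Fin d → ℝ} {ξ2 b : Fin K → ℝ}

theorem isProbabilityMeasure_compHyper (hδ : ∀ k, 0 < δ k) (hb : ∀ k, 0 < b k) :
    IsProbabilityMeasure (compHyper δ τ ξ2 b) := by
  have := isProbabilityMeasure_dirichlet hδ
  have := fun k => isProbabilityMeasure_gammaMeasure two_pos (hb k)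
  unfold compHyper
  infer_instance

theorem ae_compHyper (hK : 0 < K) (hδ : ∀ k, 0 < δ k) (hb : ∀ k, 0 < b k) :
    ∀ᵐ p ∂(compHyper δ τ ξ2 b), ((∀ k, 0 < p.1 k) ∧ ∑ k, p.1 k = 1) ∧ ∀ k, 0 < p.2.2 k := by
  have := isProbabilityMeasure_dirichlet hδ
  have := fun k => isProbabilityMeasure_gammaMeasure two_pos (hb k)
  have h : ∀ᵐ g ∂(Measure.pi fun k => gammaMeasure 2 (b k)), ∀ k, 0 < g k := by
    rw [ae_all_iff]
    intro k
    exact (measurePreserving_eval (fun k => gammaMeasure 2 (b k)) k).quasiMeasurePreserving.ae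
      (ae_pos_gammaMeasure 2 (b k))
  refine Filter.Eventually.and ?_ ?_
  · exact Measure.quasiMeasurePreserving_fst.ae (ae_dirichlet hK hδ)
  · exact (Measure.quasiMeasurePreserving_snd.comp Measure.quasiMeasurePreserving_snd).ae h

theorem ae_mixture_univ (hK : 0 < K) (hδ : ∀ k, 0 < δ k) (hb : ∀ k, 0 < b k) :
    ∀ᵐ p ∂(compHyper δ τ ξ2 b), mixture ⟨K, p⟩ Set.univ = 1 := by
  filter_upwards [ae_compHyper hK hδ hb] with p hp
  rw [mixture_univ, ← ENNReal.ofReal_sum_of_nonneg fun k _ => (hp.1.1 k).le, hp.1.2,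
    ENNReal.ofReal_one]

end CompHyper

section Hyper

variable {T : ℕ}

theorem isProbabilityMeasure_of_mem_hyperSet {Q : Measure (MixParam d)} (hQ : Q ∈ hyperSet d T) :
    IsProbabilityMeasure Q := by
  obtain ⟨x, δ, τ, ξ2, b, hx, hx1, hpos, rfl⟩ := hQ
  refine ⟨?_⟩
  simp only [hyper, Measure.coe_finsetSum, Finset.sum_apply, Measure.smul_apply, smul_eq_mul]
  rw [← ENNReal.ofReal_one, ← hx1, ENNReal.ofReal_sum_of_nonneg hx]
  refine Finset.sum_congr rfl fun K hK => ?_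
  have := isProbabilityMeasure_compHyper (δ := δ K) (τ := τ K) (ξ2 := ξ2 K) (b := b K)
    (fun k => (hpos K hK k).1) (fun k => (hpos K hK k).2.2)
  rw [Measure.map_apply (measurable_sigmaMk K) MeasurableSet.univ, Set.preimage_univ, measure_univ,
    mul_one]

theorem ae_mixture_univ_of_mem_hyperSet {Q : Measure (MixParam d)} (hQ : Q ∈ hyperSet d T) :
    ∀ᵐ m ∂Q, mixture m Set.univ = 1 := by
  obtain ⟨x, δ, τ, ξ2, b, hx, hx1, hpos, rfl⟩ := hQ
  rw [hyper, ae_iff]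
  simp only [Measure.coe_finsetSum, Finset.sum_apply, Measure.smul_apply, smul_eq_mul]
  refine Finset.sum_eq_zero fun K hK => mul_eq_zero_of_right _ ?_
  have h := ae_mixture_univ (δ := δ K) (τ := τ K) (ξ2 := ξ2 K) (b := b K)
    (Finset.mem_Icc.mp hK).1 (fun k => (hpos K hK k).1) (fun k => (hpos K hK k).2.2)
  have h' := (ae_map_iff (measurable_sigmaMk K).aemeasurable measurableSet_mixture_univ).mpr h
  exact ae_iff.mp h'

theorem hyperPrior_mem_hyperSet (hT : 0 < T) {ξ0 b0 : ∀ K : ℕ, Fin K → ℝ}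
    (hξ0 : ∀ K ∈ Finset.Icc 1 T, ∀ k, 0 < ξ0 K k)
    (hb0 : ∀ K ∈ Finset.Icc 1 T, ∀ k, 0 < b0 K k) : hyperPrior d T ξ0 b0 ∈ hyperSet d T := by
  refine ⟨_, _, _, _, _, fun _ _ => by positivity, ?_,
    fun K hK k => ⟨one_pos, hξ0 K hK k, hb0 K hK k⟩, rfl⟩
  rw [Finset.sum_const, Nat.card_Icc, nsmul_eq_mul]
  simp [hT.ne']

theorem map_compHyper_mem_hyperSet (hK : K ∈ Finset.Icc 1 T) (τ : Fin K → Fin d → ℝ)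
    {ξ b : Fin K → ℝ} (hξ : ∀ k, 0 < ξ k) (hb : ∀ k, 0 < b k) :
    (compHyper (fun _ => 1) τ ξ b).map (Sigma.mk K) ∈ hyperSet d T := by
  classical
  -- Point mass at K. The parameters for other numbers of components carry no weight and only have
  -- to be admissible.
  refine ⟨fun j => if j = K then 1 else 0, fun _ _ => 1,
    Function.update (fun _ _ => 0) K τ, Function.update (fun _ _ => 1) K ξ,
    Function.update (fun _ _ => 1) K b, fun j _ => by dsimp only; split_ifs <;> norm_num, ?_, ?_, ?_⟩
  · rw [Finset.sum_ite_eq' _ K, if_pos hK]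
  · intro j _
    rcases eq_or_ne j K with rfl | hj
    · simpa using fun k => ⟨hξ k, hb k⟩
    · simp [Function.update_of_ne hj]
  · rw [hyper, Finset.sum_eq_single K]
    · simp
    · intro j _ hj
      simp [hj]
    · exact fun h => absurd hK h

theorem log_add_inv_sub_one_nonneg {x : ℝ} (hx : 0 < x) : 0 ≤ Real.log x + x⁻¹ - 1 := by
  have := Real.log_le_sub_one_of_pos (inv_pos.mpr hx)
  rw [Real.log_inv] at this
  linarith

theorem klIsoGaussian_nonneg (d : ℕ) {s s' D : ℝ} (hs : 0 < s) (hs' : 0 < s') (hD : 0 ≤ D) :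
    0 ≤ 1 / 2 * (d * (Real.log (s' / s) - 1 + s / s') + D / s') := by
  have h := log_add_inv_sub_one_nonneg (div_pos hs' hs)
  rw [inv_div] at h
  have h1 : 0 ≤ D / s' := div_nonneg hD hs'.le
  have h2 : 0 ≤ (d : ℝ) * (Real.log (s' / s) - 1 + s / s') :=
    mul_nonneg (by positivity) (by linarith)
  linarith

theorem klDiv_isoGaussian_le (μ μ' : Fin d → ℝ) {s s' : ℝ} (hs : 0 < s) (hs' : 0 < s') :
    klDiv (isoGaussian μ s) (isoGaussian μ' s')
      ≤ ENNReal.ofReal (1 / 2 * (d * (Real.log (s' / s) - 1 + s / s') + sqDist μ μ' / s')) := by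
  calc klDiv (isoGaussian μ s) (isoGaussian μ' s')
      ≤ ∑ i, ENNReal.ofReal (1 / 2 * (Real.log (s' / s) - 1 + (s + (μ i - μ' i) ^ 2) / s')) := by
        refine (klDiv_pi_le _ _).trans (Finset.sum_le_sum fun i _ => ?_)
        refine (klDiv_gaussianReal_le _ _ (Real.toNNReal_pos.mpr hs).ne'
          (Real.toNNReal_pos.mpr hs').ne').trans (le_of_eq ?_)
        rw [Real.coe_toNNReal _ hs.le, Real.coe_toNNReal _ hs'.le]
    _ = _ := by
        rw [← ENNReal.ofReal_sum_of_nonneg]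
        · congr 1
          rw [← Finset.mul_sum]
          congr 1
          simp only [add_div, Finset.sum_add_distrib, Finset.sum_const, Finset.card_univ,
            Fintype.card_fin, nsmul_eq_mul, sqDist, Finset.sum_div]
          ring
        · intro i _
          have h := klIsoGaussian_nonneg 1 hs hs' (sq_nonneg (μ i - μ' i))
          rw [Nat.cast_one, one_mul] at h
          rwa [add_div, ← add_assoc]

theorem sqDist_nonneg (x y : Fin d → ℝ) : 0 ≤ sqDist x y :=
  Finset.sum_nonneg fun _ _ => sq_nonneg _

theorem klDiv_compHyper_le {τ τ' : Fin K → Fin d → ℝ} {ξ ξ' b b' : Fin K → ℝ}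
    (hξ : ∀ k, 0 < ξ k) (hξ' : ∀ k, 0 < ξ' k) (hb : ∀ k, 0 < b k) (hb' : ∀ k, 0 < b' k) :
    klDiv (compHyper (fun _ => 1) τ ξ b) (compHyper (fun _ => 1) τ' ξ' b')
      ≤ ENNReal.ofReal (∑ k, (1 / 2 * (d * (Real.log (ξ' k / ξ k) - 1 + ξ k / ξ' k)
          + sqDist (τ k) (τ' k) / ξ' k) + 2 * (Real.log (b k / b' k) + b' k / b k - 1))) := by
  have := isProbabilityMeasure_dirichlet (K := K) (δ := fun _ => 1) (fun _ => one_pos)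
  have := fun k => isProbabilityMeasure_gammaMeasure two_pos (hb k)
  have := fun k => isProbabilityMeasure_gammaMeasure two_pos (hb' k)
  have hg := fun k => klIsoGaussian_nonneg d (hξ k) (hξ' k) (sqDist_nonneg (τ k) (τ' k))
  have hG : ∀ k, 0 ≤ 2 * (Real.log (b k / b' k) + b' k / b k - 1) := by
    intro k
    have h1 := log_add_inv_sub_one_nonneg (div_pos (hb k) (hb' k))
    rw [inv_div] at h1
    linarith
  rw [Finset.sum_add_distrib, ENNReal.ofReal_add (Finset.sum_nonneg fun k _ => hg k)
    (Finset.sum_nonneg fun k _ => hG k), ENNReal.ofReal_sum_of_nonneg fun k _ => hg k,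
    ENNReal.ofReal_sum_of_nonneg fun k _ => hG k]
  -- Both weight laws are Dir(1,…,1), so the weights cost nothing.
  refine klDiv_prod_le.trans ((add_le_add (klDiv_self _).le klDiv_prod_le).trans ?_)
  rw [zero_add]
  refine add_le_add ?_ ?_
  · exact (klDiv_pi_le _ _).trans
      (Finset.sum_le_sum fun k _ => klDiv_isoGaussian_le _ _ (hξ k) (hξ' k))
  · exact (klDiv_pi_le _ _).trans
      (Finset.sum_le_sum fun k _ => klDiv_gammaMeasure_two_le (hb k) (hb' k))

theorem klDiv_hyperPrior_le (hK : K ∈ Finset.Icc 1 T) {ξ0 b0 : ∀ K : ℕ, Fin K → ℝ}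
    (hξ0 : ∀ K ∈ Finset.Icc 1 T, ∀ k, 0 < ξ0 K k) (hb0 : ∀ K ∈ Finset.Icc 1 T, ∀ k, 0 < b0 K k)
    {τ : Fin K → Fin d → ℝ} {ξ b : Fin K → ℝ} (hξ : ∀ k, 0 < ξ k) (hb : ∀ k, 0 < b k) :
    klDiv ((compHyper (fun _ => 1) τ ξ b).map (Sigma.mk K)) (hyperPrior d T ξ0 b0)
      ≤ ENNReal.ofReal (∑ k, (1 / 2 * (d * (Real.log (ξ0 K k / ξ k) - 1 + ξ k / ξ0 K k)
          + sqDist (τ k) 0 / ξ0 K k) + 2 * (Real.log (b k / b0 K k) + b0 K k / b k - 1)))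
        + ENNReal.ofReal (Real.log T) := by
  have hT : 0 < T := (Finset.mem_Icc.mp hK).1.trans (Finset.mem_Icc.mp hK).2
  have hT' : (0 : ℝ) < T := by exact_mod_cast hT
  have hΛ := hyperPrior_mem_hyperSet (d := d) hT hξ0 hb0
  have := isProbabilityMeasure_of_mem_hyperSet hΛ
  have := isProbabilityMeasure_compHyper (δ := fun _ => 1) (τ := τ) (ξ2 := ξ) (fun _ => one_pos) hb
  have := isProbabilityMeasure_compHyper (δ := fun _ => 1) (τ := fun _ : Fin K => (0 : Fin d → ℝ))
    (ξ2 := ξ0 K) (fun _ => one_pos) (hb0 K hK)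
  have := Measure.isProbabilityMeasure_map (μ := compHyper (fun _ => 1) τ ξ b)
    (measurable_sigmaMk (E := fun K => CompParam d K) K).aemeasurable
  have := Measure.isProbabilityMeasure_map
    (μ := compHyper (fun _ => 1) (fun _ : Fin K => (0 : Fin d → ℝ)) (ξ0 K) (b0 K))
    (measurable_sigmaMk (E := fun K => CompParam d K) K).aemeasurable
  have hle : ENNReal.ofReal (1 / (T : ℝ)) •
      (compHyper (fun _ => 1) (fun _ : Fin K => (0 : Fin d → ℝ)) (ξ0 K) (b0 K)).map (Sigma.mk K)
      ≤ hyperPrior d T ξ0 b0 :=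
    Finset.single_le_sum (f := fun K => ENNReal.ofReal (1 / (T : ℝ)) •
      (compHyper (fun _ => 1) (fun _ : Fin K => (0 : Fin d → ℝ)) (ξ0 K) (b0 K)).map (Sigma.mk K))
      (fun _ _ => Measure.zero_le _) hK
  refine (klDiv_le_add_log (by positivity) hle).trans (add_le_add ?_ ?_)
  · exact (klDiv_map_le _ _ (measurable_sigmaMk K)).trans
      (klDiv_compHyper_le hξ (hξ0 K hK) hb (hb0 K hK))
  · rw [one_div, Real.log_inv, neg_neg]

end Hyper

end

section

/-! ### Expectations under the hyper-distributions -/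

section Expectations

variable {d K : ℕ}

theorem integral_sqDist_isoGaussian (μ θ : Fin d → ℝ) {v : ℝ} (hv : 0 ≤ v) :
    Integrable (fun x => sqDist x θ) (isoGaussian μ v) ∧
      ∫ x, sqDist x θ ∂(isoGaussian μ v) = d * v + sqDist μ θ := by
  have h : ∀ i, Integrable (fun x : Fin d → ℝ => (x i - θ i) ^ 2) (isoGaussian μ v) := fun i =>
    (measurePreserving_eval (fun i => gaussianReal (μ i) v.toNNReal) i).integrable_comp_of_integrable
      (integral_sq_sub_gaussianReal (μ i) (θ i) v.toNNReal).1
  have h' : ∀ i, ∫ x : Fin d → ℝ, (x i - θ i) ^ 2 ∂(isoGaussian μ v) = v + (μ i - θ i) ^ 2 := by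
    intro i
    rw [integral_comp_eval (μ := fun i => gaussianReal (μ i) v.toNNReal) (i := i)
      (f := fun x => (x - θ i) ^ 2) (by fun_prop),
      (integral_sq_sub_gaussianReal (μ i) (θ i) v.toNNReal).2, Real.coe_toNNReal _ hv]
  refine ⟨integrable_finsetSum _ fun i _ => h i, ?_⟩
  simp only [sqDist]
  rw [integral_finsetSum _ fun i _ => h i]
  simp only [h', Finset.sum_add_distrib, Finset.sum_const, Finset.card_univ, Fintype.card_fin,
    nsmul_eq_mul]

theorem sqDist_comm (x y : Fin d → ℝ) : sqDist x y = sqDist y x :=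
  Finset.sum_congr rfl fun _ _ => by ring

theorem lintegral_log_one_add_gammaMeasure_le {b κ : ℝ} (hb : 0 < b) (hκ : 0 ≤ κ) :
    ∫⁻ v, ENNReal.ofReal (Real.log (1 + κ * v)) ∂(gammaMeasure 2 b)
      ≤ ENNReal.ofReal (Real.log (1 + 2 * κ / b)) := by
  have := isProbabilityMeasure_gammaMeasure two_pos hb
  obtain ⟨i1, e1⟩ := integrable_id_gammaMeasure two_pos hb
  obtain ⟨u, hu⟩ : ∃ u, u = 1 + 2 * κ / b := ⟨_, rfl⟩
  have hu0 : 0 < u := by rw [hu]; positivity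
  -- Jensen by hand: the tangent of the logarithm at u, which is the mean of 1 + κv since Γ(2, b)
  -- has mean 2/b. The affine bound then integrates to log u.
  have hle : ∀ v : ℝ, 0 < v → Real.log (1 + κ * v) ≤ Real.log u - 1 + 1 / u + κ / u * v := by
    intro v hv
    have h1 : 0 < 1 + κ * v := by positivity
    have h2 := Real.log_le_sub_one_of_pos (div_pos h1 hu0)
    rw [Real.log_div h1.ne' hu0.ne'] at h2
    have : (1 + κ * v) / u = 1 / u + κ / u * v := by ring
    linarith
  have i2 : Integrable (fun v : ℝ => Real.log u - 1 + 1 / u + κ / u * v) (gammaMeasure 2 b) :=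
    (integrable_const _).add (i1.const_mul _)
  calc ∫⁻ v, ENNReal.ofReal (Real.log (1 + κ * v)) ∂(gammaMeasure 2 b)
      ≤ ∫⁻ v, ENNReal.ofReal (Real.log u - 1 + 1 / u + κ / u * v) ∂(gammaMeasure 2 b) :=
        lintegral_mono_ae ((ae_pos_gammaMeasure 2 b).mono fun v hv =>
          ENNReal.ofReal_le_ofReal (hle v hv))
    _ = ENNReal.ofReal (∫ v, (Real.log u - 1 + 1 / u + κ / u * v) ∂(gammaMeasure 2 b)) := by
        refine (ofReal_integral_eq_lintegral_ofReal i2 ?_).symm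
        filter_upwards [ae_pos_gammaMeasure 2 b] with v hv
        exact (Real.log_nonneg (by nlinarith [mul_nonneg hκ hv.le])).trans (hle v hv)
    _ = _ := by
        rw [integral_add (integrable_const _) (i1.const_mul _), integral_const_mul, e1,
          integral_const, probReal_univ, one_smul, ← hu]
        congr 1
        have : 1 / u + κ / u * (2 / b) = 1 := by
          rw [hu] at hu0 ⊢
          field_simp
        linarith

/-- Reduces to 3 log 2 ≥ 2. -/
theorem two_add_log_le {K : ℕ} (hK : 2 ≤ K) :
    Real.log K + 2 ≤ 2 * Real.log (2 * K) := by
  have h : Real.log 2 ≤ Real.log K := Real.log_le_log two_pos (by exact_mod_cast hK)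
  have := Real.log_two_gt_d9
  rw [Real.log_mul two_ne_zero (by positivity)]
  linarith

/-- In the Gamma representation, -log w_k = log ∑ g_j - log g_k. The first term is at most log K +
(∑ g_j)/K, whose mean is log K + 1, and the positive part of -log g_k has mean at most 1. The sum
log K + 2 fits under 2 log(2K) once K ≥ 2. -/
theorem lintegral_neg_log_dirichlet_le (k : Fin K) :
    ∫⁻ w, ENNReal.ofReal (-Real.log (w k)) ∂(dirichlet fun _ : Fin K => 1)
      ≤ ENNReal.ofReal (2 * Real.log (2 * K)) := by
  have := isProbabilityMeasure_gammaMeasure one_pos one_pos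
  have hK : 0 < K := k.pos
  have hK' : (0 : ℝ) < K := by exact_mod_cast hK
  have : Nonempty (Fin K) := ⟨k⟩
  rw [dirichlet, lintegral_map (by fun_prop) measurable_normalize]
  have hpos : ∀ᵐ g ∂(Measure.pi fun _ : Fin K => gammaMeasure 1 1), ∀ k, 0 < g k := by
    rw [ae_all_iff]
    intro k
    exact (measurePreserving_eval (fun _ => gammaMeasure 1 1) k).quasiMeasurePreserving.ae
      (ae_pos_gammaMeasure 1 1)
  rcases Nat.lt_or_ge 1 K with h2 | h2
  · calc ∫⁻ g : Fin K → ℝ, ENNReal.ofReal (-Real.log (g k / ∑ j, g j))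
          ∂(Measure.pi fun _ => gammaMeasure 1 1)
        ≤ ∫⁻ g : Fin K → ℝ, (ENNReal.ofReal (Real.log K)
            + ENNReal.ofReal (1 / K) * ∑ j, ENNReal.ofReal (g j)
            + ENNReal.ofReal (-Real.log (g k))) ∂(Measure.pi fun _ => gammaMeasure 1 1) := by
          refine lintegral_mono_ae ?_
          filter_upwards [hpos] with g hg
          have hs : 0 < ∑ j, g j := Finset.sum_pos (fun j _ => hg j) Finset.univ_nonempty
          rw [← ENNReal.ofReal_sum_of_nonneg fun j _ => (hg j).le,
            ← ENNReal.ofReal_mul (by positivity), ← ENNReal.ofReal_add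
            (Real.log_nonneg (by exact_mod_cast h2.le)) (by positivity)]
          refine le_trans (ENNReal.ofReal_le_ofReal ?_) ENNReal.ofReal_add_le
          have h3 := Real.log_le_sub_one_of_pos (div_pos hs hK')
          rw [Real.log_div hs.ne' hK'.ne'] at h3
          rw [Real.log_div (hg k).ne' hs.ne']
          have : 1 / K * ∑ j, g j = (∑ j, g j) / K := by ring
          linarith
      _ ≤ ENNReal.ofReal (Real.log K) + 1 + 1 := by
          rw [lintegral_add_right _ (by fun_prop), lintegral_add_left measurable_const,
            lintegral_const, measure_univ, mul_one, lintegral_const_mul _ (by fun_prop),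
            lintegral_finsetSum _ (fun j _ => by fun_prop)]
          have e1 : ∀ j : Fin K, ∫⁻ g : Fin K → ℝ, ENNReal.ofReal (g j)
              ∂(Measure.pi fun _ => gammaMeasure 1 1) = 1 := fun j => by
            rw [(measurePreserving_eval (fun _ : Fin K => gammaMeasure 1 1) j).lintegral_comp
              (f := fun x => ENNReal.ofReal x) (by fun_prop),
              lintegral_id_gammaMeasure one_pos one_pos]
            simp
          simp only [e1, Finset.sum_const, Finset.card_univ, Fintype.card_fin, nsmul_eq_mul,
            mul_one]
          gcongr
          · rw [← ENNReal.ofReal_natCast, ← ENNReal.ofReal_mul (by positivity),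
              ENNReal.ofReal_le_one, one_div_mul_cancel hK'.ne']
          · rw [(measurePreserving_eval (fun _ : Fin K => gammaMeasure 1 1) k).lintegral_comp
              (f := fun x => ENNReal.ofReal (-Real.log x)) (by fun_prop)]
            exact lintegral_neg_log_exp_le
      _ ≤ _ := by
          have hl : 0 ≤ Real.log K := Real.log_nonneg (by exact_mod_cast h2.le)
          rw [← ENNReal.ofReal_one, ← ENNReal.ofReal_add hl zero_le_one,
            ← ENNReal.ofReal_add (by positivity) zero_le_one]
          refine ENNReal.ofReal_le_ofReal ?_
          have := two_add_log_le h2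
          linarith
  -- A single weight equals 1 almost surely, so the left side is zero.
  · obtain rfl : K = 1 := by omega
    calc _ ≤ ∫⁻ g : Fin 1 → ℝ, 0 ∂(Measure.pi fun _ => gammaMeasure 1 1) := by
          refine lintegral_mono_ae ?_
          filter_upwards [hpos] with g hg
          rw [Fin.sum_univ_one, Subsingleton.elim k 0, div_self (hg 0).ne']
          simp
      _ ≤ _ := by simp

variable {τ : Fin K → Fin d → ℝ} {ξ b : Fin K → ℝ}

/-- Means and variances are independent under the hyper-distribution, so the integral is a product:
the Gaussian second moment d ξ_k + ‖τ_k - θ‖² times the mean inverse variance, at most b_k. -/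
theorem lintegral_sqDist_mul_inv_compHyper_le {δ : Fin K → ℝ} (hδ : ∀ k, 0 < δ k)
    (hξ : ∀ k, 0 < ξ k) (hb : ∀ k, 0 < b k) (θ : Fin d → ℝ) (k : Fin K) :
    ∫⁻ p, ENNReal.ofReal (sqDist (p.2.1 k) θ) * ENNReal.ofReal (p.2.2 k)⁻¹ ∂(compHyper δ τ ξ b)
      ≤ ENNReal.ofReal ((d * ξ k + sqDist (τ k) θ) * b k) := by
  have := isProbabilityMeasure_dirichlet hδ
  have := fun k => isProbabilityMeasure_gammaMeasure two_pos (hb k)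
  have hm : Measurable fun μ : Fin K → Fin d → ℝ => sqDist (μ k) θ := by
    unfold sqDist
    fun_prop
  have hm1 : Measurable fun x : Fin d → ℝ => ENNReal.ofReal (sqDist x θ) := by
    unfold sqDist
    fun_prop
  rw [compHyper, measurePreserving_snd.lintegral_comp
    (f := fun q : (Fin K → Fin d → ℝ) × (Fin K → ℝ) =>
      ENNReal.ofReal (sqDist (q.1 k) θ) * ENNReal.ofReal (q.2 k)⁻¹)
    ((hm.comp measurable_fst).ennreal_ofReal.mul (by fun_prop)),
    lintegral_prod_mul (f := fun μ : Fin K → Fin d → ℝ => ENNReal.ofReal (sqDist (μ k) θ))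
      (g := fun v : Fin K → ℝ => ENNReal.ofReal (v k)⁻¹) hm.ennreal_ofReal.aemeasurable
      (Measurable.aemeasurable (by fun_prop))]
  rw [ENNReal.ofReal_mul (add_nonneg (mul_nonneg (by positivity) (hξ k).le) (sqDist_nonneg _ _))]
  refine mul_le_mul' (le_of_eq ?_) ?_
  · rw [(measurePreserving_eval (fun k => Measure.pi fun i =>
      gaussianReal (τ k i) (ξ k).toNNReal) k).lintegral_comp hm1]
    obtain ⟨h1, h2⟩ := integral_sqDist_isoGaussian (τ k) θ (hξ k).le
    rw [← h2, ofReal_integral_eq_lintegral_ofReal h1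
      (Filter.Eventually.of_forall fun x => sqDist_nonneg _ _)]
  · rw [(measurePreserving_eval (fun k => gammaMeasure 2 (b k)) k).lintegral_comp
      (f := fun x => ENNReal.ofReal x⁻¹) (by fun_prop)]
    exact lintegral_inv_gammaMeasure_two_le (hb k)

theorem lintegral_neg_log_compHyper_le (hb : ∀ k, 0 < b k) (k : Fin K) :
    ∫⁻ p, ENNReal.ofReal (-Real.log (p.1 k)) ∂(compHyper (fun _ => 1) τ ξ b)
      ≤ ENNReal.ofReal (2 * Real.log (2 * K)) := by
  have := isProbabilityMeasure_dirichlet (K := K) (δ := fun _ => 1) (fun _ => one_pos)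
  have := fun k => isProbabilityMeasure_gammaMeasure two_pos (hb k)
  rw [compHyper, measurePreserving_fst.lintegral_comp
    (f := fun w : Fin K → ℝ => ENNReal.ofReal (-Real.log (w k))) (by fun_prop)]
  exact lintegral_neg_log_dirichlet_le k

theorem lintegral_log_one_add_compHyper_le {δ : Fin K → ℝ} (hδ : ∀ k, 0 < δ k)
    (hb : ∀ k, 0 < b k) {κ : ℝ} (hκ : 0 ≤ κ) (k : Fin K) :
    ∫⁻ p, ENNReal.ofReal (Real.log (1 + κ * p.2.2 k)) ∂(compHyper δ τ ξ b)
      ≤ ENNReal.ofReal (Real.log (1 + 2 * κ / b k)) := by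
  have := isProbabilityMeasure_dirichlet hδ
  have := fun k => isProbabilityMeasure_gammaMeasure two_pos (hb k)
  rw [compHyper, measurePreserving_snd.lintegral_comp
    (f := fun q : (Fin K → Fin d → ℝ) × (Fin K → ℝ) =>
      ENNReal.ofReal (Real.log (1 + κ * q.2 k))) (by fun_prop),
    measurePreserving_snd.lintegral_comp
      (f := fun v : Fin K → ℝ => ENNReal.ofReal (Real.log (1 + κ * v k))) (by fun_prop),
    (measurePreserving_eval (fun k => gammaMeasure 2 (b k)) k).lintegral_comp
      (f := fun x => ENNReal.ofReal (Real.log (1 + κ * x))) (by fun_prop)]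
  exact lintegral_log_one_add_gammaMeasure_le (hb k) hκ

end Expectations

/-! ### Free energy of mixture priors, localized near the best parameter -/

namespace IsBoundedLoss

variable {Z : Type*} [MeasurableSpace Z] {d n K : ℕ} {ℓ : Z → (Fin d → ℝ) → ℝ} {C : ℝ}
  (hℓ : IsBoundedLoss ℓ C)
include hℓ

/-- Localization of the posterior around the best parameter, for a mixture prior. -/
theorem integral_freeEnergy_mixture_le {a L : ℝ} (ha : 0 < a) (hL : 0 < L) (hn : 0 < n)
    {P : ProbabilityMeasure Z} {θ₀ : Fin d → ℝ}
    (hQ : ∀ θ, risk ℓ P θ - risk ℓ P θ₀ ≤ L * sqDist θ θ₀) (p : CompParam d K)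
    (hp : mixture ⟨K, p⟩ Set.univ = 1) (k : Fin K) (hw : 0 < p.1 k) (hv : 0 < p.2.2 k) :
    ∫ S : Fin n → Z, freeEnergy ℓ a S (mixture ⟨K, p⟩) ∂(sampleLaw n P)
      ≤ risk ℓ P θ₀ + 1 / a * (-Real.log (p.1 k) + d / 2 * Real.log (1 + 2 * a * L * p.2.2 k)
        + sqDist (p.2.1 k) θ₀ * (p.2.2 k)⁻¹ / 2) := by
  have : IsProbabilityMeasure (mixture ⟨K, p⟩) := ⟨hp⟩
  obtain ⟨w, μ, v⟩ := p
  dsimp only at hw hv ⊢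
  obtain ⟨π, hπ⟩ : ∃ π, π = mixture ⟨K, w, μ, v⟩ := ⟨_, rfl⟩
  rw [← hπ] at this ⊢
  -- Variance of the trial posterior N(θ₀, s I). It minimizes L d s + (d/(2a))(log(v_k/s) + s/v_k),
  -- the sum of the quadratic risk and the variance part of the divergence.
  obtain ⟨s, hs⟩ : ∃ s, s = 1 / (2 * a * L + 1 / v k) := ⟨_, rfl⟩
  have hs0 : 0 < s := by rw [hs]; positivity
  have hs1 : 2 * a * L * s + s / v k = 1 := by
    rw [hs]
    field_simp
  have hvs : v k / s = 1 + 2 * a * L * v k := by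
    rw [hs]
    field_simp
    ring
  have hle : ENNReal.ofReal (w k) • isoGaussian (μ k) (v k) ≤ π := by
    rw [hπ]
    exact Finset.single_le_sum (f := fun k => ENNReal.ofReal (w k) • isoGaussian (μ k) (v k))
      (fun _ _ => Measure.zero_le _) (Finset.mem_univ k)
  have hw1 : w k ≤ 1 := by
    rw [mixture_univ] at hp
    rw [← ENNReal.ofReal_le_one, ← hp]
    exact Finset.single_le_sum (f := fun k => ENNReal.ofReal (w k)) (fun _ _ => zero_le)
      (Finset.mem_univ k)
  have hA := klIsoGaussian_nonneg d hs0 hv (sqDist_nonneg θ₀ (μ k))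
  have hlog : 0 ≤ -Real.log (w k) := neg_nonneg.mpr (Real.log_nonpos hw.le hw1)
  have hkl : klDiv (isoGaussian θ₀ s) π ≤ ENNReal.ofReal (1 / 2 * (d * (Real.log (v k / s) - 1
      + s / v k) + sqDist θ₀ (μ k) / v k) + -Real.log (w k)) := by
    rw [ENNReal.ofReal_add hA hlog]
    exact (klDiv_le_add_log hw hle).trans (add_le_add_left (klDiv_isoGaussian_le _ _ hs0 hv) _)
  have hkl' := ENNReal.toReal_le_of_le_ofReal (add_nonneg hA hlog) hkl
  obtain ⟨i1, e1⟩ := integral_sqDist_isoGaussian θ₀ θ₀ hs0.le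
  have hr : ∫ θ, risk ℓ P θ ∂(isoGaussian θ₀ s) ≤ risk ℓ P θ₀ + L * (d * s) := by
    have h1 : Integrable (fun θ => risk ℓ P θ) (isoGaussian θ₀ s) :=
      integrable_of_mem_Icc (hℓ.measurable_risk_right P) (hℓ.risk_nonneg P) (hℓ.risk_le P)
    calc ∫ θ, risk ℓ P θ ∂(isoGaussian θ₀ s)
        ≤ ∫ θ, (risk ℓ P θ₀ + L * sqDist θ θ₀) ∂(isoGaussian θ₀ s) :=
          integral_mono h1 ((integrable_const _).add (i1.const_mul L)) fun θ => by
            have := hQ θ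
            dsimp only
            linarith
      _ = _ := by
          rw [integral_add (integrable_const _) (i1.const_mul L), integral_const_mul, e1]
          simp [sqDist]
  have hE : Measurable fun q : (Fin n → Z) × (Fin d → ℝ) => empRisk ℓ q.1 q.2 :=
    hℓ.measurable_empRisk
  have hswap : ∫ S : Fin n → Z, ∫ θ, empRisk ℓ S θ ∂(isoGaussian θ₀ s) ∂(sampleLaw n P)
      = ∫ θ, risk ℓ P θ ∂(isoGaussian θ₀ s) := by
    rw [integral_integral_swap (f := fun (S : Fin n → Z) θ => empRisk ℓ S θ)
      (integrable_of_mem_Icc hE (fun q => hℓ.empRisk_nonneg q.1 q.2)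
        (fun q => hℓ.empRisk_le hn q.1 q.2))]
    simp only [hℓ.integral_empRisk hn P]
  have hm : Measurable fun S : Fin n → Z => ∫ θ, empRisk ℓ S θ ∂(isoGaussian θ₀ s) :=
    measurable_integral_kernel (Kernel.const _ (isoGaussian θ₀ s))
      (f := fun (S : Fin n → Z) θ => empRisk ℓ S θ) hE
  have hI : ∀ S : Fin n → Z, 0 ≤ ∫ θ, empRisk ℓ S θ ∂(isoGaussian θ₀ s)
      ∧ ∫ θ, empRisk ℓ S θ ∂(isoGaussian θ₀ s) ≤ C := fun S =>
    integral_mem_Icc (hℓ.measurable_empRisk_right S) (hℓ.empRisk_nonneg S) (hℓ.empRisk_le hn S)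
  have hi : Integrable (fun S : Fin n → Z => ∫ θ, empRisk ℓ S θ ∂(isoGaussian θ₀ s))
      (sampleLaw n P) := integrable_of_mem_Icc hm (fun S => (hI S).1) (fun S => (hI S).2)
  have hF : Integrable (fun S : Fin n → Z => freeEnergy ℓ a S π) (sampleLaw n P) := by
    have hm : Measurable fun S : Fin n → Z => freeEnergy ℓ a S π :=
      (hℓ.measurable_freeEnergy (Kernel.const Unit π)).comp
        (f := fun S : Fin n → Z => ((), S)) (by fun_prop)
    exact integrable_of_mem_Icc hm (fun S => (hℓ.freeEnergy_mem_Icc ha hn S π).1)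
      (fun S => (hℓ.freeEnergy_mem_Icc ha hn S π).2)
  calc ∫ S : Fin n → Z, freeEnergy ℓ a S π ∂(sampleLaw n P)
      ≤ ∫ S : Fin n → Z, (∫ θ, empRisk ℓ S θ ∂(isoGaussian θ₀ s)
          + (klDiv (isoGaussian θ₀ s) π).toReal / a) ∂(sampleLaw n P) :=
        integral_mono hF (hi.add (integrable_const _)) fun S =>
          hℓ.freeEnergy_le ha hn S π _ (hkl.trans_lt ENNReal.ofReal_lt_top).ne
    _ = ∫ θ, risk ℓ P θ ∂(isoGaussian θ₀ s) + (klDiv (isoGaussian θ₀ s) π).toReal / a := by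
        rw [integral_add hi (integrable_const _), hswap]
        simp
    _ ≤ risk ℓ P θ₀ + L * (d * s) + (1 / 2 * (d * (Real.log (v k / s) - 1
          + s / v k) + sqDist θ₀ (μ k) / v k) + -Real.log (w k)) / a := by gcongr
    _ = _ := by
        have h2 : s / v k = 1 - 2 * a * L * s := by linarith
        rw [hvs, h2, sqDist_comm θ₀]
        field_simp
        ring

theorem lintegral_integral_freeEnergy_le {a L : ℝ} (ha : 0 < a) (hL : 0 < L) (hn : 0 < n)
    {P : ProbabilityMeasure Z} {θ₀ : Fin d → ℝ}
    (hQ : ∀ θ, risk ℓ P θ - risk ℓ P θ₀ ≤ L * sqDist θ θ₀) {τ : Fin K → Fin d → ℝ}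
    {ξ : Fin K → ℝ} {b : ℝ} (hξ : ∀ k, 0 < ξ k) (hb : 0 < b) (k : Fin K) :
    ∫⁻ p, ENNReal.ofReal (∫ S : Fin n → Z, freeEnergy ℓ a S (priorKernel d ⟨K, p⟩)
        ∂(sampleLaw n P)) ∂(compHyper (fun _ => 1) τ ξ fun _ => b)
      ≤ ENNReal.ofReal (risk ℓ P θ₀) + ENNReal.ofReal (1 / a * (2 * Real.log (2 * K)
          + d / 2 * Real.log (1 + 4 * a * L / b) + b / 2 * (d * ξ k)))
        + ENNReal.ofReal (b / (2 * a)) * ENNReal.ofReal (sqDist θ₀ (τ k)) := by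
  have hK : 0 < K := k.pos
  have hδ : ∀ k : Fin K, (0 : ℝ) < (fun _ => 1) k := fun _ => one_pos
  have hb' : ∀ k : Fin K, 0 < (fun _ => b) k := fun _ => hb
  have := isProbabilityMeasure_compHyper (τ := τ) (ξ2 := ξ) hδ hb'
  obtain ⟨ν, hν⟩ : ∃ ν, ν = compHyper (fun _ => 1) τ ξ fun _ => b := ⟨_, rfl⟩
  have hae := ae_compHyper (τ := τ) (ξ2 := ξ) hK hδ hb'
  have hae' := ae_mixture_univ (τ := τ) (ξ2 := ξ) hK hδ hb'
  have b1 := lintegral_neg_log_compHyper_le (τ := τ) (ξ := ξ) hb' k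
  have b2 := lintegral_log_one_add_compHyper_le (τ := τ) (ξ := ξ) hδ hb'
    (κ := 2 * a * L) (by positivity) k
  have b3 := lintegral_sqDist_mul_inv_compHyper_le (τ := τ) hδ hξ hb' θ₀ k
  rw [← hν] at this hae hae' b1 b2 b3 ⊢
  have hmD : Measurable fun p : CompParam d K =>
      ENNReal.ofReal (sqDist (p.2.1 k) θ₀) * ENNReal.ofReal (p.2.2 k)⁻¹ := by
    unfold sqDist
    fun_prop
  have hlogK : 0 ≤ Real.log (2 * K) := by
    have : (1 : ℝ) ≤ K := by exact_mod_cast hK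
    exact Real.log_nonneg (by linarith)
  have hlog : 0 ≤ Real.log (1 + 4 * a * L / b) :=
    Real.log_nonneg (le_add_of_nonneg_right (by positivity))
  have hD := sqDist_nonneg (τ k) θ₀
  have hξk := hξ k
  calc ∫⁻ p, ENNReal.ofReal (∫ S : Fin n → Z, freeEnergy ℓ a S (priorKernel d ⟨K, p⟩)
        ∂(sampleLaw n P)) ∂ν
      ≤ ∫⁻ p, (ENNReal.ofReal (risk ℓ P θ₀) + (ENNReal.ofReal (1 / a)
          * ENNReal.ofReal (-Real.log (p.1 k)) + (ENNReal.ofReal (d / (2 * a))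
          * ENNReal.ofReal (Real.log (1 + 2 * a * L * p.2.2 k)) + ENNReal.ofReal (1 / (2 * a))
          * (ENNReal.ofReal (sqDist (p.2.1 k) θ₀) * ENNReal.ofReal (p.2.2 k)⁻¹)))) ∂ν := by
        refine lintegral_mono_ae ?_
        filter_upwards [hae, hae'] with p hp hp'
        rw [priorKernel_apply hp', ← ENNReal.ofReal_mul (sqDist_nonneg _ _),
          ← ENNReal.ofReal_mul (by positivity), ← ENNReal.ofReal_mul (by positivity),
          ← ENNReal.ofReal_mul (by positivity)]
        have h := hℓ.integral_freeEnergy_mixture_le ha hL hn hQ p hp' k (hp.1.1 k) (hp.2 k)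
        refine (ENNReal.ofReal_le_ofReal h).trans ?_
        refine ENNReal.ofReal_add_le.trans (add_le_add le_rfl ?_)
        rw [show 1 / a * (-Real.log (p.1 k) + d / 2 * Real.log (1 + 2 * a * L * p.2.2 k)
            + sqDist (p.2.1 k) θ₀ * (p.2.2 k)⁻¹ / 2) = 1 / a * -Real.log (p.1 k)
            + (d / (2 * a) * Real.log (1 + 2 * a * L * p.2.2 k)
              + 1 / (2 * a) * (sqDist (p.2.1 k) θ₀ * (p.2.2 k)⁻¹)) by field_simp; ring]
        exact ENNReal.ofReal_add_le.trans (add_le_add le_rfl ENNReal.ofReal_add_le)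
    _ ≤ ENNReal.ofReal (risk ℓ P θ₀) + (ENNReal.ofReal (1 / a)
          * ENNReal.ofReal (2 * Real.log (2 * K)) + (ENNReal.ofReal (d / (2 * a))
          * ENNReal.ofReal (Real.log (1 + 2 * (2 * a * L) / b)) + ENNReal.ofReal (1 / (2 * a))
          * ENNReal.ofReal ((d * ξ k + sqDist (τ k) θ₀) * b))) := by
        rw [lintegral_add_left measurable_const, lintegral_const, measure_univ, mul_one,
          lintegral_add_left (by fun_prop), lintegral_add_left (by fun_prop),
          lintegral_const_mul _ (by fun_prop), lintegral_const_mul _ (by fun_prop),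
          lintegral_const_mul _ hmD]
        gcongr
    _ = _ := by
        rw [add_assoc (ENNReal.ofReal (risk ℓ P θ₀))]
        congr 1
        rw [← ENNReal.ofReal_mul (by positivity), ← ENNReal.ofReal_mul (by positivity),
          ← ENNReal.ofReal_mul (by positivity), ← ENNReal.ofReal_mul (by positivity), sqDist_comm θ₀,
          show 2 * (2 * a * L) / b = 4 * a * L / b by ring,
          ← ENNReal.ofReal_add (by positivity) (by positivity),
          ← ENNReal.ofReal_add (by positivity) (by positivity),
          ← ENNReal.ofReal_add (by positivity) (by positivity)]
        congr 1
        field_simp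
        ring

/-- Mean free energy of the mixture priors drawn around given centres. -/
theorem lintegral_meanFreeEnergy_le {a L : ℝ} (ha : 0 < a) (hL : 0 < L) (hn : 0 < n)
    (𝓓 : Measure (ProbabilityMeasure Z)) [IsProbabilityMeasure 𝓓]
    {θstar : ProbabilityMeasure Z → Fin d → ℝ} (hθ : Measurable θstar)
    (hQ : ∀ᵐ P ∂𝓓, ∀ θ, risk ℓ P θ - risk ℓ P (θstar P) ≤ L * sqDist θ (θstar P)) (hK : 0 < K)
    {τ : Fin K → Fin d → ℝ} {ξ : Fin K → ℝ} {b : ℝ} (hξ : ∀ k, 0 < ξ k) (hb : 0 < b) :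
    ∫⁻ m, ENNReal.ofReal (meanFreeEnergy n ℓ a 𝓓 (priorKernel d m))
        ∂((compHyper (fun _ => 1) τ ξ fun _ => b).map (Sigma.mk K))
      ≤ ENNReal.ofReal (∫ P, risk ℓ P (θstar P) ∂𝓓) + ENNReal.ofReal (1 / a *
          (2 * Real.log (2 * K) + d / 2 * Real.log (1 + 4 * a * L / b) + b / 2 * (d * ∑ k, ξ k)))
        + ENNReal.ofReal (b / (2 * a)) * quantError 𝓓 θstar τ := by
  have := isProbabilityMeasure_compHyper (τ := τ) (ξ2 := ξ) (δ := fun _ => 1) (b := fun _ => b)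
    (fun _ => one_pos) (fun _ => hb)
  have : Nonempty (Fin K) := ⟨⟨0, hK⟩⟩
  obtain ⟨F, hF⟩ : ∃ F : MixParam d → ProbabilityMeasure Z → ℝ, F = fun m P =>
    ∫ S : Fin n → Z, freeEnergy ℓ a S (priorKernel d m) ∂(sampleLaw n P) := ⟨_, rfl⟩
  have hFm : Measurable fun q : MixParam d × ProbabilityMeasure Z => F q.1 q.2 := by
    rw [hF]
    exact hℓ.measurable_integral_sample_freeEnergy (priorKernel d) n a
  have hF01 : ∀ m P, 0 ≤ F m P ∧ F m P ≤ C := by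
    intro m P
    rw [hF]
    exact hℓ.integral_sample_freeEnergy_mem_Icc ha hn (priorKernel d m) P
  have h1 : ∀ m, ENNReal.ofReal (meanFreeEnergy n ℓ a 𝓓 (priorKernel d m))
      = ∫⁻ P, ENNReal.ofReal (F m P) ∂𝓓 := by
    intro m
    have : meanFreeEnergy n ℓ a 𝓓 (priorKernel d m) = ∫ P, F m P ∂𝓓 := by rw [hF]; rfl
    rw [this, ofReal_integral_eq_lintegral_ofReal _ (Filter.Eventually.of_forall fun P => (hF01 m P).1)]
    exact integrable_of_mem_Icc (hFm.comp measurable_prodMk_left) (fun P => (hF01 m P).1)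
      (fun P => (hF01 m P).2)
  have hm : Measurable fun q : CompParam d K × ProbabilityMeasure Z => F ⟨K, q.1⟩ q.2 := by
    have : Measurable fun q : CompParam d K × ProbabilityMeasure Z =>
      ((⟨K, q.1⟩ : MixParam d), q.2) :=
      ((measurable_sigmaMk K).comp measurable_fst).prodMk measurable_snd
    exact hFm.comp this
  simp only [h1]
  rw [lintegral_map (Measurable.lintegral_prod_right hFm.ennreal_ofReal) (measurable_sigmaMk K),
    lintegral_lintegral_swap hm.ennreal_ofReal.aemeasurable]
  have hr : Measurable fun P => risk ℓ P (θstar P) := hℓ.measurable_risk_comp hθ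
  have hq : Measurable fun P => ⨅ k, ENNReal.ofReal (sqDist (θstar P) (τ k)) := by
    refine Measurable.iInf fun k => ?_
    unfold sqDist
    fun_prop
  have hr' : ∀ c : ℝ≥0∞, Measurable fun P => ENNReal.ofReal (risk ℓ P (θstar P)) + c := fun c =>
    hr.ennreal_ofReal.add measurable_const
  calc ∫⁻ P, ∫⁻ p, ENNReal.ofReal (F ⟨K, p⟩ P) ∂(compHyper (fun _ => 1) τ ξ fun _ => b) ∂𝓓
      ≤ ∫⁻ P, (ENNReal.ofReal (risk ℓ P (θstar P)) + ENNReal.ofReal (1 / a *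
          (2 * Real.log (2 * K) + d / 2 * Real.log (1 + 4 * a * L / b) + b / 2 * (d * ∑ k, ξ k)))
          + ENNReal.ofReal (b / (2 * a)) * ⨅ k, ENNReal.ofReal (sqDist (θstar P) (τ k))) ∂𝓓 := by
        refine lintegral_mono_ae ?_
        filter_upwards [hQ] with P hP
        -- The nearest centre may depend on the task, because the hyper-distribution integrated
        -- against does not depend on k.
        obtain ⟨k, hk⟩ := exists_eq_ciInf_of_finite
          (f := fun k => ENNReal.ofReal (sqDist (θstar P) (τ k)))
        rw [← hk, hF]
        refine (hℓ.lintegral_integral_freeEnergy_le ha hL hn hP hξ hb k).trans ?_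
        gcongr
        -- Replacing ξ_k by the sum removes the dependence on the chosen k, so the bound can be
        -- integrated over tasks.
        exact Finset.single_le_sum (fun j _ => (hξ j).le) (Finset.mem_univ k)
    _ = _ := by
        rw [lintegral_add_left (hr' _),
          lintegral_add_left hr.ennreal_ofReal, lintegral_const, measure_univ, mul_one,
          lintegral_const_mul _ hq, quantError, ofReal_integral_eq_lintegral_ofReal
          (integrable_of_mem_Icc hr (fun P => hℓ.risk_nonneg P _) (fun P => hℓ.risk_le P _))
          (Filter.Eventually.of_forall fun P => hℓ.risk_nonneg P _)]

end IsBoundedLoss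

end

section

/-! ### The terms of the bound -/

/-- The spread ξ_k of the means enters the divergence through ξ_k/ξ0_k - 1 and the free energy
through (bT/n) ξ_k. With ξ_k = ξ0_k/(1 + (T²/n) ξ0_k) and b ≤ T these contributions sum to at most
0, and only the logarithm of ξ0_k/ξ_k remains. The rate terms use 1 ≤ b ≤ T. -/
theorem le_cvMetaUnknown {d n T K : ℕ} {α b : ℝ} (hα : 0 < α) (hn : 0 < n) (hK : 0 < K)
    (hb : 1 ≤ b) (hbT : b ≤ T) {ξ0 b0 : Fin K → ℝ} (hξ0 : ∀ k, 0 < ξ0 k) (hb0 : ∀ k, 0 < b0 k)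
    (τ : Fin K → Fin d → ℝ) {ξ : Fin K → ℝ} (hξ : ∀ k, ξ k = ξ0 k / (1 + T ^ 2 / n * ξ0 k)) :
    2 * (∑ k, (1 / 2 * (d * (Real.log (ξ0 k / ξ k) - 1 + ξ k / ξ0 k) + sqDist (τ k) 0 / ξ0 k)
        + 2 * (Real.log (b / b0 k) + b0 k / b - 1)) + Real.log T) / (α * T)
        + b / (α * n) * (d * ∑ k, ξ k)
      ≤ cvMetaUnknown α α T n d K b0 ξ0 τ := by
  have hT : (0 : ℝ) < T := by linarith
  have hn' : (0 : ℝ) < n := by exact_mod_cast hn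
  have hlogK : 0 ≤ 2 * K * Real.log (2 * K) / (α * T) := by
    have h1 : (1 : ℝ) ≤ K := by exact_mod_cast hK
    have := Real.log_nonneg (show (1 : ℝ) ≤ 2 * K by linarith)
    positivity
  have key : ∀ k, (d * (Real.log (ξ0 k / ξ k) - 1 + ξ k / ξ0 k) + sqDist (τ k) 0 / ξ0 k)
        + 4 * (Real.log (b / b0 k) + b0 k / b - 1) + b * T / n * (d * ξ k)
      ≤ sqDist (τ k) 0 / ξ0 k + d * Real.log (1 + 4 * ξ0 k * α * (T : ℝ) ^ 2 / (α * n))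
        + 4 * (Real.log (T / b0 k) + b0 k - 1) := by
    intro k
    have hx := hξ0 k
    have hy := hb0 k
    have hB : 0 < 1 + T ^ 2 / n * ξ0 k := by positivity
    have hξk : 0 < ξ k := by rw [hξ k]; positivity
    have h1 : ξ0 k / ξ k = 1 + T ^ 2 / n * ξ0 k := by rw [hξ k]; field_simp
    have h2 : ξ k / ξ0 k + T ^ 2 / n * ξ k = 1 := by rw [hξ k]; field_simp
    have h3 : Real.log (1 + T ^ 2 / n * ξ0 k)
        ≤ Real.log (1 + 4 * ξ0 k * α * (T : ℝ) ^ 2 / (α * n)) := by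
      refine Real.log_le_log hB ?_
      have : 4 * ξ0 k * α * (T : ℝ) ^ 2 / (α * n) = 4 * (T ^ 2 / n * ξ0 k) := by field_simp
      rw [this]
      have : 0 < T ^ 2 / n * ξ0 k := by positivity
      linarith
    have h4 : Real.log (b / b0 k) ≤ Real.log (T / b0 k) :=
      Real.log_le_log (by positivity) (by gcongr)
    have h5 : b0 k / b ≤ b0 k := div_le_self hy.le hb
    have h6 : b * T / n * ξ k ≤ T ^ 2 / n * ξ k := by
      rw [pow_two]
      gcongr
    rw [h1]
    have h7 : (d : ℝ) * (Real.log (1 + T ^ 2 / n * ξ0 k) - 1 + ξ k / ξ0 k + b * T / n * ξ k)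
        ≤ d * Real.log (1 + 4 * ξ0 k * α * (T : ℝ) ^ 2 / (α * n)) :=
      mul_le_mul_of_nonneg_left (by linarith) (by positivity)
    linarith
  have hsum := Finset.sum_le_sum fun k (_ : k ∈ Finset.univ) => key k
  simp only [Finset.sum_add_distrib, ← Finset.mul_sum] at hsum
  obtain ⟨c, hc⟩ : ∃ c, c = 1 / (α * T) := ⟨_, rfl⟩
  have hc0 : 0 ≤ c := by rw [hc]; positivity
  have hdiv : ∀ x : ℝ, x / (α * T) = c * x := fun x => by rw [hc]; ring
  have e1 : b / (α * n) * (d * ∑ k, ξ k) = c * (b * T / n * (d * ∑ k, ξ k)) := by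
    rw [hc]
    field_simp
  rw [hdiv] at hlogK
  simp only [cvMetaUnknown, cvMeta, Finset.sum_add_distrib, ← Finset.mul_sum, e1, hdiv]
  linarith [mul_le_mul_of_nonneg_left hsum hc0]

theorem exists_cvMeta_le {α β : ℝ} (hα : 0 < α) (hβ : 0 < β) {m : ℝ} (M : ℝ) (hm : 0 < m) :
    ∃ A : ℝ, ∀ T n d K : ℕ, 2 ≤ T → 1 ≤ n → 1 ≤ d → 1 ≤ K → K ≤ T →
      ∀ (b ξ : Fin K → ℝ) (t : Fin K → Fin d → ℝ),
        (∀ k, m ≤ b k ∧ b k ≤ M ∧ m ≤ ξ k ∧ ξ k ≤ M ∧ sqDist (t k) 0 ≤ M) →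
        cvMeta α β T n d K b ξ t ≤ A * (d * K * Real.log T / T) := by
  -- One summand for each of the four terms of `cvMeta`. Terms without a logarithm of T are compared
  -- with 2 log T ≥ 1, valid for T ≥ 2.
  refine ⟨(4 + 2 * (M / m) + (2 * Real.log (1 + 4 * M * β / α) + 2)
    + 4 * (1 + 2 * |Real.log m| + 2 * M)) / β, ?_⟩
  intro T n d K hT hn hd hK hKT b ξ t h
  have hM : 0 < M := hm.trans_le ((h ⟨0, hK⟩).1.trans (h ⟨0, hK⟩).2.1)
  have hT' : (2 : ℝ) ≤ T := by exact_mod_cast hT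
  have hn' : (1 : ℝ) ≤ n := by exact_mod_cast hn
  have hd' : (1 : ℝ) ≤ d := by exact_mod_cast hd
  have hK' : (1 : ℝ) ≤ K := by exact_mod_cast hK
  have hKT' : (K : ℝ) ≤ T := by exact_mod_cast hKT
  have hT0 : (0 : ℝ) < T := by linarith
  obtain ⟨l, hl⟩ : ∃ l, l = Real.log T := ⟨_, rfl⟩
  have hl1 : 1 ≤ 2 * l := by
    have h1 : Real.log 2 ≤ Real.log T := Real.log_le_log two_pos hT'
    have := Real.log_two_gt_d9
    rw [hl]
    linarith
  have hl0 : 0 < l := by linarith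
  have hlogsq : Real.log ((T : ℝ) ^ 2) = 2 * l := by rw [Real.log_pow, hl]; norm_num
  have e1 : 2 * K * Real.log (2 * K) ≤ d * K * l * 4 := by
    have h1 : Real.log (2 * K) ≤ 2 * l := by
      rw [← hlogsq]
      exact Real.log_le_log (by positivity) (by nlinarith)
    have h2 : 2 * K * Real.log (2 * K) ≤ 2 * K * (2 * l) := by gcongr
    have h3 : 0 ≤ K * l := by positivity
    nlinarith
  have e2 : ∑ k, sqDist (t k) 0 / ξ k ≤ d * K * l * (2 * (M / m)) := by
    have h1 : ∀ k ∈ Finset.univ, sqDist (t k) 0 / ξ k ≤ M / m := fun k _ =>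
      div_le_div₀ hM.le (h k).2.2.2.2 hm (h k).2.2.1
    have h2 := Finset.sum_le_card_nsmul _ _ _ h1
    rw [Finset.card_univ, Fintype.card_fin, nsmul_eq_mul] at h2
    have h3 : 0 ≤ K * (M / m) := by positivity
    have h4 : 1 ≤ d * (2 * l) := one_le_mul_of_one_le_of_one_le hd' hl1
    nlinarith [mul_le_mul_of_nonneg_left h4 h3]
  have hlogM : 0 ≤ Real.log (1 + 4 * M * β / α) :=
    Real.log_nonneg (le_add_of_nonneg_right (by positivity))
  have e3 : ∑ k, Real.log (1 + 4 * ξ k * β * (T : ℝ) ^ 2 / (α * n))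
      ≤ K * l * (2 * Real.log (1 + 4 * M * β / α) + 2) := by
    have h1 : ∀ k ∈ Finset.univ, Real.log (1 + 4 * ξ k * β * (T : ℝ) ^ 2 / (α * n))
        ≤ l * (2 * Real.log (1 + 4 * M * β / α) + 2) := fun k _ => by
      have hξ : 0 < ξ k := hm.trans_le (h k).2.2.1
      have h2 : 1 + 4 * ξ k * β * (T : ℝ) ^ 2 / (α * n) ≤ (1 + 4 * M * β / α) * T ^ 2 := by
        have h3 : 4 * ξ k * β * (T : ℝ) ^ 2 / (α * n) ≤ 4 * M * β * T ^ 2 / (α * 1) := by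
          have := (h k).2.2.2.1
          gcongr
        have h4 : 4 * M * β * T ^ 2 / (α * 1) = 4 * M * β / α * T ^ 2 := by ring
        nlinarith
      have h5 := Real.log_le_log (by positivity) h2
      rw [Real.log_mul (by positivity) (by positivity), hlogsq] at h5
      nlinarith
    have h2 := Finset.sum_le_card_nsmul _ _ _ h1
    rw [Finset.card_univ, Fintype.card_fin, nsmul_eq_mul] at h2
    linarith
  have e4 : ∑ k, (Real.log (T / b k) + b k - 1)
      ≤ d * K * l * (1 + 2 * |Real.log m| + 2 * M) := by
    have h1 : ∀ k ∈ Finset.univ, Real.log (T / b k) + b k - 1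
        ≤ l * (1 + 2 * |Real.log m| + 2 * M) := fun k _ => by
      have hb : 0 < b k := hm.trans_le (h k).1
      rw [Real.log_div hT0.ne' hb.ne', ← hl]
      have h2 := Real.log_le_log hm (h k).1
      have h3 := neg_abs_le (Real.log m)
      have h4 := (h k).2.1
      nlinarith [mul_le_mul_of_nonneg_right hl1 (abs_nonneg (Real.log m)),
        mul_le_mul_of_nonneg_right hl1 hM.le]
    have h2 := Finset.sum_le_card_nsmul _ _ _ h1
    rw [Finset.card_univ, Fintype.card_fin, nsmul_eq_mul] at h2
    refine h2.trans ?_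
    have h3 : 0 ≤ K * (l * (1 + 2 * |Real.log m| + 2 * M)) := by positivity
    nlinarith
  rw [cvMeta, ← hl]
  have e3' := mul_le_mul_of_nonneg_left e3 (show (0 : ℝ) ≤ d by positivity)
  calc _ = 1 / (β * T) * (2 * K * Real.log (2 * K) + ∑ k, sqDist (t k) 0 / ξ k
          + d * ∑ k, Real.log (1 + 4 * ξ k * β * (T : ℝ) ^ 2 / (α * n))
          + 4 * ∑ k, (Real.log (T / b k) + b k - 1)) := by ring
    _ ≤ 1 / (β * T) * (d * K * l * 4 + d * K * l * (2 * (M / m))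
          + d * (K * l * (2 * Real.log (1 + 4 * M * β / α) + 2))
          + 4 * (d * K * l * (1 + 2 * |Real.log m| + 2 * M))) := by gcongr
    _ = _ := by
        field_simp

/-! ### Meta-risk and meta-criterion expressed through explicit Gibbs posteriors and free energies
-/

namespace IsBoundedLoss

variable {Z : Type*} [MeasurableSpace Z] {d n T : ℕ} {ℓ : Z → (Fin d → ℝ) → ℝ} {C : ℝ}
  (hℓ : IsBoundedLoss ℓ C) {α : ℝ} (hα : 0 < α) (hn : 0 < n)
  {ρ : (Fin n → Z) → Measure (Fin d → ℝ) → Measure (Fin d → ℝ)}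
  (hρ : ∀ (S : Fin n → Z) (π : Measure (Fin d → ℝ)),
    IsProbabilityMeasure π → IsGibbsPosterior ℓ α S π (ρ S π))
include hℓ hα hn hρ

theorem metaRisk_eq (𝓓 : Measure (ProbabilityMeasure Z)) [IsProbabilityMeasure 𝓓]
    (π : Measure (Fin d → ℝ)) [IsProbabilityMeasure π] :
    metaRisk ℓ 𝓓 ρ π = ENNReal.ofReal (gibbsMetaRisk n ℓ (α * n) 𝓓 π) := by
  have ha : 0 < α * n := mul_pos hα (by exact_mod_cast hn)
  have h1 : ∀ P (S : Fin n → Z), ∫⁻ θ, ENNReal.ofReal (risk ℓ P θ) ∂(ρ S π)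
      = ENNReal.ofReal (∫ θ, risk ℓ P θ ∂(gibbs ℓ (α * n) S π)) := by
    intro P S
    have := hℓ.isProbabilityMeasure_gibbs ha hn S π
    rw [(hℓ.eq_gibbs hα hn (hρ S π inferInstance)).1, ofReal_integral_eq_lintegral_ofReal
      (integrable_of_mem_Icc (hℓ.measurable_risk_right P) (hℓ.risk_nonneg P) (hℓ.risk_le P))
      (Filter.Eventually.of_forall fun θ => hℓ.risk_nonneg P θ)]
  have h2 : ∀ P, ∫⁻ S : Fin n → Z, ENNReal.ofReal (∫ θ, risk ℓ P θ ∂(gibbs ℓ (α * n) S π))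
      ∂(sampleLaw n P) = ENNReal.ofReal (∫ S : Fin n → Z,
        ∫ θ, risk ℓ P θ ∂(gibbs ℓ (α * n) S π) ∂(sampleLaw n P)) := by
    intro P
    have hm : Measurable fun S : Fin n → Z => ∫ θ, risk ℓ P θ ∂(gibbs ℓ (α * n) S π) :=
      (hℓ.measurable_integral_risk_gibbs (Kernel.const Unit π)).comp
        (f := fun S : Fin n → Z => ((), P, S)) (by fun_prop)
    rw [ofReal_integral_eq_lintegral_ofReal (integrable_of_mem_Icc hm
      (fun S => (hℓ.integral_risk_gibbs_mem_Icc ha hn P S π).1)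
      (fun S => (hℓ.integral_risk_gibbs_mem_Icc ha hn P S π).2))
      (Filter.Eventually.of_forall fun S => (hℓ.integral_risk_gibbs_mem_Icc ha hn P S π).1)]
  have hm : Measurable fun P => ∫ S : Fin n → Z,
      ∫ θ, risk ℓ P θ ∂(gibbs ℓ (α * n) S π) ∂(sampleLaw n P) :=
    (hℓ.measurable_integral_sample_gibbs (Kernel.const Unit π) n (α * n)).comp
      (f := fun P => ((), P)) (by fun_prop)
  rw [metaRisk]
  simp only [h1, h2]
  rw [gibbsMetaRisk, ofReal_integral_eq_lintegral_ofReal (integrable_of_mem_Icc hm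
    (fun P => (hℓ.integral_sample_gibbs_mem_Icc ha hn π P).1)
    (fun P => (hℓ.integral_sample_gibbs_mem_Icc ha hn π P).2))
    (Filter.Eventually.of_forall fun P => (hℓ.integral_sample_gibbs_mem_Icc ha hn π P).1)]

theorem lintegral_metaRisk_eq (𝓓 : Measure (ProbabilityMeasure Z)) [IsProbabilityMeasure 𝓓]
    {Q : Measure (MixParam d)} (hQ : Q ∈ hyperSet d T) :
    ∫⁻ m, metaRisk ℓ 𝓓 ρ (mixture m) ∂Q
      = ∫⁻ m, ENNReal.ofReal (gibbsMetaRisk n ℓ (α * n) 𝓓 (priorKernel d m)) ∂Q := by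
  refine lintegral_congr_ae ?_
  filter_upwards [ae_mixture_univ_of_mem_hyperSet hQ] with m hm
  rw [← priorKernel_apply hm]
  exact hℓ.metaRisk_eq hα hn hρ 𝓓 _

theorem metaCriterion_eq (hT : 0 < T) {β : ℝ} {Q Λ : Measure (MixParam d)}
    (hQ : Q ∈ hyperSet d T) (S : Fin T → Fin n → Z) :
    metaCriterion ℓ α β ρ Λ S Q
      = ENNReal.ofReal ((∑ t, ∫ m, freeEnergy ℓ (α * n) (S t) (priorKernel d m) ∂Q) / T)
        + klDiv Q Λ / ENNReal.ofReal (β * T) := by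
  have ha : 0 < α * n := mul_pos hα (by exact_mod_cast hn)
  have := isProbabilityMeasure_of_mem_hyperSet hQ
  have hF : ∀ (S : Fin n → Z) m, 0 ≤ freeEnergy ℓ (α * n) S (priorKernel d m)
    ∧ freeEnergy ℓ (α * n) S (priorKernel d m) ≤ C := fun S m =>
    hℓ.freeEnergy_mem_Icc ha hn S (priorKernel d m)
  have h1 : ∀ t, ∫⁻ m, penEmpRisk ℓ α (S t) (ρ (S t) (mixture m)) (mixture m) ∂Q
      = ENNReal.ofReal (∫ m, freeEnergy ℓ (α * n) (S t) (priorKernel d m) ∂Q) := by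
    intro t
    rw [ofReal_integral_eq_lintegral_ofReal
      (integrable_of_mem_Icc (hℓ.measurable_freeEnergy_comp (priorKernel d) (S t) (α * n))
        (fun m => (hF (S t) m).1) (fun m => (hF (S t) m).2))
      (Filter.Eventually.of_forall fun m => (hF (S t) m).1)]
    refine lintegral_congr_ae ?_
    filter_upwards [ae_mixture_univ_of_mem_hyperSet hQ] with m hm
    rw [← priorKernel_apply hm]
    exact (hℓ.eq_gibbs hα hn (hρ (S t) (priorKernel d m) inferInstance)).2
  rw [metaCriterion]
  simp only [h1]
  rw [← ENNReal.ofReal_sum_of_nonneg fun t _ => integral_nonneg fun m => (hF (S t) m).1,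
    ENNReal.ofReal_div_of_pos (by exact_mod_cast hT), ENNReal.ofReal_natCast]

/-- A competitor of finite divergence has a finite criterion, which forces a finite divergence on
the minimizer; the extended-valued comparison then becomes a real one, multiplied through by αT. -/
theorem criterion_le (hT : 0 < T) {Q Qh Λ : Measure (MixParam d)} (hQ : Q ∈ hyperSet d T)
    (hQh : Qh ∈ hyperSet d T) (hKL : klDiv Q Λ ≠ ∞) (S : Fin T → Fin n → Z)
    (h : metaCriterion ℓ α α ρ Λ S Qh ≤ metaCriterion ℓ α α ρ Λ S Q) :
    klDiv Qh Λ ≠ ∞ ∧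
      α * ∑ t, ∫ m, freeEnergy ℓ (α * n) (S t) (priorKernel d m) ∂Qh + (klDiv Qh Λ).toReal
        ≤ α * ∑ t, ∫ m, freeEnergy ℓ (α * n) (S t) (priorKernel d m) ∂Q + (klDiv Q Λ).toReal := by
  have ha : 0 < α * n := mul_pos hα (by exact_mod_cast hn)
  have hT' : (0 : ℝ) < T := by exact_mod_cast hT
  have hαT : 0 < α * T := mul_pos hα hT'
  rw [hℓ.metaCriterion_eq hα hn hρ hT hQ, hℓ.metaCriterion_eq hα hn hρ hT hQh] at h
  have hfin : klDiv Q Λ / ENNReal.ofReal (α * T) ≠ ∞ :=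
    ENNReal.div_ne_top hKL (ENNReal.ofReal_pos.mpr hαT).ne'
  have hKL' : klDiv Qh Λ ≠ ∞ := by
    intro htop
    rw [htop, ENNReal.top_div_of_ne_top ENNReal.ofReal_ne_top, add_top, top_le_iff] at h
    exact ENNReal.add_ne_top.mpr ⟨ENNReal.ofReal_ne_top, hfin⟩ h
  refine ⟨hKL', ?_⟩
  have hnn : ∀ ν : Measure (MixParam d),
      0 ≤ (∑ t, ∫ m, freeEnergy ℓ (α * n) (S t) (priorKernel d m) ∂ν) / T := fun ν =>
    div_nonneg (Finset.sum_nonneg fun t _ => integral_nonneg fun m =>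
      (hℓ.freeEnergy_mem_Icc ha hn (S t) (priorKernel d m)).1) hT'.le
  rw [← ENNReal.ofReal_toReal hKL, ← ENNReal.ofReal_toReal hKL', ← ENNReal.ofReal_div_of_pos hαT,
    ← ENNReal.ofReal_div_of_pos hαT, ← ENNReal.ofReal_add (hnn _) (by positivity),
    ← ENNReal.ofReal_add (hnn _) (by positivity), ENNReal.ofReal_le_ofReal_iff
    (add_nonneg (hnn _) (by positivity))] at h
  have h2 := mul_le_mul_of_nonneg_left h hαT.le
  have e : ∀ A B : ℝ, α * T * (A / T + B / (α * T)) = α * A + B := fun A B => by field_simp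
  rwa [e, e] at h2

end IsBoundedLoss

end

section

/-! ### The oracle bound -/

/-- The rate b trades the dimension term d log(1 + 4αnL/b) against b Σ. When Σ ≤ n/T², the rate b =
T (components of variance of order 1/T) makes both of order 1/T, using log(1 + u) ≤ u; otherwise b =
1. -/
theorem exists_rate_le_cvGaussian {d n T : ℕ} {α L : ℝ} (hα : 0 < α) (hL : 0 < L) (hn : 0 < n)
    (hT : 1 ≤ T) {Sig : ℝ≥0∞} (hS : Sig ≠ ∞) :
    ∃ b : ℝ, 1 ≤ b ∧ b ≤ T ∧ ENNReal.ofReal (2 * (1 / (α * n) *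
        (d / 2 * Real.log (1 + 4 * (α * n) * L / b)) + b / (2 * (α * n)) * Sig.toReal))
      ≤ cvGaussian α L d Sig n T := by
  have hT' : (1 : ℝ) ≤ T := by exact_mod_cast hT
  have hT0 : (0 : ℝ) < T := by linarith
  have hn' : (0 : ℝ) < n := by exact_mod_cast hn
  have hq : 0 ≤ Sig.toReal := ENNReal.toReal_nonneg
  rw [cvGaussian]
  split_ifs with h
  · refine ⟨T, hT', le_rfl, ENNReal.ofReal_le_ofReal ?_⟩
    have h1 : Sig.toReal ≤ n / T ^ 2 := ENNReal.toReal_le_of_le_ofReal (by positivity) h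
    have h2 : Real.log (1 + 4 * (α * n) * L / T) ≤ 4 * (α * n) * L / T :=
      (Real.log_le_sub_one_of_pos (by positivity)).trans (by linarith)
    calc 2 * (1 / (α * n) * (d / 2 * Real.log (1 + 4 * (α * n) * L / T))
          + T / (2 * (α * n)) * Sig.toReal)
        ≤ 2 * (1 / (α * n) * (d / 2 * (4 * (α * n) * L / T))
          + T / (2 * (α * n)) * (n / T ^ 2)) := by gcongr
      _ = 4 * L * d / T + 1 / (α * T) := by
          field_simp
      _ ≤ 8 * L * d / T + 4 / (α * T) := by
          gcongr <;> norm_num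
  · refine ⟨1, le_rfl, hT', ?_⟩
    rw [← ENNReal.ofReal_toReal hS, ENNReal.toReal_ofReal hq, ← ENNReal.ofReal_mul (by positivity)]
    have hlog : 0 ≤ Real.log (1 + 4 * α * L * n) :=
      Real.log_nonneg (le_add_of_nonneg_right (by positivity))
    rw [← ENNReal.ofReal_add (by positivity) (by positivity)]
    refine ENNReal.ofReal_le_ofReal ?_
    rw [show 4 * (α * n) * L / 1 = 4 * α * L * n by ring]
    calc 2 * (1 / (α * n) * (d / 2 * Real.log (1 + 4 * α * L * n))
          + 1 / (2 * (α * n)) * Sig.toReal)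
        = 1 * d / (α * n) * Real.log (1 + 4 * α * L * n) + 1 / (α * n) * Sig.toReal := by
          field_simp
      _ ≤ 2 * d / (α * n) * Real.log (1 + 4 * α * L * n) + 4 / (α * n) * Sig.toReal := by
          gcongr <;> norm_num

/-- Since αC ≤ 1 and 4 log(2K) ≥ 4 log 2 > 2 ≥ n, the bound on the loss itself is below CV_finite.
-/
theorem le_cvFinite {α C c : ℝ} (hC : 0 < C) (hc : 0 < c) (hα : α = 1 / (C + c)) {K n : ℕ}
    (hK : 1 ≤ K) (hn : 1 ≤ n) (hn2 : n ≤ 2) : C ≤ cvFinite α K n := by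
  have hn' : (1 : ℝ) ≤ n := by exact_mod_cast hn
  have hn2' : (n : ℝ) ≤ 2 := by exact_mod_cast hn2
  have hK' : (1 : ℝ) ≤ K := by exact_mod_cast hK
  have h1 : Real.log 2 ≤ Real.log (2 * K) := Real.log_le_log two_pos (by linarith)
  have h2 := Real.log_two_gt_d9
  rw [cvFinite, hα, le_div_iff₀ (by positivity)]
  have h3 : C * (1 / (C + c) * n) ≤ n := by
    have : C / (C + c) ≤ 1 := by rw [div_le_one (by positivity)]; linarith
    calc C * (1 / (C + c) * n) = C / (C + c) * n := by ring
      _ ≤ 1 * n := by gcongr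
      _ = n := one_mul _
  linarith

namespace IsBoundedLoss

variable {Z : Type*} [MeasurableSpace Z] {d n T : ℕ} {ℓ : Z → (Fin d → ℝ) → ℝ} {C : ℝ}
  (hℓ : IsBoundedLoss ℓ C) {α : ℝ}
  {ρ : (Fin n → Z) → Measure (Fin d → ℝ) → Measure (Fin d → ℝ)}
  (hρ : ∀ (S : Fin n → Z) (π : Measure (Fin d → ℝ)),
    IsProbabilityMeasure π → IsGibbsPosterior ℓ α S π (ρ S π))
  (𝓓 : Measure (ProbabilityMeasure Z)) [IsProbabilityMeasure 𝓓]
include hℓ hρ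

theorem expectedMetaRisk_eq (hα : 0 < α) (hn : 0 < n)
    {Qhat : (Fin T → Fin n → Z) → Measure (MixParam d)} (hQ : ∀ S, Qhat S ∈ hyperSet d T) :
    expectedMetaRisk ℓ 𝓓 ρ Qhat = ∫⁻ P : Fin T → ProbabilityMeasure Z,
      ∫⁻ S : Fin T → Fin n → Z,
        ∫⁻ m, ENNReal.ofReal (gibbsMetaRisk n ℓ (α * n) 𝓓 (priorKernel d m)) ∂(Qhat S)
          ∂(Measure.pi fun t => sampleLaw n (P t)) ∂(Measure.pi fun _ => 𝓓) := by
  rw [expectedMetaRisk]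
  simp only [fun S => hℓ.lintegral_metaRisk_eq hα hn hρ 𝓓 (hQ S)]

theorem expectedMetaRisk_le (hα : 0 < α) (hn : 0 < n)
    {Qhat : (Fin T → Fin n → Z) → Measure (MixParam d)} (hQ : ∀ S, Qhat S ∈ hyperSet d T) :
    expectedMetaRisk ℓ 𝓓 ρ Qhat ≤ ENNReal.ofReal C := by
  have ha : 0 < α * n := mul_pos hα (by exact_mod_cast hn)
  have := fun S => isProbabilityMeasure_of_mem_hyperSet (hQ S)
  rw [hℓ.expectedMetaRisk_eq hρ 𝓓 hα hn hQ]
  calc _ ≤ ∫⁻ _ : Fin T → ProbabilityMeasure Z, ENNReal.ofReal C ∂(Measure.pi fun _ => 𝓓) := by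
        refine lintegral_mono fun P => ?_
        calc _ ≤ ∫⁻ _ : Fin T → Fin n → Z, ENNReal.ofReal C
              ∂(Measure.pi fun t => sampleLaw n (P t)) := by
              refine lintegral_mono fun S => ?_
              calc _ ≤ ∫⁻ _, ENNReal.ofReal C ∂(Qhat S) := lintegral_mono fun m =>
                    ENNReal.ofReal_le_ofReal (hℓ.gibbsMetaRisk_mem_Icc 𝓓 ha hn _).2
                _ = _ := by simp
          _ = _ := by simp
    _ = _ := by simp

theorem expectedMetaRisk_le_of_num_components {c : ℝ} (hC : 0 < C) (hc : 0 < c)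
    (hα : α = 1 / (C + c)) (hn : 3 ≤ n) (hT : 1 ≤ T)
    {θstar : ProbabilityMeasure Z → Fin d → ℝ} (hθ : Measurable θstar)
    (hmin : ∀ᵐ P ∂𝓓, risk ℓ P (θstar P) = bestRisk ℓ P)
    (hB : ∀ᵐ (P : ProbabilityMeasure Z) ∂𝓓, ∀ θ : Fin d → ℝ,
      ∫ z, |ℓ z θ - ℓ z (θstar P)| ^ 2 ∂(P : Measure Z) ≤ c * (risk ℓ P θ - bestRisk ℓ P))
    {L : ℝ} (hL : 0 < L)
    (hQ : ∀ᵐ P ∂𝓓, ∀ θ, risk ℓ P θ - bestRisk ℓ P ≤ L * sqDist θ (θstar P))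
    {ξ0 b0 : ∀ K : ℕ, Fin K → ℝ}
    (hξ0 : ∀ K ∈ Finset.Icc 1 T, ∀ k, 0 < ξ0 K k) (hb0 : ∀ K ∈ Finset.Icc 1 T, ∀ k, 0 < b0 K k)
    {Qhat : (Fin T → Fin n → Z) → Measure (MixParam d)}
    (hQhat : IsMetaGibbs ℓ α α ρ (hyperPrior d T ξ0 b0) Qhat)
    {K : ℕ} (hK : K ∈ Finset.Icc 1 T) {τ : Fin K → Fin d → ℝ} (hτ : quantError 𝓓 θstar τ ≠ ∞) :
    expectedMetaRisk ℓ 𝓓 ρ Qhat ≤ oracleRisk ℓ 𝓓 + (ENNReal.ofReal (cvFinite α K n)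
      + (K : ℝ≥0∞) * cvGaussian α L d (quantError 𝓓 θstar τ) n T
      + ENNReal.ofReal (cvMetaUnknown α α T n d K (b0 K) (ξ0 K) τ)) := by
  have hα0 : 0 < α := by rw [hα]; positivity
  have hn0 : 0 < n := by omega
  have hn' : (0 : ℝ) < n := by exact_mod_cast hn0
  have hT' : (0 : ℝ) < T := by exact_mod_cast hT
  have ha : 0 < α * n := mul_pos hα0 hn'
  have hK0 : 0 < K := (Finset.mem_Icc.mp hK).1
  obtain ⟨b, hb1, hbT, hbG⟩ := exists_rate_le_cvGaussian (d := d) hα0 hL hn0 hT hτ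
  have hb : 0 < b := by linarith
  -- The spread of the means required by `le_cvMetaUnknown`; the inverse variance is raised from
  -- 1/ξ0 by T²/n.
  obtain ⟨ξ, hξ⟩ : ∃ ξ : Fin K → ℝ, ∀ k, ξ k = ξ0 K k / (1 + T ^ 2 / n * ξ0 K k) :=
    ⟨_, fun _ => rfl⟩
  have hξpos : ∀ k, 0 < ξ k := fun k => by
    have := hξ0 K hK k
    rw [hξ]
    positivity
  have hΛ := hyperPrior_mem_hyperSet (d := d) hT hξ0 hb0
  have := isProbabilityMeasure_of_mem_hyperSet hΛ
  obtain ⟨Q, hQdef⟩ : ∃ Q : Measure (MixParam d),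
    Q = (compHyper (fun _ => 1) τ ξ fun _ => b).map (Sigma.mk K) := ⟨_, rfl⟩
  have hQmem : Q ∈ hyperSet d T := hQdef ▸ map_compHyper_mem_hyperSet hK τ hξpos fun _ => hb
  have := isProbabilityMeasure_of_mem_hyperSet hQmem
  have hKL := klDiv_hyperPrior_le hK hξ0 hb0 (τ := τ) hξpos fun _ => hb
  have hF := hℓ.lintegral_meanFreeEnergy_le ha hL hn0 𝓓 hθ
    (by filter_upwards [hmin, hQ] with P h1 h2; rwa [h1]) hK0 (τ := τ) hξpos hb
  rw [← hQdef] at hKL hF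
  have hKLtop : klDiv Q (hyperPrior d T ξ0 b0) ≠ ∞ :=
    (hKL.trans_lt (ENNReal.add_lt_top.mpr ⟨ENNReal.ofReal_lt_top, ENNReal.ofReal_lt_top⟩)).ne
  have hcrit := fun S => hℓ.criterion_le hα0 hn0 hρ hT hQmem (hQhat S).1 hKLtop S
    ((hQhat S).2 Q hQmem)
  have hmain := hℓ.lintegral_gibbsMetaRisk_le (priorKernel d) 𝓓 hC hc hα hn hT hθ hmin hB
    (hyperPrior d T ξ0 b0) Q Qhat (fun S => isProbabilityMeasure_of_mem_hyperSet (hQhat S).1)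
    (fun S => (hcrit S).1) (fun S => (hcrit S).2)
  rw [hℓ.expectedMetaRisk_eq hρ 𝓓 hα0 hn0 fun S => (hQhat S).1]
  refine hmain.trans ?_
  have hr : Measurable fun P => risk ℓ P (θstar P) := hℓ.measurable_risk_comp hθ
  have hO : oracleRisk ℓ 𝓓 = ENNReal.ofReal (∫ P, risk ℓ P (θstar P) ∂𝓓) := by
    rw [ofReal_integral_eq_lintegral_ofReal
      (integrable_of_mem_Icc hr (fun P => hℓ.risk_nonneg P _) (fun P => hℓ.risk_le P _))
      (Filter.Eventually.of_forall fun P => hℓ.risk_nonneg P _), oracleRisk]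
    exact lintegral_congr_ae (hmin.mono fun P hP => by simp only [hP])
  rw [hO]
  have hO0 : 0 ≤ ∫ P, risk ℓ P (θstar P) ∂𝓓 := integral_nonneg fun P => hℓ.risk_nonneg P _
  obtain ⟨O, hOdef⟩ : ∃ O, O = ∫ P, risk ℓ P (θstar P) ∂𝓓 := ⟨_, rfl⟩
  rw [← hOdef] at hF hO0 ⊢
  have hlogK : 0 ≤ Real.log (2 * K) := by
    have : (1 : ℝ) ≤ K := by exact_mod_cast hK0
    exact Real.log_nonneg (by linarith)
  have hlog : 0 ≤ Real.log (1 + 4 * (α * n) * L / b) :=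
    Real.log_nonneg (le_add_of_nonneg_right (by positivity))
  have hΞ : 0 ≤ ∑ k, ξ k := Finset.sum_nonneg fun k _ => (hξpos k).le
  have hF' : ∫ m, meanFreeEnergy n ℓ (α * n) 𝓓 (priorKernel d m) ∂Q
      ≤ O + 1 / (α * n) * (2 * Real.log (2 * K) + d / 2 * Real.log (1 + 4 * (α * n) * L / b)
        + b / 2 * (d * ∑ k, ξ k)) + b / (2 * (α * n)) * (quantError 𝓓 θstar τ).toReal := by
    rw [← ofReal_integral_eq_lintegral_ofReal (integrable_of_mem_Icc
      (hℓ.measurable_meanFreeEnergy (priorKernel d) 𝓓 n (α * n))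
      (fun m => (hℓ.meanFreeEnergy_mem_Icc 𝓓 ha hn0 _).1)
      (fun m => (hℓ.meanFreeEnergy_mem_Icc 𝓓 ha hn0 _).2))
      (Filter.Eventually.of_forall fun m => (hℓ.meanFreeEnergy_mem_Icc 𝓓 ha hn0 _).1),
      ← ENNReal.ofReal_toReal hτ, ← ENNReal.ofReal_mul (by positivity),
      ← ENNReal.ofReal_add hO0 (by positivity), ← ENNReal.ofReal_add (by positivity)
      (by positivity), ENNReal.ofReal_le_ofReal_iff (by positivity)] at hF
    exact hF
  have hKL0 : 0 ≤ ∑ k, (1 / 2 * (d * (Real.log (ξ0 K k / ξ k) - 1 + ξ k / ξ0 K k)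
      + sqDist (τ k) 0 / ξ0 K k) + 2 * (Real.log (b / b0 K k) + b0 K k / b - 1)) := by
    refine Finset.sum_nonneg fun k _ => add_nonneg
      (klIsoGaussian_nonneg d (hξpos k) (hξ0 K hK k) (sqDist_nonneg _ _)) ?_
    have h1 := log_add_inv_sub_one_nonneg (div_pos hb (hb0 K hK k))
    rw [inv_div] at h1
    linarith
  have hKL' : (klDiv Q (hyperPrior d T ξ0 b0)).toReal
      ≤ ∑ k, (1 / 2 * (d * (Real.log (ξ0 K k / ξ k) - 1 + ξ k / ξ0 K k)
      + sqDist (τ k) 0 / ξ0 K k) + 2 * (Real.log (b / b0 K k) + b0 K k / b - 1))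
        + Real.log T := by
    have hlT : 0 ≤ Real.log T := Real.log_nonneg (by exact_mod_cast hT)
    rw [← ENNReal.ofReal_add hKL0 hlT] at hKL
    exact ENNReal.toReal_le_of_le_ofReal (by positivity) hKL
  have hcv := le_cvMetaUnknown (d := d) hα0 hn0 hK0 hb1 hbT (hξ0 K hK) (hb0 K hK) τ hξ
  have hKL'' := div_le_div_of_nonneg_right (mul_le_mul_of_nonneg_left hKL' zero_le_two)
    (mul_pos hα0 hT').le
  have hsplit : 2 * (1 / (α * n) * (2 * Real.log (2 * K)
        + d / 2 * Real.log (1 + 4 * (α * n) * L / b) + b / 2 * (d * ∑ k, ξ k))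
        + b / (2 * (α * n)) * (quantError 𝓓 θstar τ).toReal)
      = cvFinite α K n + 2 * (1 / (α * n) * (d / 2 * Real.log (1 + 4 * (α * n) * L / b))
        + b / (2 * (α * n)) * (quantError 𝓓 θstar τ).toReal) + b / (α * n) * (d * ∑ k, ξ k) := by
    rw [cvFinite]
    field_simp
    ring
  refine (ENNReal.ofReal_le_ofReal (q := O + (cvFinite α K n + 2 * (1 / (α * n) *
    (d / 2 * Real.log (1 + 4 * (α * n) * L / b))
      + b / (2 * (α * n)) * (quantError 𝓓 θstar τ).toReal)
      + cvMetaUnknown α α T n d K (b0 K) (ξ0 K) τ)) (by linarith)).trans ?_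
  refine ENNReal.ofReal_add_le.trans (add_le_add le_rfl (ENNReal.ofReal_add_le.trans
    (add_le_add (ENNReal.ofReal_add_le.trans (add_le_add le_rfl ?_)) le_rfl)))
  -- The localization used a single component per task, so one copy of `cvGaussian` suffices and K ≥
  -- 1 gives the stated multiple.
  refine hbG.trans (le_mul_of_one_le_left' ?_)
  exact_mod_cast hK0

end IsBoundedLoss

end

end MetaPAC
end

/-! ### The main theorem -/

theorem mainTheorem6 {Z : Type*} [MeasurableSpace Z] {d n T : ℕ} (hn : 1 ≤ n) (hT : 1 ≤ T)
    -- the bounded loss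
    (ℓ : Z → (Fin d → ℝ) → ℝ) (hℓ_meas : Measurable (Function.uncurry ℓ))
    (C : ℝ) (hC : 0 < C) (hℓ_nonneg : ∀ z θ, 0 ≤ ℓ z θ) (hℓ_le : ∀ z θ, ℓ z θ ≤ C)
    -- the distribution of the tasks, and the minimizers of their risks
    (𝓓 : Measure (ProbabilityMeasure Z))
    [IsProbabilityMeasure 𝓓]
    (θstar : ProbabilityMeasure Z → Fin d → ℝ) (hθ_meas : Measurable θstar)
    (hθ_min : ∀ᵐ P ∂𝓓, MetaPAC.risk ℓ P (θstar P) = MetaPAC.bestRisk ℓ P)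
    -- the Bernstein condition
    (c : ℝ) (hc : 0 < c)
    (hBernstein : ∀ᵐ (P : ProbabilityMeasure Z) ∂𝓓, ∀ θ : Fin d → ℝ,
      ∫ z, |ℓ z θ - ℓ z (θstar P)| ^ 2 ∂(P : Measure Z)
        ≤ c * (MetaPAC.risk ℓ P θ - MetaPAC.bestRisk ℓ P))
    -- the quadratic upper bound on the excess risk
    (L : ℝ) (hL : 0 < L)
    (hQuadratic : ∀ᵐ P ∂𝓓, ∀ θ : Fin d → ℝ,
      MetaPAC.risk ℓ P θ - MetaPAC.bestRisk ℓ P ≤ L * MetaPAC.sqDist θ (θstar P))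
    -- the temperatures
    (α β : ℝ) (hα : α = 1 / (C + c)) (hβ : β = 1 / (C + c))
    -- the Gibbs posteriors within the tasks
    (ρ : (Fin n → Z) → Measure (Fin d → ℝ) → Measure (Fin d → ℝ))
    (hρ : ∀ (S : Fin n → Z) (π : Measure (Fin d → ℝ)),
      IsProbabilityMeasure π → MetaPAC.IsGibbsPosterior ℓ α S π (ρ S π))
    -- the parameters of the prior on priors
    (ξ0 b0 : ∀ K : ℕ, Fin K → ℝ)
    (hξ0 : ∀ K ∈ Finset.Icc 1 T, ∀ k, 0 < ξ0 K k) (hb0 : ∀ K ∈ Finset.Icc 1 T, ∀ k, 0 < b0 K k)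
    -- the Gibbs distribution on priors
    (Qhat : Kernel (Fin T → Fin n → Z) (MetaPAC.MixParam d))
    (hQhat : MetaPAC.IsMetaGibbs ℓ α β ρ (MetaPAC.hyperPrior d T ξ0 b0) (fun S => Qhat S))
    -- optimal centres for each number of components
    (τ : ∀ K : ℕ, Fin K → Fin d → ℝ)
    (hτ : ∀ K ∈ Finset.Icc 1 T,
      MetaPAC.quantError 𝓓 θstar (τ K) = MetaPAC.sigmaK 𝓓 θstar K) :
    (MetaPAC.expectedMetaRisk ℓ 𝓓 ρ (fun S => Qhat S)
      ≤ MetaPAC.oracleRisk ℓ 𝓓 +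
        ⨅ K ∈ Finset.Icc 1 T,
          (ENNReal.ofReal (MetaPAC.cvFinite α K n)
            + (K : ENNReal) * MetaPAC.cvGaussian α L d (MetaPAC.sigmaK 𝓓 θstar K) n T
            + ENNReal.ofReal (MetaPAC.cvMetaUnknown α β T n d K (b0 K) (ξ0 K) (τ K)))) ∧
    -- the meta term is `O(d K log T / T)`
    (∀ m M : ℝ, 0 < m → ∃ A : ℝ, ∀ T' n' d' K : ℕ, 2 ≤ T' → 1 ≤ n' → 1 ≤ d' → 1 ≤ K → K ≤ T' →
      ∀ (b ξ : Fin K → ℝ) (t : Fin K → Fin d' → ℝ),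
        (∀ k, m ≤ b k ∧ b k ≤ M ∧ m ≤ ξ k ∧ ξ k ≤ M ∧ MetaPAC.sqDist (t k) 0 ≤ M) →
        MetaPAC.cvMeta α β T' n' d' K b ξ t ≤ A * (d' * K * Real.log T' / T')) := by
  have hℓ : MetaPAC.IsBoundedLoss ℓ C := ⟨hℓ_meas, hℓ_nonneg, hℓ_le⟩
  have hα0 : 0 < α := by rw [hα]; positivity
  obtain rfl : β = α := hβ.trans hα.symm
  refine ⟨?_, fun m M hm => MetaPAC.exists_cvMeta_le hα0 hα0 M hm⟩
  -- Moving the oracle risk to the left isolates the infimum, so each K can be treated on its own.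
  rw [← tsub_le_iff_left]
  refine le_iInf₂ fun K hK => tsub_le_iff_left.mpr ?_
  have hK1 : 1 ≤ K := (Finset.mem_Icc.mp hK).1
  rcases Nat.lt_or_ge n 3 with hn3 | hn3
  -- With one or two observations the linearization of the n-th root is not available, but the
  -- trivial bound C is enough.
  · calc _ ≤ ENNReal.ofReal C := hℓ.expectedMetaRisk_le hρ 𝓓 hα0 hn fun S => (hQhat S).1
      _ ≤ ENNReal.ofReal (MetaPAC.cvFinite β K n) :=
        ENNReal.ofReal_le_ofReal (MetaPAC.le_cvFinite hC hc hα hK1 hn (by omega))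
      _ ≤ _ := by
        rw [add_assoc (ENNReal.ofReal _)]
        exact le_add_of_le_right le_self_add
  · by_cases htop : MetaPAC.quantError 𝓓 θstar (τ K) = ⊤
    -- An infinite Σ_K falls in the second case of `cvGaussian`, where its coefficient 4/(αn) is
    -- positive; as K ≠ 0, the right side is infinite.
    · rw [← hτ K hK, htop, MetaPAC.cvGaussian, if_neg (by simp), ENNReal.mul_top, add_top,
        ENNReal.mul_top (by simpa using Nat.one_le_iff_ne_zero.mp hK1)]
      · simp
      · have : (0 : ℝ) < n := by exact_mod_cast hn
        exact (ENNReal.ofReal_pos.mpr (by positivity)).ne'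
    · rw [← hτ K hK]
      exact hℓ.expectedMetaRisk_le_of_num_components hρ 𝓓 hC hc hα hn3 hT hθ_meas hθ_min
        hBernstein hL hQuadratic hξ0 hb0 hQhat hK htop
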